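/- **Theorem (matrix Riemann–Hilbert problem).** Let $\epsilon\in\mathbb R$, $q_0>0$, $q_\pm\in\mathbb C$ with $|q_\pm|=q_0$, and let $q:\mathbb R\times\mathbb R\to\mathbb C$ be a classical solution (the derivatives in the equation exist and $\partial_x^jq$, $j\le 5$, are jointly continuous) of $$iq_t+2(|q|^2-q_0^2)q-i\epsilon q_{xxxxx}-10i\epsilon|q|^2q_{xxx}-20i\epsilon q_xq^*q_{xx}-30i\epsilon|q|^4q_x-10i\epsilon(|q_x|^2q)_x+q_{xx}-iq_x=0$$ such that, as $x\to\pm\infty$, $q\to q_\pm$ and $\partial_x^jq\to0$ $(1\le j\le4)$ locally uniformly in $t$, and such that for all $t,a$, $q(\cdot,t)-q_-\in L^1(-\infty,a)$ and $q(\cdot,t)-q_+\in L^1(a,\infty)$. Notation. $\sigma_3=\mathrm{diag}(1,-1)$; $k(z)=\frac12(z-q_0^2/z)$, $\lambda(z)=\frac12(z+q_0^2/z)$, $\gamma(z)=1+q_0^2/z^2$; $$\theta(x,t;z)=\lambda\big[x+(16\epsilon k^4-8\epsilon q_0^2k^2+2k+6\epsilon q_0^4+1)t\big];$$ $\Sigma=\mathbb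 R\cup\{|z|=q_0\}$, $\Sigma'=\Sigma\setminus\{0,iq_0,-iq_0\}$, $D^\pm=\{z:\pm(|z|^2-q_0^2)\,\mathrm{Im}\,z>0\}$; $Q_\pm=\begin{pmatrix}0&q_\pm\\-q_\pm^*&0\end{pmatrix}$, $E_\pm=I-\frac iz\sigma_3Q_\pm$. The Lax pair is $\phi_x=U\phi$, $\phi_t=V\phi$ with $U=\begin{pmatrix}-ik&q\\-q^*&ik\end{pmatrix}$, $V=\begin{pmatrix}V_{11}&V_{12}\\-V_{12}^*&-V_{11}\end{pmatrix}$ (in $V_{12}^*$ only the coefficients of the powers of $k$ are conjugated), where $$\begin{aligned}V_{11}={}&-16i\epsilon k^5+8i\epsilon k^3|q|^2+4\epsilon k^2(qq_x^*-q_xq^*)-ik+i(|q|^2-q_0^2)-2ik^2-6i\epsilon k|q|^4\\&-2i\epsilon k(qq_{xx}^*+q_{xx}q^*-|q_x|^2)+\epsilon(q_{xxx}q^*-qq_{xxx}^*+q_xq_{xx}^*-q_{xx}q_x^*+6|q|^2q^*q_x-6|q|^2q_x^*q),\\V_{12}={}&16\epsilon k^4q+8i\epsilon k^3q_x-4\epsilon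 k^2(q_{xx}+2|q|^2q)-2i\epsilon k(q_{xxx}+6|q|^2q_x)+2kq+iq_x+q\\&+\epsilon(q_{xxxx}+8|q|^2q_{xx}+2q^2q_{xx}^*+4|q_x|^2q+6q_x^2q^*+6|q|^4q).\end{aligned}$$ The Jost functions are the solutions $\phi_\pm(x,t;z)$ of both equations whose modifications $u_\pm=\phi_\pm e^{i\theta\sigma_3}$ satisfy $u_\pm\to E_\pm$ as $x\to\pm\infty$, column by column. The columns $\phi_{-,1},\phi_{+,2}$ exist and are unique for $z\in D^+\cup\Sigma'$, and so are $\phi_{-,2},\phi_{+,1}$ for $z\in D^-\cup\Sigma'$. There is a matrix $S(z)=(s_{ij}(z))$, independent of $(x,t)$, with $\phi_+=\phi_-S$ on $\Sigma'$; the entries $s_{11}$, $s_{22}$ are defined on $D^-\cup\Sigma'$ and $D^+\cup\Sigma'$, respectively, by $s_{11}\gamma=\det(\phi_{+,1},\phi_{-,2})$ and $s_{22}\gamma=\det(\phi_{-,1},\phi_{+,2})$, which do not depend on $(x,t)$. Put $\rho=s_{21}/s_{11}$, $\tilde\rho=s_{12}/s_{22}$ and $$M=M^+=\Big(u_{-,1},\frac{u_{+,2}}{s_{22}}\Big)\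 \text{on }D^+,\qquad M=M^-=\Big(\frac{u_{+,1}}{s_{11}},u_{-,2}\Big)\ \text{on }D^-.$$ Then for all $x,t\in\mathbb R$: 1. $M(x,t;\cdot)$ is meromorphic in $\mathbb C\setminus\Sigma$. 2. At every $z\in\Sigma'$ with $s_{11}(z)\ne0\ne s_{22}(z)$, $M$ has boundary values from $D^\pm$; these are given by the same formulas for $M^\pm$, and $$M^+=M^-(I-G),\qquad G=e^{-i\theta\sigma_3}\begin{pmatrix}0&-\tilde\rho\\\rho&\rho\tilde\rho\end{pmatrix}e^{i\theta\sigma_3}.$$ 3. If $q_x(\cdot,t)\in L^1(\mathbb R)$, then $M^\pm=I+O(1/z)$ as $z\to\infty$ and $M^\pm=-\frac iz\sigma_3Q_-+O(1)$ as $z\to0$, for $z\in D^\pm\cup\Sigma$. -/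

import Mathlib

open Filter Topology Asymptotics MeasureTheory Matrix

noncomputable section

namespace IfoNLS

/-! ### The equation and the boundary conditions -/

/-- The `j`-th derivative of `q` in the space variable. -/
def dx (j : ℕ) (q : ℝ → ℝ → ℂ) (x t : ℝ) : ℂ := iteratedDeriv j (fun y => q y t) x

/-- Classical solutions of the fifth-order equation
`i q_t + 2(|q|² - q₀²) q - iε q_xxxxx - 10iε |q|² q_xxx - 20iε q_x q^* q_xx - 30iε |q|⁴ q_x
  - 10iε (|q_x|² q)_x + q_xx - i q_x = 0`
on `ℝ × ℝ`: the derivatives in the equation exist, and the `x`-derivatives up to order five are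
jointly continuous (the equation then makes `q_t` continuous as well). -/
structure IsClassicalSolution (ε q₀ : ℝ) (q : ℝ → ℝ → ℂ) : Prop where
  contDiff_x : ∀ t, ContDiff ℝ 5 (fun x => q x t)
  continuous_dx : ∀ j ≤ 5, Continuous (fun p : ℝ × ℝ => dx j q p.1 p.2)
  differentiable_t : ∀ x, Differentiable ℝ (fun t => q x t)
  equation : ∀ x t,
    Complex.I * deriv (fun s => q x s) t
      + 2 * ((‖q x t‖ : ℂ) ^ 2 - (q₀ : ℂ) ^ 2) * q x t
      - Complex.I * ε * dx 5 q x t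
      - 10 * Complex.I * ε * (‖q x t‖ : ℂ) ^ 2 * dx 3 q x t
      - 20 * Complex.I * ε * dx 1 q x t * star (q x t) * dx 2 q x t
      - 30 * Complex.I * ε * (‖q x t‖ : ℂ) ^ 4 * dx 1 q x t
      - 10 * Complex.I * ε * deriv (fun y => (‖dx 1 q y t‖ : ℂ) ^ 2 * q y t) x
      + dx 2 q x t
      - Complex.I * dx 1 q x t = 0

/-- Nonvanishing boundary conditions: `q → q_±` as `x → ±∞`, with `|q_±| = q₀`, the `x`-derivatives
that enter the Lax pair tend to zero (both locally uniformly in `t`), and `q - q_±` is integrable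
in `x` near `±∞` at every time. -/
structure HasNonzeroBoundary (q₀ : ℝ) (q : ℝ → ℝ → ℂ) (qm qp : ℂ) : Prop where
  norm_qm : ‖qm‖ = q₀
  norm_qp : ‖qp‖ = q₀
  tendsto_bot : TendstoLocallyUniformly (fun x t => q x t) (fun _ => qm) atBot
  tendsto_top : TendstoLocallyUniformly (fun x t => q x t) (fun _ => qp) atTop
  tendsto_dx_bot : ∀ j, 1 ≤ j → j ≤ 4 →
    TendstoLocallyUniformly (fun x t => dx j q x t) (fun _ => 0) atBot
  tendsto_dx_top : ∀ j, 1 ≤ j → j ≤ 4 →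
    TendstoLocallyUniformly (fun x t => dx j q x t) (fun _ => 0) atTop
  integrable_bot : ∀ t a : ℝ, IntegrableOn (fun x => q x t - qm) (Set.Iic a)
  integrable_top : ∀ t a : ℝ, IntegrableOn (fun x => q x t - qp) (Set.Ici a)

/-! ### The uniformization variable -/

/-- `k(z) = (z - q₀²/z)/2`. -/
def kz (q₀ : ℝ) (z : ℂ) : ℂ := (z - (q₀ : ℂ) ^ 2 / z) / 2

/-- `λ(z) = (z + q₀²/z)/2`. -/
def lam (q₀ : ℝ) (z : ℂ) : ℂ := (z + (q₀ : ℂ) ^ 2 / z) / 2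

/-- `γ(z) = 1 + q₀²/z²`. -/
def gam (q₀ : ℝ) (z : ℂ) : ℂ := 1 + (q₀ : ℂ) ^ 2 / z ^ 2

/-- `θ(x,t;z) = λ [x + (16 ε k⁴ - 8 ε q₀² k² + 2 k + 6 ε q₀⁴ + 1) t]`. -/
def theta (ε q₀ : ℝ) (x t : ℝ) (z : ℂ) : ℂ :=
  lam q₀ z * (x + (16 * ε * kz q₀ z ^ 4 - 8 * ε * (q₀ : ℂ) ^ 2 * kz q₀ z ^ 2
    + 2 * kz q₀ z + 6 * ε * (q₀ : ℂ) ^ 4 + 1) * t)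

/-- The continuous spectrum `Σ = ℝ ∪ {|z| = q₀}`. -/
def Sig (q₀ : ℝ) : Set ℂ := {z | z.im = 0 ∨ ‖z‖ = q₀}

/-- `Σ` without the singular point `0` and without the branch points `± i q₀`
(where `γ` vanishes). -/
def SigReg (q₀ : ℝ) : Set ℂ := {z ∈ Sig q₀ | z ≠ 0 ∧ z ≠ Complex.I * q₀ ∧ z ≠ -(Complex.I * q₀)}

/-- `D⁺ = {(|z|² - q₀²) Im z > 0}`. -/
def Dplus (q₀ : ℝ) : Set ℂ := {z | 0 < (‖z‖ ^ 2 - q₀ ^ 2) * z.im}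

/-- `D⁻ = {(|z|² - q₀²) Im z < 0}`. -/
def Dminus (q₀ : ℝ) : Set ℂ := {z | (‖z‖ ^ 2 - q₀ ^ 2) * z.im < 0}

/-! ### The Lax pair -/

def sigma3 : Matrix (Fin 2) (Fin 2) ℂ := !![1, 0; 0, -1]

/-- `e^{a σ₃}`. -/
def expSigma3 (a : ℂ) : Matrix (Fin 2) (Fin 2) ℂ := !![Complex.exp a, 0; 0, Complex.exp (-a)]

/-- The matrix `Q` with rows `(0, c)` and `(-c^*, 0)`. -/
def potMat (c : ℂ) : Matrix (Fin 2) (Fin 2) ℂ := !![0, c; -star c, 0]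

/-- `U = -i k σ₃ + U₀`. -/
def laxU (q : ℝ → ℝ → ℂ) (k : ℂ) (x t : ℝ) : Matrix (Fin 2) (Fin 2) ℂ :=
  -(Complex.I * k) • sigma3 + potMat (q x t)

/-- The diagonal entry `V₁₁`. -/
def laxV11 (ε q₀ : ℝ) (q : ℝ → ℝ → ℂ) (k : ℂ) (x t : ℝ) : ℂ :=
  let Q := q x t
  let Q1 := dx 1 q x t
  let Q2 := dx 2 q x t
  let Q3 := dx 3 q x t
  let N : ℂ := (‖q x t‖ : ℂ) ^ 2
  8 * Complex.I * k ^ 3 * N * ε - 16 * Complex.I * k ^ 5 * ε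
    + 4 * k ^ 2 * ε * (Q * star Q1 - Q1 * star Q)
    - Complex.I * k + Complex.I * (N - (q₀ : ℂ) ^ 2) - 2 * Complex.I * k ^ 2
    - 6 * Complex.I * k * ε * N ^ 2
    - 2 * Complex.I * k * ε * (Q * star Q2 + Q2 * star Q - (‖Q1‖ : ℂ) ^ 2)
    + ε * (Q3 * star Q - Q * star Q3 + Q1 * star Q2 - Q2 * star Q1
      + 6 * N * star Q * Q1 - 6 * N * star Q1 * Q)

/-- The off-diagonal entry `V₁₂`. -/
def laxV12 (ε : ℝ) (q : ℝ → ℝ → ℂ) (k : ℂ) (x t : ℝ) : ℂ :=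
  let Q := q x t
  let Q1 := dx 1 q x t
  let Q2 := dx 2 q x t
  let Q3 := dx 3 q x t
  let Q4 := dx 4 q x t
  let N : ℂ := (‖q x t‖ : ℂ) ^ 2
  16 * k ^ 4 * ε * Q + 8 * Complex.I * k ^ 3 * Q1 * ε - 4 * k ^ 2 * ε * (Q2 + 2 * N * Q)
    - 2 * Complex.I * k * ε * (Q3 + 6 * N * Q1) + 2 * k * Q + Complex.I * Q1 + Q
    + ε * (Q4 + 8 * N * Q2 + 2 * Q ^ 2 * star Q2 + 4 * (‖Q1‖ : ℂ) ^ 2 * Q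
      + 6 * Q1 ^ 2 * star Q + 6 * N ^ 2 * Q)

/-- The time part of the Lax pair. The entry `V₂₁ = -V₁₂^*` is polynomial in `k`: the star acts on
the coefficients of `V₁₂`, that is, `V₂₁(k)` is minus the conjugate of `V₁₂(k^*)`. -/
def laxV (ε q₀ : ℝ) (q : ℝ → ℝ → ℂ) (k : ℂ) (x t : ℝ) : Matrix (Fin 2) (Fin 2) ℂ :=
  !![laxV11 ε q₀ q k x t, laxV12 ε q k x t;
     -star (laxV12 ε q (star k) x t), -laxV11 ε q₀ q k x t]

/-- `E_± = I - (i/z) σ₃ Q_±`, where `c = q_±`. -/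
def eigMat (c z : ℂ) : Matrix (Fin 2) (Fin 2) ℂ := 1 - (Complex.I / z) • (sigma3 * potMat c)

/-! ### Jost functions -/

/-- `φ` is the `j`-th column of a Jost function normalized at the end `l` of the line
(`l = atBot`, `c = q_-` or `l = atTop`, `c = q_+`): it solves both parts of the Lax pair, and
`e^{iθ} φ` (first column) or `e^{-iθ} φ` (second column) tends to that column of `E_±`. -/
structure IsJostColumn (ε q₀ : ℝ) (q : ℝ → ℝ → ℂ) (c : ℂ) (l : Filter ℝ) (z : ℂ) (j : Fin 2)
    (φ : ℝ → ℝ → Fin 2 → ℂ) : Prop where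
  space : ∀ x t, HasDerivAt (fun y => φ y t) (laxU q (kz q₀ z) x t *ᵥ φ x t) x
  time : ∀ x t, HasDerivAt (fun s => φ x s) (laxV ε q₀ q (kz q₀ z) x t *ᵥ φ x t) t
  limit : ∀ t, Tendsto
    (fun x => expSigma3 (Complex.I * theta ε q₀ x t z) j j • φ x t) l
    (𝓝 fun i => eigMat c z i j)

/-- The `j`-th column of the Jost function, for those `z` for which there is exactly one. -/
def jost (ε q₀ : ℝ) (q : ℝ → ℝ → ℂ) (c : ℂ) (l : Filter ℝ) (z : ℂ) (j : Fin 2) :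
    ℝ → ℝ → Fin 2 → ℂ :=
  Classical.epsilon (IsJostColumn ε q₀ q c l z j)

/-- `φ_-`, as a matrix. -/
def phiM (ε q₀ : ℝ) (q : ℝ → ℝ → ℂ) (qm : ℂ) (x t : ℝ) (z : ℂ) : Matrix (Fin 2) (Fin 2) ℂ :=
  Matrix.of fun i j => jost ε q₀ q qm atBot z j x t i

/-- `φ_+`, as a matrix. -/
def phiP (ε q₀ : ℝ) (q : ℝ → ℝ → ℂ) (qp : ℂ) (x t : ℝ) (z : ℂ) : Matrix (Fin 2) (Fin 2) ℂ :=
  Matrix.of fun i j => jost ε q₀ q qp atTop z j x t i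

/-- The modified Jost function `u_- = φ_- e^{iθσ₃}`. -/
def uM (ε q₀ : ℝ) (q : ℝ → ℝ → ℂ) (qm : ℂ) (x t : ℝ) (z : ℂ) : Matrix (Fin 2) (Fin 2) ℂ :=
  phiM ε q₀ q qm x t z * expSigma3 (Complex.I * theta ε q₀ x t z)

/-- The modified Jost function `u_+ = φ_+ e^{iθσ₃}`. -/
def uP (ε q₀ : ℝ) (q : ℝ → ℝ → ℂ) (qp : ℂ) (x t : ℝ) (z : ℂ) : Matrix (Fin 2) (Fin 2) ℂ :=
  phiP ε q₀ q qp x t z * expSigma3 (Complex.I * theta ε q₀ x t z)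

/-! ### Scattering data -/

/-- The Wronskian of column `a` of `A` and column `b` of `B`. -/
def wr (A B : Matrix (Fin 2) (Fin 2) ℂ) (a b : Fin 2) : ℂ := A 0 a * B 1 b - A 1 a * B 0 b

/-- `s₁₁ γ = Wr(φ_{+,1}, φ_{-,2})`. The Wronskians do not depend on `(x,t)`; they are evaluated
at `(0,0)`. -/
def s11 (ε q₀ : ℝ) (q : ℝ → ℝ → ℂ) (qm qp z : ℂ) : ℂ :=
  wr (phiP ε q₀ q qp 0 0 z) (phiM ε q₀ q qm 0 0 z) 0 1 / gam q₀ z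

/-- `s₂₂ γ = Wr(φ_{-,1}, φ_{+,2})`. -/
def s22 (ε q₀ : ℝ) (q : ℝ → ℝ → ℂ) (qm qp z : ℂ) : ℂ :=
  wr (phiM ε q₀ q qm 0 0 z) (phiP ε q₀ q qp 0 0 z) 0 1 / gam q₀ z

/-- `s₁₂ γ = Wr(φ_{+,2}, φ_{-,2})`. -/
def s12 (ε q₀ : ℝ) (q : ℝ → ℝ → ℂ) (qm qp z : ℂ) : ℂ :=
  wr (phiP ε q₀ q qp 0 0 z) (phiM ε q₀ q qm 0 0 z) 1 1 / gam q₀ z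

/-- `s₂₁ γ = Wr(φ_{-,1}, φ_{+,1})`. -/
def s21 (ε q₀ : ℝ) (q : ℝ → ℝ → ℂ) (qm qp z : ℂ) : ℂ :=
  wr (phiM ε q₀ q qm 0 0 z) (phiP ε q₀ q qp 0 0 z) 0 0 / gam q₀ z

/-- The scattering matrix. -/
def scatMat (ε q₀ : ℝ) (q : ℝ → ℝ → ℂ) (qm qp z : ℂ) : Matrix (Fin 2) (Fin 2) ℂ :=
  !![s11 ε q₀ q qm qp z, s12 ε q₀ q qm qp z; s21 ε q₀ q qm qp z, s22 ε q₀ q qm qp z]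

/-- The reflection coefficient `ρ = s₂₁/s₁₁`. -/
def rho (ε q₀ : ℝ) (q : ℝ → ℝ → ℂ) (qm qp z : ℂ) : ℂ :=
  s21 ε q₀ q qm qp z / s11 ε q₀ q qm qp z

/-- The reflection coefficient `ρ̃ = s₁₂/s₂₂`. -/
def rhoT (ε q₀ : ℝ) (q : ℝ → ℝ → ℂ) (qm qp z : ℂ) : ℂ :=
  s12 ε q₀ q qm qp z / s22 ε q₀ q qm qp z

/-! ### The matrix of the Riemann-Hilbert problem -/

/-- `M⁺ = (u_{-,1}, u_{+,2}/s₂₂)`. -/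
def MP (ε q₀ : ℝ) (q : ℝ → ℝ → ℂ) (qm qp : ℂ) (x t : ℝ) (z : ℂ) : Matrix (Fin 2) (Fin 2) ℂ :=
  !![uM ε q₀ q qm x t z 0 0, uP ε q₀ q qp x t z 0 1 / s22 ε q₀ q qm qp z;
     uM ε q₀ q qm x t z 1 0, uP ε q₀ q qp x t z 1 1 / s22 ε q₀ q qm qp z]

/-- `M⁻ = (u_{+,1}/s₁₁, u_{-,2})`. -/
def MM (ε q₀ : ℝ) (q : ℝ → ℝ → ℂ) (qm qp : ℂ) (x t : ℝ) (z : ℂ) : Matrix (Fin 2) (Fin 2) ℂ :=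
  !![uP ε q₀ q qp x t z 0 0 / s11 ε q₀ q qm qp z, uM ε q₀ q qm x t z 0 1;
     uP ε q₀ q qp x t z 1 0 / s11 ε q₀ q qm qp z, uM ε q₀ q qm x t z 1 1]

open Classical in
/-- The sectionally meromorphic matrix `M`: `M⁺` on `D⁺` and `M⁻` on `D⁻`. The value `0` on `Σ`
is a placeholder. -/
def RHM (ε q₀ : ℝ) (q : ℝ → ℝ → ℂ) (qm qp : ℂ) (x t : ℝ) (z : ℂ) : Matrix (Fin 2) (Fin 2) ℂ :=
  if z ∈ Dplus q₀ then MP ε q₀ q qm qp x t z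
  else if z ∈ Dminus q₀ then MM ε q₀ q qm qp x t z
  else 0

/-- `G = e^{-iθσ₃} G₀ e^{iθσ₃}`, where `G₀` has the rows `(0, -ρ̃)` and `(ρ, ρρ̃)`. -/
def jumpG (ε q₀ : ℝ) (q : ℝ → ℝ → ℂ) (qm qp : ℂ) (x t : ℝ) (z : ℂ) :
    Matrix (Fin 2) (Fin 2) ℂ :=
  expSigma3 (-(Complex.I * theta ε q₀ x t z))
    * !![0, -rhoT ε q₀ q qm qp z;
         rho ε q₀ q qm qp z, rho ε q₀ q qm qp z * rhoT ε q₀ q qm qp z]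
    * expSigma3 (Complex.I * theta ε q₀ x t z)

end IfoNLS

end

/-!
The Jost columns are solved for at a fixed time, and everything in the Riemann-Hilbert problem is
then read off from the Volterra equation that they satisfy.

*Construction.* The matrix `E_±` diagonalizes the limit `U_±` of `U` at an end of the line, with
eigenvalues `∓ i λ`. After the substitution `u = E_± v` the equation of a modified Jost column is
`v' = d v + A v`, where `d` is diagonal and `‖A‖` is bounded by a multiple of `|q - q_±|`, which is
integrable at that end. Reflecting the line if necessary, the end is `-∞`, and the equation with
`v(-∞) = e_j` is a Volterra equation whose kernel `e^{d (x - y)}` is bounded by `1` when `Im λ` has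
the right sign, that is, on `D⁺ ∪ Σ'` or on `D⁻ ∪ Σ'` (`lam_im`). In the norm with weight
`e^{2 ∫ ‖A‖}` the Volterra operator is a contraction (`VolterraData.integral_weight`), so that the
Neumann series converges uniformly in the spectral parameter; its terms are continuous up to the
boundary and holomorphic inside (`continuousOn_jostSol`, `differentiableOn_jostSol`). Solutions are
unique, since `|v|² e^{-4 ∫ ‖A‖}` decreases from `0` for the difference of two of them
(`VolterraData.eq_zero_of_tendsto`).

*Time.* The equation for `q` is the zero-curvature equation `V_x = U_t + [U, V]`, so the flow
`φ_t = V φ` preserves the space equation (`hasDerivAt_space_of_time`). As only `V_x` and `U_t` are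
known to exist, this is proved with difference quotients and Grönwall's inequality rather than by
commuting mixed derivatives. The flow also preserves the normalization, because `V` tends to
`f U_±` locally uniformly in time (`EndData.tendsto_phase_smul`). Existence and uniqueness of the
Jost columns follow (`existsUnique_isJostColumn`). Since `U` and `V` are traceless, Wronskians are
constant, and `φ_+ = φ_- S` is Cramer's rule (`phiP_eq_phiM_mul_scatMat`). The jump condition is a
rearrangement of it.

*Asymptotics.* For large `z` the gauge `E(x) = I - (i/z) σ₃ Q(x)`, in place of its limit, leaves a
coefficient of order `1/z` in `L¹`, because `q_x` is integrable; hence `u_± = I + O(1/z)`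
(`exists_jostSol_bound_infty`). The involution `z ↦ -q₀²/z` exchanges `0` with `∞` and the two
columns with each other, by uniqueness (`jostSol_symm`), which gives the behaviour at `0`. The
coefficients `s₁₁` and `s₂₂` are Wronskians divided by `γ`, so their asymptotics, and those of `M`,
follow from those of the columns.
-/

noncomputable section

namespace IfoNLS

open scoped Matrix.Norms.Operator ComplexConjugate

section

/-! ### Volterra equations on a half-line -/

/-- The integral of a continuous function over `(-∞, x]` is an antiderivative of it. -/
lemma hasDerivAt_integral_Iic {E : Type*} [NormedAddCommGroup E] [NormedSpace ℝ E]
    [CompleteSpace E] {h : ℝ → E} (hc : Continuous h)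
    (hi : ∀ x, IntegrableOn h (Set.Iic x)) (x : ℝ) :
    HasDerivAt (fun x => ∫ y in Set.Iic x, h y) (h x) x := by
  have h1 : HasDerivAt (fun u => (∫ y in Set.Iic x, h y) + ∫ y in x..u, h y) (h x) x :=
    ((hc.integral_hasStrictDerivAt x x).hasDerivAt).const_add _
  refine h1.congr_of_eventuallyEq (Eventually.of_forall fun u => ?_)
  simp only
  rw [← intervalIntegral.integral_Iic_sub_Iic (hi x) (hi u), add_sub_cancel]

/-- The data of a Volterra equation `v(x) = c + ∫_{-∞}^x e^{d (x - y)} A(y) v(y) dy` with a diagonal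
exponent `d` of nonpositive real part, and a continuous majorant `g` of `‖A‖` that is integrable
near `-∞`. -/
structure VolterraData (d : Fin 2 → ℂ) (A : ℝ → Matrix (Fin 2) (Fin 2) ℂ) (g : ℝ → ℝ) :
    Prop where
  re_nonpos : ∀ i, (d i).re ≤ 0
  cont : Continuous A
  bound : ∀ y, ‖A y‖ ≤ g y
  cont_g : Continuous g
  int_g : ∀ x, IntegrableOn g (Set.Iic x)

/-- The Volterra operator `w ↦ ∫_{-∞}^x e^{d (x - y)} A(y) w(y) dy`. -/
def volterraOp (d : Fin 2 → ℂ) (A : ℝ → Matrix (Fin 2) (Fin 2) ℂ) (w : ℝ → Fin 2 → ℂ) (x : ℝ) :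
    Fin 2 → ℂ :=
  fun i => ∫ y in Set.Iic x, Complex.exp (d i * (x - y)) * (A y *ᵥ w y) i

/-- The Neumann series of the Volterra equation with inhomogeneity `c`. -/
def volterraSol (d : Fin 2 → ℂ) (A : ℝ → Matrix (Fin 2) (Fin 2) ℂ) (c : Fin 2 → ℂ) (x : ℝ) :
    Fin 2 → ℂ :=
  ∑' n : ℕ, (volterraOp d A)^[n] (fun _ => c) x

/-- The mass `∫_{-∞}^x g`. -/
def massIic (g : ℝ → ℝ) (x : ℝ) : ℝ := ∫ y in Set.Iic x, g y

namespace VolterraData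

variable {d : Fin 2 → ℂ} {A : ℝ → Matrix (Fin 2) (Fin 2) ℂ} {g : ℝ → ℝ}

lemma g_nonneg (h : VolterraData d A g) (y : ℝ) : 0 ≤ g y := (norm_nonneg _).trans (h.bound y)

lemma hasDerivAt_mass (h : VolterraData d A g) (x : ℝ) : HasDerivAt (massIic g) (g x) x :=
  hasDerivAt_integral_Iic h.cont_g h.int_g x

lemma continuous_mass (h : VolterraData d A g) : Continuous (massIic g) :=
  continuous_iff_continuousAt.2 fun x => (h.hasDerivAt_mass x).continuousAt

lemma mass_nonneg (h : VolterraData d A g) (x : ℝ) : 0 ≤ massIic g x :=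
  setIntegral_nonneg measurableSet_Iic fun y _ => h.g_nonneg y

lemma mass_mono (h : VolterraData d A g) : Monotone (massIic g) :=
  monotone_of_hasDerivAt_nonneg h.hasDerivAt_mass h.g_nonneg

lemma tendsto_mass : Tendsto (massIic g) atBot (𝓝 0) :=
  tendsto_integral_Iic_zero tendsto_id

lemma integrableOn_weight (h : VolterraData d A g) (K x : ℝ) :
    IntegrableOn (fun y => g y * (K * Real.exp (2 * massIic g y))) (Set.Iic x) := by
  have hm := h.continuous_mass
  refine Integrable.mono' ((h.int_g x).mul_const (|K| * Real.exp (2 * massIic g x)))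
    ((h.cont_g.mul (by fun_prop)).aestronglyMeasurable) ?_
  refine (ae_restrict_iff' measurableSet_Iic).2 (Eventually.of_forall fun y hy => ?_)
  rw [norm_mul, norm_mul, Real.norm_of_nonneg (h.g_nonneg y), Real.norm_eq_abs,
    Real.norm_of_nonneg (Real.exp_pos _).le]
  have := h.mass_mono hy
  have := h.g_nonneg y
  gcongr

/-- The weight `e^{2 G}`, `G = ∫_{-∞}^x g`, makes the Volterra operator a contraction with
factor `1/2`. -/
lemma integral_weight (h : VolterraData d A g) {K : ℝ} (hK : 0 ≤ K) (x : ℝ) :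
    ∫ y in Set.Iic x, g y * (K * Real.exp (2 * massIic g y)) ≤
      K * Real.exp (2 * massIic g x) * (1 / 2) := by
  have hd : ∀ y ∈ Set.Iic x, HasDerivAt (fun y => K / 2 * Real.exp (2 * massIic g y))
      (g y * (K * Real.exp (2 * massIic g y))) y := by
    intro y _
    have := (((h.hasDerivAt_mass y).const_mul 2).exp).const_mul (K / 2)
    refine this.congr_deriv ?_
    ring
  have ht : Tendsto (fun y => K / 2 * Real.exp (2 * massIic g y)) atBot (𝓝 (K / 2 * 1)) := by
    have : Tendsto (fun y => Real.exp (2 * massIic g y)) atBot (𝓝 (Real.exp (2 * 0))) :=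
      (Real.continuous_exp.tendsto _).comp ((tendsto_mass (g := g)).const_mul 2)
    simpa using this.const_mul (K / 2)
  rw [integral_Iic_of_hasDerivAt_of_tendsto' hd (h.integrableOn_weight K x) ht]
  linarith

lemma norm_kernel_le (h : VolterraData d A g) {x y : ℝ} (hy : y ≤ x) (w : Fin 2 → ℂ) (i : Fin 2) :
    ‖Complex.exp (d i * (x - y)) * (A y *ᵥ w) i‖ ≤ g y * ‖w‖ := by
  have h1 : ‖Complex.exp (d i * (x - y))‖ ≤ 1 := by
    rw [Complex.norm_exp, Real.exp_le_one_iff]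
    have : (d i * (x - y) : ℂ).re = (d i).re * (x - y) := by
      rw [← Complex.ofReal_sub, Complex.re_mul_ofReal]
    rw [this]
    exact mul_nonpos_of_nonpos_of_nonneg (h.re_nonpos i) (sub_nonneg.2 hy)
  have h2 : ‖(A y *ᵥ w) i‖ ≤ g y * ‖w‖ :=
    (norm_le_pi_norm _ i).trans ((Matrix.linfty_opNorm_mulVec _ _).trans
      (mul_le_mul_of_nonneg_right (h.bound y) (norm_nonneg _)))
  rw [norm_mul]
  exact (mul_le_of_le_one_left (norm_nonneg _) h1).trans h2

variable {w : ℝ → Fin 2 → ℂ} {K : ℝ}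

lemma continuous_mulVec (h : VolterraData d A g) (hw : Continuous w) :
    Continuous fun y => A y *ᵥ w y := h.cont.matrix_mulVec hw

lemma norm_kernel_le_weight (h : VolterraData d A g)
    (hb : ∀ y, ‖w y‖ ≤ K * Real.exp (2 * massIic g y)) (i : Fin 2) {x y : ℝ} (hy : y ≤ x) :
    ‖Complex.exp (d i * (x - y)) * (A y *ᵥ w y) i‖ ≤ g y * (K * Real.exp (2 * massIic g y)) :=
  (h.norm_kernel_le hy _ i).trans (mul_le_mul_of_nonneg_left (hb y) (h.g_nonneg y))

lemma integrableOn_kernel (h : VolterraData d A g) (hw : Continuous w)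
    (hb : ∀ y, ‖w y‖ ≤ K * Real.exp (2 * massIic g y)) (i : Fin 2) (x : ℝ) :
    IntegrableOn (fun y : ℝ => Complex.exp (d i * (x - y)) * (A y *ᵥ w y) i) (Set.Iic x) := by
  have hc := (continuous_apply i).comp (h.continuous_mulVec hw)
  refine Integrable.mono' (h.integrableOn_weight K x)
    (Continuous.aestronglyMeasurable (Continuous.mul (by fun_prop) hc)) ?_
  exact (ae_restrict_iff' measurableSet_Iic).2
    (Eventually.of_forall fun y hy => h.norm_kernel_le_weight hb i hy)

/-- The factor `e^{d x}` leaves the integral, so that the operator can be differentiated in `x`. -/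
lemma volterraOp_eq (x : ℝ) (i : Fin 2) : volterraOp d A w x i =
    Complex.exp (d i * x) * ∫ y in Set.Iic x, Complex.exp (-(d i * y)) * (A y *ᵥ w y) i := by
  rw [volterraOp, ← integral_const_mul]
  congr 1 with y
  rw [← mul_assoc, ← Complex.exp_add]
  congr 2
  ring

lemma hasDerivAt_volterraOp (h : VolterraData d A g) (hw : Continuous w)
    (hb : ∀ y, ‖w y‖ ≤ K * Real.exp (2 * massIic g y)) (x : ℝ) :
    HasDerivAt (volterraOp d A w) (fun i => d i * volterraOp d A w x i + (A x *ᵥ w x) i) x := by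
  refine hasDerivAt_pi.2 fun i => ?_
  have hc := (continuous_apply i).comp (h.continuous_mulVec hw)
  have hint : ∀ x : ℝ, IntegrableOn
      (fun y : ℝ => Complex.exp (-(d i * y)) * (A y *ᵥ w y) i) (Set.Iic x) := by
    intro x
    have := (h.integrableOn_kernel hw hb i x).const_mul (Complex.exp (-(d i * x)))
    refine this.congr (Eventually.of_forall fun y => ?_)
    simp only
    rw [← mul_assoc, ← Complex.exp_add]
    congr 2
    ring
  have hcont : Continuous fun y : ℝ => Complex.exp (-(d i * y)) * (A y *ᵥ w y) i :=
    Continuous.mul (by fun_prop) hc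
  have h1 := hasDerivAt_integral_Iic hcont hint x
  have h2 : HasDerivAt (fun x : ℝ => Complex.exp (d i * x)) (Complex.exp (d i * x) * (d i * 1)) x :=
    HasDerivAt.cexp ((Complex.ofRealCLM.hasDerivAt (x := x)).const_mul (d i))
  have h3 := h2.mul h1
  refine (h3.congr_of_eventuallyEq (Eventually.of_forall fun x => volterraOp_eq x i)).congr_deriv ?_
  have h4 : Complex.exp (d i * x) * Complex.exp (-(d i * x)) = 1 := by
    rw [← Complex.exp_add, add_neg_cancel, Complex.exp_zero]
  rw [volterraOp_eq]
  linear_combination (A x *ᵥ w x) i * h4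

lemma norm_volterraOp_le (h : VolterraData d A g)
    (hb : ∀ y, ‖w y‖ ≤ K * Real.exp (2 * massIic g y)) (x : ℝ) :
    ‖volterraOp d A w x‖ ≤ K * Real.exp (2 * massIic g x) * (1 / 2) := by
  have hK : 0 ≤ K := by
    have := (norm_nonneg _).trans (hb 0)
    exact nonneg_of_mul_nonneg_left this (Real.exp_pos _)
  refine (pi_norm_le_iff_of_nonneg (by positivity)).2 fun i => ?_
  refine le_trans ?_ (h.integral_weight hK x)
  refine norm_integral_le_of_norm_le (h.integrableOn_weight K x) ?_
  exact (ae_restrict_iff' measurableSet_Iic).2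
    (Eventually.of_forall fun y hy => h.norm_kernel_le_weight hb i hy)

/-- Without the contraction factor, but small near `-∞`. -/
lemma norm_volterraOp_le_mass (h : VolterraData d A g)
    (hb : ∀ y, ‖w y‖ ≤ K * Real.exp (2 * massIic g y)) (x : ℝ) :
    ‖volterraOp d A w x‖ ≤ massIic g x * (K * Real.exp (2 * massIic g x)) := by
  have hK : 0 ≤ K := by
    have := (norm_nonneg _).trans (hb 0)
    exact nonneg_of_mul_nonneg_left this (Real.exp_pos _)
  have := h.mass_nonneg x
  refine (pi_norm_le_iff_of_nonneg (by positivity)).2 fun i => ?_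
  rw [massIic, ← integral_mul_const]
  refine norm_integral_le_of_norm_le ((h.int_g x).mul_const _) ?_
  refine (ae_restrict_iff' measurableSet_Iic).2 (Eventually.of_forall fun y hy => ?_)
  refine (h.norm_kernel_le_weight hb i hy).trans ?_
  have hle : massIic g y ≤ massIic g x := h.mass_mono hy
  have := h.g_nonneg y
  gcongr
  exact hle

variable {c : Fin 2 → ℂ}

lemma iterate_spec (h : VolterraData d A g) (c : Fin 2 → ℂ) (n : ℕ) :
    Continuous ((volterraOp d A)^[n] fun _ => c) ∧
      ∀ x, ‖(volterraOp d A)^[n] (fun _ => c) x‖ ≤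
        ‖c‖ * (1 / 2) ^ n * Real.exp (2 * massIic g x) := by
  induction n with
  | zero =>
    refine ⟨continuous_const, fun x => ?_⟩
    simp only [Function.iterate_zero, id_eq, pow_zero, mul_one]
    refine le_mul_of_one_le_right (norm_nonneg _) (Real.one_le_exp ?_)
    have := h.mass_nonneg x
    positivity
  | succ n ih =>
    rw [Function.iterate_succ_apply']
    refine ⟨continuous_iff_continuousAt.2 fun x =>
      (h.hasDerivAt_volterraOp ih.1 ih.2 x).continuousAt, fun x => ?_⟩
    refine (h.norm_volterraOp_le ih.2 x).trans (le_of_eq ?_)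
    ring

lemma summable_bound (a b : ℝ) : Summable fun n : ℕ => a * (1 / 2 : ℝ) ^ n * b :=
  (summable_geometric_two.mul_left a).mul_right b

lemma tsum_bound (a b : ℝ) : ∑' n : ℕ, a * (1 / 2 : ℝ) ^ n * b = 2 * a * b := by
  rw [tsum_mul_right, tsum_mul_left, tsum_geometric_two]
  ring

lemma summable_iterate (h : VolterraData d A g) (c : Fin 2 → ℂ) (x : ℝ) :
    Summable fun n : ℕ => (volterraOp d A)^[n] (fun _ => c) x :=
  Summable.of_norm_bounded (summable_bound _ _) fun n => (h.iterate_spec c n).2 x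

lemma norm_sol_le (h : VolterraData d A g) (c : Fin 2 → ℂ) (x : ℝ) :
    ‖volterraSol d A c x‖ ≤ 2 * ‖c‖ * Real.exp (2 * massIic g x) := by
  rw [← tsum_bound]
  exact tsum_of_norm_bounded (summable_bound _ _).hasSum fun n => (h.iterate_spec c n).2 x

lemma continuous_sol (h : VolterraData d A g) (c : Fin 2 → ℂ) : Continuous (volterraSol d A c) := by
  refine continuous_iff_continuousAt.2 fun x => ?_
  -- The majorant is uniform on `(-∞, x + 1]`, since the mass is monotone.
  have : ContinuousOn (volterraSol d A c) (Set.Iic (x + 1)) := by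
    refine continuousOn_tsum (u := fun n : ℕ => ‖c‖ * (1 / 2) ^ n *
      Real.exp (2 * massIic g (x + 1))) (fun n => (h.iterate_spec c n).1.continuousOn)
      (summable_bound _ _) fun n y hy => ?_
    refine ((h.iterate_spec c n).2 y).trans ?_
    have := h.mass_mono hy
    gcongr
  exact this.continuousAt (Iic_mem_nhds (by linarith))

/-- The Neumann series solves the Volterra equation. -/
lemma sol_eq (h : VolterraData d A g) (c : Fin 2 → ℂ) (x : ℝ) :
    volterraSol d A c x = c + volterraOp d A (volterraSol d A c) x := by
  have h1 : volterraSol d A c x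
      = c + ∑' n : ℕ, volterraOp d A ((volterraOp d A)^[n] fun _ => c) x := by
    rw [volterraSol, (h.summable_iterate c x).tsum_eq_zero_add]
    simp only [Function.iterate_succ_apply', Function.iterate_zero, id_eq]
  rw [h1]
  congr 1
  have hs : Summable fun n : ℕ => volterraOp d A ((volterraOp d A)^[n] fun _ => c) x := by
    have := (summable_nat_add_iff 1).2 (h.summable_iterate c x)
    simpa only [Function.iterate_succ_apply'] using this
  ext i
  rw [tsum_apply hs]
  refine HasSum.tsum_eq ?_
  refine hasSum_integral_of_dominated_convergence
    (bound := fun n y => g y * (‖c‖ * (1 / 2) ^ n * Real.exp (2 * massIic g y)))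
    (fun n => (h.integrableOn_kernel (h.iterate_spec c n).1 (h.iterate_spec c n).2 i x).1)
    (fun n => (ae_restrict_iff' measurableSet_Iic).2 (Eventually.of_forall fun y hy =>
      h.norm_kernel_le_weight (h.iterate_spec c n).2 i hy))
    (Eventually.of_forall fun y => (summable_bound _ _).mul_left _) ?_
    (Eventually.of_forall fun y => ?_)
  · simp_rw [tsum_mul_left (a := g _), tsum_bound]
    exact h.integrableOn_weight (2 * ‖c‖) x
  · refine HasSum.mul_left _ ?_
    have h2 := (h.summable_iterate c y).hasSum
    have h3 := h2.map (Matrix.mulVecLin (A y)).toAddMonoidHom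
      (continuous_const.matrix_mulVec continuous_id)
    exact (Pi.hasSum.1 h3) i

lemma norm_sol_sub_le (h : VolterraData d A g) (c : Fin 2 → ℂ) (x : ℝ) :
    ‖volterraSol d A c x - c‖ ≤ massIic g x * (2 * ‖c‖ * Real.exp (2 * massIic g x)) := by
  have h1 : volterraSol d A c x - c = volterraOp d A (volterraSol d A c) x := by
    rw [sub_eq_iff_eq_add', ← h.sol_eq]
  rw [h1]
  exact h.norm_volterraOp_le_mass (h.norm_sol_le c) x

lemma tendsto_sol (h : VolterraData d A g) (c : Fin 2 → ℂ) :
    Tendsto (volterraSol d A c) atBot (𝓝 c) := by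
  rw [tendsto_iff_norm_sub_tendsto_zero]
  have hm := tendsto_mass (g := g)
  have h1 : Tendsto (fun x => massIic g x * (2 * ‖c‖ * Real.exp (2 * massIic g x))) atBot
      (𝓝 (0 * (2 * ‖c‖ * Real.exp (2 * 0)))) :=
    hm.mul (((Real.continuous_exp.tendsto _).comp (hm.const_mul 2)).const_mul _)
  rw [zero_mul] at h1
  exact squeeze_zero (fun _ => norm_nonneg _) (fun x => h.norm_sol_sub_le c x) h1

/-- The Volterra equation is the differential equation `v' = d v + A v` with `v → c` at `-∞`. -/
lemma hasDerivAt_sol (h : VolterraData d A g) (hc : ∀ i, d i * c i = 0) (x : ℝ) :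
    HasDerivAt (volterraSol d A c)
      (fun i => d i * volterraSol d A c x i + (A x *ᵥ volterraSol d A c x) i) x := by
  have h1 := (h.hasDerivAt_volterraOp (h.continuous_sol c) (h.norm_sol_le c) x).const_add c
  refine (h1.congr_of_eventuallyEq (Eventually.of_forall fun x => h.sol_eq c x)).congr_deriv ?_
  ext i
  have h2 : volterraSol d A c x i = c i + volterraOp d A (volterraSol d A c) x i :=
    congrFun (h.sol_eq c x) i
  rw [h2, mul_add, hc, zero_add]

end VolterraData

/-- A solution of `v' = d v + A v` that tends to zero at `-∞` vanishes: `|v|² e^{-4 ∫ g}` decreases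
from `0`. -/
lemma VolterraData.eq_zero_of_tendsto {d : Fin 2 → ℂ} {A : ℝ → Matrix (Fin 2) (Fin 2) ℂ}
    {g : ℝ → ℝ} (h : VolterraData d A g) {v : ℝ → Fin 2 → ℂ}
    (hv : ∀ x, HasDerivAt v (fun i => d i * v x i + (A x *ᵥ v x) i) x)
    (h0 : Tendsto v atBot (𝓝 0)) (x : ℝ) : v x = 0 := by
  set N : ℝ → ℝ := fun x => ∑ i, ‖v x i‖ ^ 2 with hN
  set F : ℝ → ℝ := fun x => N x * Real.exp (-(4 * massIic g x)) with hF
  have hNd : ∀ x, HasDerivAt N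
      (∑ i, 2 * inner ℝ (v x i) (d i * v x i + (A x *ᵥ v x) i)) x := by
    intro x
    exact HasDerivAt.fun_sum fun i _ => ((hasDerivAt_pi.1 (hv x)) i).norm_sq
  have hNle : ∀ x, (∑ i, 2 * inner ℝ (v x i) (d i * v x i + (A x *ᵥ v x) i)) ≤ 4 * g x * N x := by
    intro x
    have hsup : ‖v x‖ ^ 2 ≤ N x := by
      obtain ⟨i, hi⟩ : ∃ i, ‖v x‖ = ‖v x i‖ := by
        obtain ⟨i, hi⟩ := Finite.exists_max (fun i => ‖v x i‖)
        exact ⟨i, le_antisymm ((pi_norm_le_iff_of_nonneg (norm_nonneg _)).2 hi)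
          (norm_le_pi_norm _ i)⟩
      rw [hi]
      exact Finset.single_le_sum (f := fun i => ‖v x i‖ ^ 2) (fun j _ => by positivity)
        (Finset.mem_univ i)
    have hterm : ∀ i, 2 * inner ℝ (v x i) (d i * v x i + (A x *ᵥ v x) i) ≤ 2 * (g x * N x) := by
      intro i
      rw [inner_add_right]
      have h1 : inner ℝ (v x i) (d i * v x i) ≤ 0 := by
        have : inner ℝ (v x i) (d i * v x i) = (d i).re * ‖v x i‖ ^ 2 := by
          rw [Complex.inner, ← Complex.normSq_eq_norm_sq, Complex.normSq_apply]
          simp only [Complex.mul_re, Complex.mul_im, Complex.conj_re, Complex.conj_im]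
          ring
        rw [this]
        exact mul_nonpos_of_nonpos_of_nonneg (h.re_nonpos i) (by positivity)
      have h2 : inner ℝ (v x i) ((A x *ᵥ v x) i) ≤ g x * N x := by
        refine (real_inner_le_norm _ _).trans ?_
        have h3 : ‖(A x *ᵥ v x) i‖ ≤ g x * ‖v x‖ :=
          (norm_le_pi_norm _ i).trans ((Matrix.linfty_opNorm_mulVec _ _).trans
            (mul_le_mul_of_nonneg_right (h.bound x) (norm_nonneg _)))
        have h4 := norm_le_pi_norm (v x) i
        calc ‖v x i‖ * ‖(A x *ᵥ v x) i‖ ≤ ‖v x‖ * (g x * ‖v x‖) := by gcongr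
          _ = g x * ‖v x‖ ^ 2 := by ring
          _ ≤ g x * N x := mul_le_mul_of_nonneg_left hsup (h.g_nonneg x)
      linarith
    rw [Fin.sum_univ_two]
    have := hterm 0
    have := hterm 1
    linarith
  have hFd : ∀ x, HasDerivAt F ((∑ i, 2 * inner ℝ (v x i) (d i * v x i + (A x *ᵥ v x) i))
      * Real.exp (-(4 * massIic g x)) + N x * (Real.exp (-(4 * massIic g x)) * -(4 * g x))) x :=
    fun x => (hNd x).mul (((h.hasDerivAt_mass x).const_mul 4).neg.exp)
  have hanti : Antitone F := by
    refine antitone_of_hasDerivAt_nonpos hFd fun x => ?_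
    have := hNle x
    have h5 : 0 < Real.exp (-(4 * massIic g x)) := Real.exp_pos _
    change _ ≤ (0 : ℝ)
    nlinarith
  have hlim : Tendsto F atBot (𝓝 0) := by
    have hN0 : Tendsto N atBot (𝓝 0) := by
      have : Tendsto N atBot (𝓝 (∑ i : Fin 2, ‖(0 : Fin 2 → ℂ) i‖ ^ 2)) :=
        tendsto_finsetSum _ fun i _ => (((tendsto_pi_nhds.1 h0) i).norm).pow 2
      simpa using this
    have hE : Tendsto (fun x => Real.exp (-(4 * massIic g x))) atBot (𝓝 (Real.exp (-(4 * 0)))) :=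
      (Real.continuous_exp.tendsto _).comp ((VolterraData.tendsto_mass (g := g)).const_mul 4).neg
    simpa using hN0.mul hE
  have hF0 : F x ≤ 0 := by
    refine ge_of_tendsto hlim ?_
    filter_upwards [Iic_mem_atBot x] with y hy using hanti hy
  have hN0 : N x ≤ 0 := by
    by_contra hcon
    push Not at hcon
    exact absurd hF0 (not_le.2 (mul_pos hcon (Real.exp_pos _)))
  ext i
  have h6 : ‖v x i‖ ^ 2 ≤ N x :=
    Finset.single_le_sum (f := fun i => ‖v x i‖ ^ 2) (fun j _ => by positivity) (Finset.mem_univ i)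
  have h7 : ‖v x i‖ ^ 2 = 0 := le_antisymm (h6.trans hN0) (by positivity)
  simpa using h7

end

section

/-! ### Dependence of the Volterra solution on a complex parameter -/

/-- A dominated integral of holomorphic functions is holomorphic. -/
lemma differentiableOn_integral_of_dominated {α : Type*} [MeasurableSpace α] {μ : Measure α}
    {U : Set ℂ} (hU : IsOpen U) {F : ℂ → α → ℂ} {b : α → ℝ}
    (hm : ∀ z ∈ U, AEStronglyMeasurable (F z) μ) (hb : ∀ᵐ y ∂μ, ∀ z ∈ U, ‖F z y‖ ≤ b y)
    (hbi : Integrable b μ) (hd : ∀ y, DifferentiableOn ℂ (fun z => F z y) U) :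
    DifferentiableOn ℂ (fun z => ∫ y, F z y ∂μ) U := by
  intro z hz
  obtain ⟨r, hr, hball⟩ := Metric.isOpen_iff.1 hU z hz
  have hsub : ∀ w ∈ Metric.ball z (r / 2), Metric.closedBall w (r / 4) ⊆ U := by
    intro w hw p hp
    apply hball
    rw [Metric.mem_ball] at hw ⊢
    rw [Metric.mem_closedBall] at hp
    linarith [dist_triangle p w z]
  have hda : ∀ y, ∀ w ∈ Metric.ball z (r / 2), HasDerivAt (fun z => F z y)
      (deriv (fun z => F z y) w) w := fun y w hw =>
    ((hd y).differentiableAt (hU.mem_nhds (hsub w hw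
      (Metric.mem_closedBall_self (by positivity))))).hasDerivAt
  have hzr : z ∈ Metric.ball z (r / 2) := Metric.mem_ball_self (by positivity)
  -- The derivative is a limit of difference quotients, hence measurable.
  have hmeas : AEStronglyMeasurable (fun y => deriv (fun z => F z y) z) μ := by
    set a : ℕ → ℂ := fun n => ((r / 2 * (1 / ((n : ℝ) + 2)) : ℝ) : ℂ) with ha
    have ha0 : ∀ n, a n ≠ 0 := by
      intro n
      rw [ha, Complex.ofReal_ne_zero]
      positivity
    have hat : Tendsto a atTop (𝓝 0) := by
      have h1 : Tendsto (fun n : ℕ => r / 2 * (1 / ((n : ℝ) + 2))) atTop (𝓝 (r / 2 * 0)) := by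
        refine Tendsto.const_mul _ ?_
        refine Tendsto.div_atTop tendsto_const_nhds ?_
        exact tendsto_atTop_add_const_right _ _ tendsto_natCast_atTop_atTop
      rw [mul_zero] at h1
      have h2 := (Complex.continuous_ofReal.tendsto 0).comp h1
      rwa [Complex.ofReal_zero] at h2
    have hmem : ∀ n, z + a n ∈ U := by
      intro n
      apply hball
      rw [Metric.mem_ball, dist_eq_norm, add_sub_cancel_left, ha, Complex.norm_real,
        Real.norm_of_nonneg (by positivity)]
      have : 1 / ((n : ℝ) + 2) ≤ 1 := by
        rw [div_le_one (by positivity)]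
        linarith [(Nat.cast_nonneg n : (0 : ℝ) ≤ n)]
      nlinarith
    refine aestronglyMeasurable_of_tendsto_ae (u := atTop)
      (f := fun n y => (a n)⁻¹ • (F (z + a n) y - F z y))
      (fun n => ((hm _ (hmem n)).sub (hm _ hz)).const_smul (a n)⁻¹)
      (Eventually.of_forall fun y => ?_)
    have h2 := (hda y z hzr).tendsto_slope_zero
    exact h2.comp (tendsto_nhdsWithin_iff.2 ⟨hat, Eventually.of_forall ha0⟩)
  have key := hasDerivAt_integral_of_dominated_loc_of_deriv_le (μ := μ)
    (F := F) (F' := fun w y => deriv (fun z => F z y) w) (x₀ := z)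
    (bound := fun y => b y / (r / 4)) (s := Metric.ball z (r / 2))
    (Metric.ball_mem_nhds z (by positivity))
    (by filter_upwards [hU.mem_nhds hz] with w hw using hm w hw)
    (hbi.mono' (hm z hz) (hb.mono fun y h => h z hz)) hmeas ?_ (hbi.div_const _)
    (Eventually.of_forall hda)
  · exact key.2.differentiableAt.differentiableWithinAt
  -- Cauchy's estimate on a disc of radius `r / 4` bounds the derivative.
  · filter_upwards [hb] with y hy w hw
    refine Complex.norm_deriv_le_of_forall_mem_sphere_norm_le (by positivity) ?_ fun p hp =>
      hy p (hsub w hw (Metric.sphere_subset_closedBall hp))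
    refine DifferentiableOn.diffContOnCl ?_
    exact (hd y).mono ((closure_mono (Metric.ball_subset_closedBall)).trans
      ((Metric.isClosed_closedBall.closure_eq).le.trans (hsub w hw)))

variable {d : ℂ → Fin 2 → ℂ} {A : ℂ → ℝ → Matrix (Fin 2) (Fin 2) ℂ} {g : ℝ → ℝ} {S : Set ℂ}

lemma continuousOn_iterate (h : ∀ z ∈ S, VolterraData (d z) (A z) g)
    (hd : ContinuousOn d S) (hA : ∀ y, ContinuousOn (fun z => A z y) S) (c : Fin 2 → ℂ) (n : ℕ) :
    ∀ x, ContinuousOn (fun z => (volterraOp (d z) (A z))^[n] (fun _ => c) x) S := by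
  induction n with
  | zero => exact fun x => continuousOn_const
  | succ n ih =>
    intro x
    simp only [Function.iterate_succ_apply']
    refine continuousOn_pi.2 fun i => ?_
    rcases S.eq_empty_or_nonempty with rfl | ⟨z₀, hz₀⟩
    · exact continuousOn_empty _
    refine continuousOn_of_dominated
      (bound := fun y => g y * (‖c‖ * (1 / 2) ^ n * Real.exp (2 * massIic g y)))
      (fun z hz => ((h z hz).integrableOn_kernel ((h z hz).iterate_spec c n).1
        ((h z hz).iterate_spec c n).2 i x).1)
      (fun z hz => (ae_restrict_iff' measurableSet_Iic).2 (Eventually.of_forall fun y hy =>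
        (h z hz).norm_kernel_le_weight ((h z hz).iterate_spec c n).2 i hy))
      ((h z₀ hz₀).integrableOn_weight _ x) (Eventually.of_forall fun y => ?_)
    refine ContinuousOn.mul ?_ ?_
    · exact ((continuousOn_pi.1 hd i).mul continuousOn_const).cexp
    · have h1 : ContinuousOn (fun z => A z y *ᵥ (volterraOp (d z) (A z))^[n] (fun _ => c) y) S :=
        (continuous_fst.matrix_mulVec continuous_snd).comp_continuousOn ((hA y).prodMk (ih y))
      exact continuousOn_pi.1 h1 i

/-- The Volterra solution depends continuously on the parameter. -/
lemma continuousOn_volterraSol (h : ∀ z ∈ S, VolterraData (d z) (A z) g)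
    (hd : ContinuousOn d S) (hA : ∀ y, ContinuousOn (fun z => A z y) S) (c : Fin 2 → ℂ) (x : ℝ) :
    ContinuousOn (fun z => volterraSol (d z) (A z) c x) S :=
  continuousOn_tsum (fun n => continuousOn_iterate h hd hA c n x) (VolterraData.summable_bound _ _)
    fun n z hz => ((h z hz).iterate_spec c n).2 x

lemma differentiableOn_iterate (hS : IsOpen S) (h : ∀ z ∈ S, VolterraData (d z) (A z) g)
    (hd : ∀ i, DifferentiableOn ℂ (fun z => d z i) S)
    (hA : ∀ y i j, DifferentiableOn ℂ (fun z => A z y i j) S) (c : Fin 2 → ℂ) (n : ℕ) :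
    ∀ x i, DifferentiableOn ℂ (fun z => (volterraOp (d z) (A z))^[n] (fun _ => c) x i) S := by
  induction n with
  | zero => exact fun x i => differentiableOn_const _
  | succ n ih =>
    intro x i
    simp only [Function.iterate_succ_apply']
    rcases S.eq_empty_or_nonempty with rfl | ⟨z₀, hz₀⟩
    · exact differentiableOn_empty
    refine differentiableOn_integral_of_dominated hS
      (b := fun y => g y * (‖c‖ * (1 / 2) ^ n * Real.exp (2 * massIic g y)))
      (fun z hz => ((h z hz).integrableOn_kernel ((h z hz).iterate_spec c n).1
        ((h z hz).iterate_spec c n).2 i x).1)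
      ((ae_restrict_iff' measurableSet_Iic).2 (Eventually.of_forall fun y hy z hz =>
        (h z hz).norm_kernel_le_weight ((h z hz).iterate_spec c n).2 i hy))
      ((h z₀ hz₀).integrableOn_weight _ x) (fun y => ?_)
    refine DifferentiableOn.mul ((hd i).mul_const _).cexp ?_
    simp only [Matrix.mulVec, dotProduct]
    exact DifferentiableOn.fun_sum fun j _ => (hA y i j).mul (ih y j)

/-- The Volterra solution depends holomorphically on the parameter. -/
lemma differentiableOn_volterraSol (hS : IsOpen S) (h : ∀ z ∈ S, VolterraData (d z) (A z) g)
    (hd : ∀ i, DifferentiableOn ℂ (fun z => d z i) S)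
    (hA : ∀ y i j, DifferentiableOn ℂ (fun z => A z y i j) S) (c : Fin 2 → ℂ) (x : ℝ) (i : Fin 2) :
    DifferentiableOn ℂ (fun z => volterraSol (d z) (A z) c x i) S := by
  have h1 : ∀ z ∈ S, volterraSol (d z) (A z) c x i
      = ∑' n : ℕ, (volterraOp (d z) (A z))^[n] (fun _ => c) x i := fun z hz =>
    tsum_apply ((h z hz).summable_iterate c x)
  refine DifferentiableOn.congr ?_ h1
  exact Complex.differentiableOn_tsum_of_summable_norm (VolterraData.summable_bound _ _)
    (fun n => differentiableOn_iterate hS h hd hA c n x i) hS fun n z hz =>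
      (norm_le_pi_norm _ i).trans (((h z hz).iterate_spec c n).2 x)

end

section

/-! ### Linear systems with two independent variables -/

lemma hasDerivAt_matrix {M : ℝ → Matrix (Fin 2) (Fin 2) ℂ} {M' : Matrix (Fin 2) (Fin 2) ℂ} {x : ℝ}
    (h : ∀ i j, HasDerivAt (fun y => M y i j) (M' i j) x) : HasDerivAt M M' x := by
  have h1 : HasDerivAt (fun y => (fun i j => M y i j : Fin 2 → Fin 2 → ℂ)) (fun i j => M' i j) x :=
    hasDerivAt_pi.2 fun i => hasDerivAt_pi.2 fun j => h i j
  exact ((Matrix.ofLinearEquiv ℝ (m := Fin 2) (n := Fin 2)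
    (α := ℂ)).toLinearMap.toContinuousLinearMap.hasFDerivAt).comp_hasDerivAt x h1

lemma HasDerivAt.mulVec {M : ℝ → Matrix (Fin 2) (Fin 2) ℂ} {M' : Matrix (Fin 2) (Fin 2) ℂ}
    {v : ℝ → Fin 2 → ℂ} {v' : Fin 2 → ℂ} {x : ℝ}
    (hM : ∀ i j, HasDerivAt (fun y => M y i j) (M' i j) x) (hv : HasDerivAt v v' x) :
    HasDerivAt (fun y => M y *ᵥ v y) (M' *ᵥ v x + M x *ᵥ v') x := by
  refine hasDerivAt_pi.2 fun i => ?_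
  simp only [Pi.add_apply, Matrix.mulVec, dotProduct, ← Finset.sum_add_distrib]
  exact HasDerivAt.fun_sum fun j _ => (hM i j).mul (hasDerivAt_pi.1 hv j)

lemma norm_mulVec_le {M : Matrix (Fin 2) (Fin 2) ℂ} {v : Fin 2 → ℂ} {a b : ℝ} (ha : ‖M‖ ≤ a)
    (hb : ‖v‖ ≤ b) : ‖M *ᵥ v‖ ≤ a * b :=
  (Matrix.linfty_opNorm_mulVec M v).trans
    (mul_le_mul ha hb (norm_nonneg _) ((norm_nonneg _).trans ha))

/-- Grönwall's inequality on both sides of the initial time. -/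
lemma norm_le_of_norm_deriv_le {E : Type*} [NormedAddCommGroup E] [NormedSpace ℝ E]
    {f f' : ℝ → E} {K η t : ℝ} (hK : 0 ≤ K) (hη : 0 ≤ η) (hd : ∀ s, HasDerivAt f (f' s) s)
    (hb : ∀ s ∈ Set.uIcc 0 t, ‖f' s‖ ≤ K * ‖f s‖ + η) :
    ‖f t‖ ≤ (‖f 0‖ + η * |t|) * Real.exp (K * |t|) := by
  wlog ht : 0 ≤ t generalizing f f' t
  · push Not at ht
    have h1 := this (f := fun s => f (-s)) (f' := fun s => -f' (-s)) (t := -t)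
      (fun s => by simpa [Function.comp_def] using (hd (-s)).scomp s (hasDerivAt_neg s))
      (fun s hs => ?_) (by linarith)
    · simpa using h1
    · rw [norm_neg]
      refine hb (-s) ?_
      rw [Set.uIcc_of_le (by linarith), Set.mem_Icc] at hs
      rw [Set.uIcc_of_ge ht.le, Set.mem_Icc]
      constructor <;> linarith [hs.1, hs.2]
  rw [Set.uIcc_of_le ht] at hb
  have h1 := norm_le_gronwallBound_of_norm_deriv_right_le (f := f) (f' := f') (δ := ‖f 0‖) (K := K)
    (ε := η) (a := 0) (b := t) (fun s _ => (hd s).continuousAt.continuousWithinAt)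
    (fun s _ => (hd s).hasDerivWithinAt) le_rfl (fun s hs => hb s ⟨hs.1, hs.2.le⟩) t ⟨ht, le_rfl⟩
  rw [sub_zero] at h1
  refine h1.trans ?_
  rw [abs_of_nonneg ht]
  rcases eq_or_ne K 0 with rfl | hK0
  · simp [gronwallBound_K0]
  · rw [gronwallBound_of_K_ne_0 hK0]
    have h2 : Real.exp (K * t) - 1 ≤ K * t * Real.exp (K * t) := by
      have h3 := Real.add_one_le_exp (-(K * t))
      have h4 : Real.exp (-(K * t)) * Real.exp (K * t) = 1 := by
        rw [← Real.exp_add, neg_add_cancel, Real.exp_zero]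
      nlinarith [Real.exp_pos (K * t)]
    have h5 : η / K * (Real.exp (K * t) - 1) ≤ η / K * (K * t * Real.exp (K * t)) :=
      mul_le_mul_of_nonneg_left h2 (by positivity)
    have h6 : η / K * (K * t * Real.exp (K * t)) = η * t * Real.exp (K * t) := by
      field_simp
    rw [h6] at h5
    linarith

/-- The linear equation `y' = B y` on a half-line starting at `0` becomes, in the variable
`log |t|`, a Volterra equation on `(-∞, ∞)`. -/
lemma volterraData_exp {B : ℝ → Matrix (Fin 2) (Fin 2) ℂ} (hB : Continuous B) (o : ℝ) :
    VolterraData 0 (fun s => (o * Real.exp s) • B (o * Real.exp s))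
      (fun s => ‖(o * Real.exp s) • B (o * Real.exp s)‖) where
  re_nonpos i := by simp
  cont := by fun_prop
  bound y := le_rfl
  cont_g := by fun_prop
  int_g x := by
    obtain ⟨C, hC⟩ := (isCompact_Icc (a := -(|o| * Real.exp x))
      (b := |o| * Real.exp x)).exists_bound_of_continuousOn hB.continuousOn
    refine Integrable.mono' ((integrableOn_exp_Iic x).const_mul (|o| * C))
      (Continuous.aestronglyMeasurable (by fun_prop)) ?_
    refine (ae_restrict_iff' measurableSet_Iic).2 (Eventually.of_forall fun y hy => ?_)
    rw [norm_norm, norm_smul, norm_mul, Real.norm_eq_abs, Real.norm_of_nonneg (Real.exp_pos y).le]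
    have h1 : |o * Real.exp y| ≤ |o| * Real.exp x := by
      rw [abs_mul, abs_of_pos (Real.exp_pos y)]
      have : Real.exp y ≤ Real.exp x := Real.exp_le_exp.2 hy
      gcongr
    have h2 := hC _ (abs_le.1 h1)
    calc |o| * Real.exp y * ‖B (o * Real.exp y)‖ ≤ |o| * Real.exp y * C := by gcongr
      _ = |o| * C * Real.exp y := by ring

/-- Global solvability of linear systems. -/
lemma exists_linear_ode {B : ℝ → Matrix (Fin 2) (Fin 2) ℂ} (hB : Continuous B) (y₀ : Fin 2 → ℂ) :
    ∃ y : ℝ → Fin 2 → ℂ, y 0 = y₀ ∧ ∀ t, HasDerivAt y (B t *ᵥ y t) t := by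
  set Y : ℝ → ℝ → Fin 2 → ℂ := fun o =>
    volterraSol 0 (fun s => (o * Real.exp s) • B (o * Real.exp s)) y₀ with hY
  have hYd : ∀ o s, HasDerivAt (Y o) ((o * Real.exp s) • (B (o * Real.exp s) *ᵥ Y o s)) s := by
    intro o s
    refine ((volterraData_exp hB o).hasDerivAt_sol (fun i => by simp) s).congr_deriv ?_
    ext i
    simp [hY, Matrix.smul_mulVec]
  have hYt : ∀ o, Tendsto (Y o) atBot (𝓝 y₀) := fun o => (volterraData_exp hB o).tendsto_sol y₀
  -- The solutions on the two half-lines are glued at `0`.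
  set y : ℝ → Fin 2 → ℂ := fun t =>
    if t = 0 then y₀ else if 0 < t then Y 1 (Real.log t) else Y (-1) (Real.log t) with hy
  have hy0 : y 0 = y₀ := by simp [hy]
  have hcont : ContinuousAt y 0 := by
    rw [continuousAt_iff_punctured_nhds, hy0]
    have h1 : Tendsto (fun t : ℝ => if 0 < t then Y 1 (Real.log t) else Y (-1) (Real.log t))
        (𝓝[≠] 0) (𝓝 y₀) :=
      Tendsto.if' ((hYt 1).comp Real.tendsto_log_nhdsNE_zero)
        ((hYt (-1)).comp Real.tendsto_log_nhdsNE_zero)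
    refine h1.congr' ?_
    filter_upwards [self_mem_nhdsWithin] with t ht
    rw [hy]
    simp only [if_neg (show t ≠ 0 from ht)]
  refine ⟨y, hy0, hasDerivAt_of_hasDerivAt_of_ne' (x := 0) (fun t ht => ?_) hcont ?_⟩
  · have key : ∀ o : ℝ, o * Real.exp (Real.log t) = t →
        HasDerivAt (fun t => Y o (Real.log t)) (B t *ᵥ Y o (Real.log t)) t := by
      intro o ho
      have h1 := (hYd o (Real.log t)).scomp t (Real.hasDerivAt_log ht)
      rw [ho] at h1
      rwa [smul_smul, inv_mul_cancel₀ ht, one_smul] at h1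
    rcases lt_or_gt_of_ne ht with hneg | hpos
    · have h2 := key (-1) (by rw [Real.exp_log_eq_abs ht, abs_of_neg hneg]; ring)
      have h3 : y =ᶠ[𝓝 t] fun t => Y (-1) (Real.log t) := by
        filter_upwards [Iio_mem_nhds hneg] with s hs
        have hs' : s < 0 := hs
        rw [hy]
        simp only [if_neg hs'.ne, if_neg hs'.not_gt]
      rw [h3.eq_of_nhds]
      exact h2.congr_of_eventuallyEq h3
    · have h2 := key 1 (by rw [Real.exp_log hpos]; ring)
      have h3 : y =ᶠ[𝓝 t] fun t => Y 1 (Real.log t) := by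
        filter_upwards [Ioi_mem_nhds hpos] with s hs
        have hs' : 0 < s := hs
        rw [hy]
        simp only [if_neg hs'.ne', if_pos hs']
      rw [h3.eq_of_nhds]
      exact h2.congr_of_eventuallyEq h3
  · exact (continuous_fst.matrix_mulVec continuous_snd).continuousAt.comp
      (hB.continuousAt.prodMk hcont)

/-- If the coefficients satisfy the zero-curvature equation `V_x = U_t + [U, V]`, then the evolution
`φ_t = V φ` preserves the space equation `φ_x = U φ`. Indeed the remainder
`r = φ(x + h) - φ(x) - h U φ(x)` satisfies `r_t = V(x + h) r + o(h)` with `r = o(h)` at `t = 0`. -/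
lemma hasDerivAt_space_of_time {U Ut V Vx : ℝ → ℝ → Matrix (Fin 2) (Fin 2) ℂ}
    (hV : Continuous fun p : ℝ × ℝ => V p.1 p.2) (hVx : Continuous fun p : ℝ × ℝ => Vx p.1 p.2)
    (hVd : ∀ x t i j, HasDerivAt (fun y => V y t i j) (Vx x t i j) x)
    (hUd : ∀ x t i j, HasDerivAt (fun s => U x s i j) (Ut x t i j) t)
    (hzc : ∀ x t, Vx x t = Ut x t + U x t * V x t - V x t * U x t)
    {φ : ℝ → ℝ → Fin 2 → ℂ} (ht : ∀ x t, HasDerivAt (fun s => φ x s) (V x t *ᵥ φ x t) t)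
    (h0 : ∀ x, HasDerivAt (fun y => φ y 0) (U x 0 *ᵥ φ x 0) x) (x T : ℝ) :
    HasDerivAt (fun y => φ y T) (U x T *ᵥ φ x T) x := by
  have hφc : Continuous fun s => φ x s :=
    continuous_iff_continuousAt.2 fun s => (ht x s).continuousAt
  have hUφd : ∀ s, HasDerivAt (fun s => U x s *ᵥ φ x s)
      (Ut x s *ᵥ φ x s + U x s *ᵥ (V x s *ᵥ φ x s)) s := fun s =>
    HasDerivAt.mulVec (hUd x s) (ht x s)
  have hUφc : Continuous fun s => U x s *ᵥ φ x s :=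
    continuous_iff_continuousAt.2 fun s => (hUφd s).continuousAt
  obtain ⟨M₁, hM₁⟩ := (isCompact_uIcc (a := (0 : ℝ)) (b := T)).exists_bound_of_continuousOn
    hφc.continuousOn
  obtain ⟨M₂, hM₂⟩ := (isCompact_uIcc (a := (0 : ℝ)) (b := T)).exists_bound_of_continuousOn
    hUφc.continuousOn
  obtain ⟨K, hK⟩ := (isCompact_uIcc (a := (0 : ℝ)) (b := T)).exists_bound_of_continuousOn
    (hV.comp (Continuous.prodMk_right x)).continuousOn
  have hM₁0 : 0 ≤ M₁ := (norm_nonneg _).trans (hM₁ 0 Set.left_mem_uIcc)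
  have hM₂0 : 0 ≤ M₂ := (norm_nonneg _).trans (hM₂ 0 Set.left_mem_uIcc)
  have hK0 : 0 ≤ K := (norm_nonneg _).trans (hK 0 Set.left_mem_uIcc)
  -- Continuity of `W` at the points of a compact time interval is uniform in time.
  have hunif : ∀ W : ℝ → ℝ → Matrix (Fin 2) (Fin 2) ℂ, Continuous (fun p : ℝ × ℝ => W p.1 p.2) →
      ∀ e > 0, ∀ᶠ y in 𝓝 x, ∀ s ∈ Set.uIcc 0 T, ‖W y s - W x s‖ < e := by
    intro W hW e he
    refine (isCompact_uIcc (a := (0 : ℝ)) (b := T)).eventually_forall_of_forall_eventually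
      fun s _ => ?_
    have hc : Continuous fun p : ℝ × ℝ => ‖W p.1 p.2 - W x p.2‖ :=
      (hW.sub (hW.comp (continuous_const.prodMk continuous_snd))).norm
    have := (hc.tendsto (x, s)).eventually (eventually_lt_nhds (b := e) (by simpa using he))
    exact this
  rw [hasDerivAt_iff_isLittleO_nhds_zero, isLittleO_iff]
  intro c hc
  set C : ℝ := (1 + (M₁ + M₂) * |T|) * Real.exp ((K + 1) * |T|) with hC
  have hC0 : 0 < C := by positivity
  set e : ℝ := c / C with he
  have he0 : 0 < e := by positivity
  have hx0 : Tendsto (fun h : ℝ => x + h) (𝓝 0) (𝓝 x) := by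
    have : ContinuousAt (fun h : ℝ => x + h) 0 := by fun_prop
    simpa [ContinuousAt] using this
  obtain ⟨δ, hδ, hball⟩ := Metric.eventually_nhds_iff_ball.1 (hunif Vx hVx e he0)
  have hA := hasDerivAt_iff_isLittleO_nhds_zero.1 (h0 x)
  filter_upwards [isLittleO_iff.1 hA he0, Metric.ball_mem_nhds (0 : ℝ) hδ,
    hx0.eventually (hunif V hV 1 one_pos), hx0.eventually (hunif V hV e he0)] with h hh0 hhδ hV1 hVe
  -- mean value inequality for `V(y, s) - y V_x(x, s)`
  have hmv : ∀ s ∈ Set.uIcc 0 T, ‖V (x + h) s - V x s - h • Vx x s‖ ≤ e * |h| := by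
    intro s hs
    have hd : ∀ y ∈ Metric.ball x δ, HasDerivWithinAt (fun y => V y s - y • Vx x s)
        (Vx y s - (1 : ℝ) • Vx x s) (Metric.ball x δ) y := fun y _ =>
      ((hasDerivAt_matrix (hVd y s)).sub ((hasDerivAt_id y).smul_const (Vx x s))).hasDerivWithinAt
    have := (convex_ball x δ).norm_image_sub_le_of_norm_hasDerivWithin_le hd (C := e)
      (fun y hy => by rw [one_smul]; exact (hball y hy s hs).le)
      (Metric.mem_ball_self hδ) (show x + h ∈ Metric.ball x δ by simpa using hhδ)
    rw [add_sub_cancel_left, Real.norm_eq_abs] at this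
    refine le_trans (le_of_eq ?_) this
    rw [add_smul]
    congr 1
    abel
  have hrd : ∀ s, HasDerivAt (fun s => φ (x + h) s - φ x s - h • (U x s *ᵥ φ x s))
      (V (x + h) s *ᵥ φ (x + h) s - V x s *ᵥ φ x s -
        h • (Ut x s *ᵥ φ x s + U x s *ᵥ (V x s *ᵥ φ x s))) s := fun s =>
    ((ht (x + h) s).sub (ht x s)).sub ((hUφd s).const_smul h)
  have hfin := norm_le_of_norm_deriv_le (K := K + 1) (η := e * |h| * (M₁ + M₂)) (t := T)
    (by positivity) (by positivity) hrd fun s hs => by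
      have hdec : V (x + h) s *ᵥ φ (x + h) s - V x s *ᵥ φ x s -
          h • (Ut x s *ᵥ φ x s + U x s *ᵥ (V x s *ᵥ φ x s)) =
          V (x + h) s *ᵥ (φ (x + h) s - φ x s - h • (U x s *ᵥ φ x s)) +
          ((V (x + h) s - V x s - h • Vx x s) *ᵥ φ x s +
            h • ((V (x + h) s - V x s) *ᵥ (U x s *ᵥ φ x s))) := by
        rw [hzc]
        simp only [Matrix.mulVec_sub, Matrix.sub_mulVec, Matrix.add_mulVec, Matrix.smul_mulVec,
          Matrix.mulVec_smul, smul_sub, smul_add, Matrix.mulVec_mulVec, Matrix.sub_mul]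
        abel
      rw [hdec]
      have hKh : ‖V (x + h) s‖ ≤ K + 1 := by
        have h1 := norm_le_norm_add_norm_sub' (V (x + h) s) (V x s)
        have h2 : ‖V x s‖ ≤ K := hK s hs
        linarith [(hV1 s hs).le]
      refine (norm_add_le _ _).trans (add_le_add (norm_mulVec_le hKh le_rfl) ?_)
      refine (norm_add_le _ _).trans ?_
      have h3 := norm_mulVec_le (hmv s hs) (hM₁ s hs)
      have h4 := norm_mulVec_le (hVe s hs).le (hM₂ s hs)
      rw [norm_smul, Real.norm_eq_abs]
      have h5 := mul_le_mul_of_nonneg_left h4 (abs_nonneg h)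
      linarith
  refine hfin.trans ?_
  rw [Real.norm_eq_abs] at hh0 ⊢
  have h6 : c = e * C := by rw [he, div_mul_cancel₀ _ hC0.ne']
  rw [h6, hC]
  have h7 : ‖φ (x + h) 0 - φ x 0 - h • (U x 0 *ᵥ φ x 0)‖ + e * |h| * (M₁ + M₂) * |T| ≤
      e * |h| * (1 + (M₁ + M₂) * |T|) := by linarith
  refine (mul_le_mul_of_nonneg_right h7 (Real.exp_pos _).le).trans (le_of_eq ?_)
  ring

end

section

/-! ### The zero-curvature equation -/

variable {ε q₀ : ℝ} {q : ℝ → ℝ → ℂ}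

lemma dx_zero (q : ℝ → ℝ → ℂ) (x t : ℝ) : dx 0 q x t = q x t := by
  simp [dx, iteratedDeriv_zero]

lemma IsClassicalSolution.hasDerivAt_dx (hq : IsClassicalSolution ε q₀ q) {j : ℕ} (hj : j < 5)
    (x t : ℝ) : HasDerivAt (fun y => dx j q y t) (dx (j + 1) q x t) x := by
  have h1 : Differentiable ℝ (iteratedDeriv j fun y => q y t) :=
    (hq.contDiff_x t).differentiable_iteratedDeriv j (by exact_mod_cast hj)
  have h2 := (h1 x).hasDerivAt
  rwa [← iteratedDeriv_succ] at h2

lemma IsClassicalSolution.hasDerivAt_x (hq : IsClassicalSolution ε q₀ q) (x t : ℝ) :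
    HasDerivAt (fun y => q y t) (dx 1 q x t) x := by
  simpa only [dx_zero] using hq.hasDerivAt_dx (j := 0) (by norm_num) x t

lemma HasDerivAt.conj {f : ℝ → ℂ} {f' : ℂ} {x : ℝ} (h : HasDerivAt f f' x) :
    HasDerivAt (fun y => conj (f y)) (conj f') x := h.star

lemma norm_sq_eq (w : ℂ) : (‖w‖ : ℂ) ^ 2 = w * conj w := (Complex.mul_conj' w).symm

/-- The time derivative of `q` as given by the equation. -/
def dtOf (ε q₀ : ℝ) (q : ℝ → ℝ → ℂ) (x t : ℝ) : ℂ :=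
  Complex.I * (2 * (q x t * conj (q x t) - (q₀ : ℂ) ^ 2) * q x t
    - Complex.I * ε * dx 5 q x t
    - 10 * Complex.I * ε * (q x t * conj (q x t)) * dx 3 q x t
    - 20 * Complex.I * ε * dx 1 q x t * conj (q x t) * dx 2 q x t
    - 30 * Complex.I * ε * (q x t * conj (q x t)) ^ 2 * dx 1 q x t
    - 10 * Complex.I * ε * (dx 2 q x t * conj (dx 1 q x t) * q x t
      + dx 1 q x t * conj (dx 2 q x t) * q x t + dx 1 q x t * conj (dx 1 q x t) * dx 1 q x t)
    + dx 2 q x t - Complex.I * dx 1 q x t)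

lemma IsClassicalSolution.hasDerivAt_t (hq : IsClassicalSolution ε q₀ q) (x t : ℝ) :
    HasDerivAt (fun s => q x s) (dtOf ε q₀ q x t) t := by
  refine (hq.differentiable_t x t).hasDerivAt.congr_deriv ?_
  have h1 := hq.hasDerivAt_dx (j := 1) (by norm_num) x t
  have h2 : HasDerivAt (fun y => (‖dx 1 q y t‖ : ℂ) ^ 2 * q y t)
      ((dx 2 q x t * conj (dx 1 q x t) + dx 1 q x t * conj (dx 2 q x t)) * q x t
        + dx 1 q x t * conj (dx 1 q x t) * dx 1 q x t) x := by
    have h3 := (h1.mul (HasDerivAt.conj h1)).mul (hq.hasDerivAt_x x t)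
    refine h3.congr_of_eventuallyEq (Eventually.of_forall fun y => ?_)
    simp only [Pi.mul_apply, norm_sq_eq]
  have h4 := hq.equation x t
  rw [h2.deriv, show (‖q x t‖ : ℂ) ^ 4 = ((‖q x t‖ : ℂ) ^ 2) ^ 2 by ring, norm_sq_eq,
    Complex.star_def] at h4
  rw [dtOf]
  linear_combination -Complex.I * h4 + deriv (fun s => q x s) t * Complex.I_sq

lemma IsClassicalSolution.continuous_q (hq : IsClassicalSolution ε q₀ q) :
    Continuous fun p : ℝ × ℝ => q p.1 p.2 := by
  simpa only [dx_zero] using hq.continuous_dx 0 (by norm_num)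

lemma IsClassicalSolution.continuous_dtOf (hq : IsClassicalSolution ε q₀ q) :
    Continuous fun p : ℝ × ℝ => dtOf ε q₀ q p.1 p.2 := by
  have h0 := hq.continuous_q
  have h1 := hq.continuous_dx 1 (by norm_num)
  have h2 := hq.continuous_dx 2 (by norm_num)
  have h3 := hq.continuous_dx 3 (by norm_num)
  have h5 := hq.continuous_dx 5 (by norm_num)
  have c0 := Complex.continuous_conj.comp h0
  have c1 := Complex.continuous_conj.comp h1
  have c2 := Complex.continuous_conj.comp h2
  simp only [Function.comp_def] at c0 c1 c2
  unfold dtOf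
  fun_prop

/-- The entry `V₁₁` as a function of the jet `(q, q_x, …, q_xxxx)`. -/
def laxV11Jet (ε q₀ : ℝ) (k : ℂ) (a : Fin 5 → ℂ) : ℂ :=
  8 * Complex.I * k ^ 3 * (a 0 * conj (a 0)) * ε - 16 * Complex.I * k ^ 5 * ε
    + 4 * k ^ 2 * ε * (a 0 * conj (a 1) - a 1 * conj (a 0))
    - Complex.I * k + Complex.I * (a 0 * conj (a 0) - (q₀ : ℂ) ^ 2) - 2 * Complex.I * k ^ 2
    - 6 * Complex.I * k * ε * (a 0 * conj (a 0)) ^ 2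
    - 2 * Complex.I * k * ε * (a 0 * conj (a 2) + a 2 * conj (a 0) - a 1 * conj (a 1))
    + ε * (a 3 * conj (a 0) - a 0 * conj (a 3) + a 1 * conj (a 2) - a 2 * conj (a 1)
      + 6 * (a 0 * conj (a 0)) * conj (a 0) * a 1 - 6 * (a 0 * conj (a 0)) * conj (a 1) * a 0)

/-- The entry `V₁₂` as a function of the jet `(q, q_x, …, q_xxxx)`. -/
def laxV12Jet (ε : ℝ) (k : ℂ) (a : Fin 5 → ℂ) : ℂ :=
  16 * k ^ 4 * ε * a 0 + 8 * Complex.I * k ^ 3 * a 1 * ε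
    - 4 * k ^ 2 * ε * (a 2 + 2 * (a 0 * conj (a 0)) * a 0)
    - 2 * Complex.I * k * ε * (a 3 + 6 * (a 0 * conj (a 0)) * a 1) + 2 * k * a 0
    + Complex.I * a 1 + a 0
    + ε * (a 4 + 8 * (a 0 * conj (a 0)) * a 2 + 2 * a 0 ^ 2 * conj (a 2)
      + 4 * (a 1 * conj (a 1)) * a 0 + 6 * a 1 ^ 2 * conj (a 0)
      + 6 * (a 0 * conj (a 0)) ^ 2 * a 0)

/-- The time part of the Lax pair as a function of the jet `(q, q_x, …, q_xxxx)`. -/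
def laxVJet (ε q₀ : ℝ) (k : ℂ) (a : Fin 5 → ℂ) : Matrix (Fin 2) (Fin 2) ℂ :=
  !![laxV11Jet ε q₀ k a, laxV12Jet ε k a;
     -conj (laxV12Jet ε (conj k) a), -laxV11Jet ε q₀ k a]

/-- The jet `(q, q_x, …, q_xxxx)`. -/
def jet (q : ℝ → ℝ → ℂ) (x t : ℝ) : Fin 5 → ℂ := fun j => dx j q x t

lemma laxV11_eq (ε q₀ : ℝ) (q : ℝ → ℝ → ℂ) (k : ℂ) (x t : ℝ) :
    laxV11 ε q₀ q k x t = laxV11Jet ε q₀ k (jet q x t) := by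
  simp only [laxV11, laxV11Jet, jet, norm_sq_eq, Complex.star_def, Fin.val_zero, Fin.val_one,
    Fin.val_two, dx_zero]
  rfl

lemma laxV12_eq (ε : ℝ) (q : ℝ → ℝ → ℂ) (k : ℂ) (x t : ℝ) :
    laxV12 ε q k x t = laxV12Jet ε k (jet q x t) := by
  simp only [laxV12, laxV12Jet, jet, norm_sq_eq, Complex.star_def, Fin.val_zero, Fin.val_one,
    Fin.val_two, dx_zero]
  rfl

lemma laxV_eq (ε q₀ : ℝ) (q : ℝ → ℝ → ℂ) (k : ℂ) (x t : ℝ) :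
    laxV ε q₀ q k x t = laxVJet ε q₀ k (jet q x t) := by
  simp only [laxV, laxVJet, laxV11_eq, laxV12_eq, Complex.star_def]

lemma continuous_laxVJet (ε q₀ : ℝ) (k : ℂ) : Continuous (laxVJet ε q₀ k) := by
  refine continuous_matrix fun i j => ?_
  have hc : ∀ j : Fin 5, Continuous fun a : Fin 5 → ℂ => conj (a j) := fun j =>
    Complex.continuous_conj.comp (continuous_apply j)
  have h11 : Continuous (laxV11Jet ε q₀ k) := by
    have := hc 0
    have := hc 1
    have := hc 2
    have := hc 3
    unfold laxV11Jet
    fun_prop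
  have h12 : ∀ k, Continuous (laxV12Jet ε k) := by
    intro k
    have := hc 0
    have := hc 1
    have := hc 2
    unfold laxV12Jet
    fun_prop
  fin_cases i <;> fin_cases j
  · exact h11
  · exact h12 k
  · exact (Complex.continuous_conj.comp (h12 (conj k))).neg
  · exact h11.neg

lemma IsClassicalSolution.continuous_jet (hq : IsClassicalSolution ε q₀ q) :
    Continuous fun p : ℝ × ℝ => jet q p.1 p.2 :=
  continuous_pi fun j => hq.continuous_dx j (by have := j.isLt; omega)

lemma IsClassicalSolution.continuous_laxV (hq : IsClassicalSolution ε q₀ q) (k : ℂ) :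
    Continuous fun p : ℝ × ℝ => laxV ε q₀ q k p.1 p.2 := by
  simp only [laxV_eq]
  exact (continuous_laxVJet ε q₀ k).comp hq.continuous_jet

/-- `V₁₁` has imaginary coefficients as a polynomial in `k`. -/
lemma conj_laxV11 (ε q₀ : ℝ) (q : ℝ → ℝ → ℂ) (k : ℂ) (x t : ℝ) :
    conj (laxV11 ε q₀ q (conj k) x t) = -laxV11 ε q₀ q k x t := by
  simp only [laxV11_eq, laxV11Jet, map_add, map_sub, map_mul, map_pow, Complex.conj_conj,
    Complex.conj_I, Complex.conj_ofReal, map_ofNat]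
  ring

/-- The diagonal entry of `V_x = U_t + [U, V]`, which holds for every `q`. -/
lemma IsClassicalSolution.hasDerivAt_laxV11 (hq : IsClassicalSolution ε q₀ q) (k : ℂ) (x t : ℝ) :
    HasDerivAt (fun y => laxV11 ε q₀ q k y t)
      (-(q x t * conj (laxV12 ε q (conj k) x t)) + laxV12 ε q k x t * conj (q x t)) x := by
  have h0 := hq.hasDerivAt_x x t
  have h1 := hq.hasDerivAt_dx (j := 1) (by norm_num) x t
  have h2 := hq.hasDerivAt_dx (j := 2) (by norm_num) x t
  have h3 := hq.hasDerivAt_dx (j := 3) (by norm_num) x t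
  have c0 := HasDerivAt.conj h0
  have c1 := HasDerivAt.conj h1
  have c2 := HasDerivAt.conj h2
  have c3 := HasDerivAt.conj h3
  have hN := h0.mul c0
  have key := (((((hN.const_mul (8 * Complex.I * k ^ 3 * ε + Complex.I)).add
    (((h0.mul c1).sub (h1.mul c0)).const_mul (4 * k ^ 2 * ε))).sub
    ((hN.mul hN).const_mul (6 * Complex.I * k * ε))).sub
    ((((h0.mul c2).add (h2.mul c0)).sub (h1.mul c1)).const_mul (2 * Complex.I * k * ε))).add
    ((((((h3.mul c0).sub (h0.mul c3)).add (h1.mul c2)).sub (h2.mul c1)).add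
      (((hN.mul c0).mul h1).sub ((hN.mul c1).mul h0) |>.const_mul 6)).const_mul (ε : ℂ))).add_const
    (-16 * Complex.I * k ^ 5 * ε - Complex.I * k - Complex.I * (q₀ : ℂ) ^ 2 - 2 * Complex.I * k ^ 2)
  refine (key.congr_of_eventuallyEq (Eventually.of_forall fun y => ?_)).congr_deriv ?_
  · simp only [laxV11, norm_sq_eq, Complex.star_def, Pi.add_apply, Pi.mul_apply, Pi.sub_apply]
    ring
  · simp only [laxV12, norm_sq_eq, Complex.star_def, Pi.mul_apply, map_add, map_sub, map_mul,
      map_pow, Complex.conj_conj, Complex.conj_I, Complex.conj_ofReal, map_ofNat]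
    ring

/-- The off-diagonal entry of `V_x = U_t + [U, V]`, which is the equation for `q`. -/
lemma IsClassicalSolution.hasDerivAt_laxV12 (hq : IsClassicalSolution ε q₀ q) (k : ℂ) (x t : ℝ) :
    HasDerivAt (fun y => laxV12 ε q k y t)
      (dtOf ε q₀ q x t - 2 * Complex.I * k * laxV12 ε q k x t
        - 2 * q x t * laxV11 ε q₀ q k x t) x := by
  have h0 := hq.hasDerivAt_x x t
  have h1 := hq.hasDerivAt_dx (j := 1) (by norm_num) x t
  have h2 := hq.hasDerivAt_dx (j := 2) (by norm_num) x t
  have h3 := hq.hasDerivAt_dx (j := 3) (by norm_num) x t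
  have h4 := hq.hasDerivAt_dx (j := 4) (by norm_num) x t
  have c0 := HasDerivAt.conj h0
  have c1 := HasDerivAt.conj h1
  have c2 := HasDerivAt.conj h2
  have hN := h0.mul c0
  have key := (((((h0.const_mul (16 * k ^ 4 * ε + 2 * k + 1)).add
    (h1.const_mul (8 * Complex.I * k ^ 3 * ε + Complex.I))).sub
    ((h2.add ((hN.mul h0).const_mul 2)).const_mul (4 * k ^ 2 * ε))).sub
    ((h3.add ((hN.mul h1).const_mul 6)).const_mul (2 * Complex.I * k * ε))).add
    ((((((h4.add ((hN.mul h2).const_mul 8)).add (((h0.mul h0).mul c2).const_mul 2)).add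
      (((h1.mul c1).mul h0).const_mul 4)).add (((h1.mul h1).mul c0).const_mul 6)).add
      (((hN.mul hN).mul h0).const_mul 6)).const_mul (ε : ℂ)))
  refine (key.congr_of_eventuallyEq (Eventually.of_forall fun y => ?_)).congr_deriv ?_
  · simp only [laxV12, norm_sq_eq, Complex.star_def, Pi.add_apply, Pi.mul_apply, Pi.sub_apply]
    ring
  · simp only [laxV11, laxV12, dtOf, norm_sq_eq, Complex.star_def, Pi.mul_apply]
    linear_combination (2 * k * dx 1 q x t - 24 * k ^ 2 * ε * dx 1 q x t * conj (q x t) * q x t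
      - 4 * k ^ 2 * ε * dx 3 q x t + 16 * k ^ 4 * ε * dx 1 q x t + dx 1 q x t
      + ε * (20 * dx 1 q x t * dx 2 q x t * conj (q x t)
        + 30 * dx 1 q x t * conj (q x t) ^ 2 * q x t ^ 2
        + 10 * dx 1 q x t * q x t * conj (dx 2 q x t) + 10 * dx 1 q x t ^ 2 * conj (dx 1 q x t)
        + 10 * dx 2 q x t * q x t * conj (dx 1 q x t)
        + 10 * dx 3 q x t * conj (q x t) * q x t + dx 5 q x t)) * Complex.I_sq

/-- The `x`-derivative of `V`, written in the form that the zero-curvature equation gives. -/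
def laxVx (ε q₀ : ℝ) (q : ℝ → ℝ → ℂ) (k : ℂ) (x t : ℝ) : Matrix (Fin 2) (Fin 2) ℂ :=
  potMat (dtOf ε q₀ q x t) + laxU q k x t * laxV ε q₀ q k x t - laxV ε q₀ q k x t * laxU q k x t

lemma laxU_eq (q : ℝ → ℝ → ℂ) (k : ℂ) (x t : ℝ) : laxU q k x t =
    !![-(Complex.I * k), q x t; -conj (q x t), Complex.I * k] := by
  ext i j
  fin_cases i <;> fin_cases j <;> simp [laxU, sigma3, potMat]

lemma IsClassicalSolution.hasDerivAt_laxV (hq : IsClassicalSolution ε q₀ q) (k : ℂ) (x t : ℝ)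
    (i j : Fin 2) :
    HasDerivAt (fun y => laxV ε q₀ q k y t i j) (laxVx ε q₀ q k x t i j) x := by
  have h11 := hq.hasDerivAt_laxV11 k x t
  have h12 := hq.hasDerivAt_laxV12 k x t
  have h21 := (HasDerivAt.conj (hq.hasDerivAt_laxV12 (conj k) x t)).neg
  rw [laxVx, laxU_eq, laxV]
  fin_cases i <;> fin_cases j
  · refine h11.congr_deriv ?_
    simp [potMat]
    ring
  · refine h12.congr_deriv ?_
    simp [potMat]
    ring
  · refine h21.congr_deriv ?_
    simp [potMat, conj_laxV11, map_ofNat]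
    ring
  · refine h11.neg.congr_deriv ?_
    simp [potMat]
    ring

lemma continuous_potMat : Continuous potMat := by
  refine continuous_matrix fun i j => ?_
  fin_cases i <;> fin_cases j <;> simp only [potMat] <;> dsimp <;> fun_prop

lemma IsClassicalSolution.continuous_laxU (hq : IsClassicalSolution ε q₀ q) (k : ℂ) :
    Continuous fun p : ℝ × ℝ => laxU q k p.1 p.2 :=
  continuous_const.add (continuous_potMat.comp hq.continuous_q)

lemma IsClassicalSolution.continuous_laxVx (hq : IsClassicalSolution ε q₀ q) (k : ℂ) :
    Continuous fun p : ℝ × ℝ => laxVx ε q₀ q k p.1 p.2 :=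
  ((continuous_potMat.comp hq.continuous_dtOf).add
    ((hq.continuous_laxU k).mul (hq.continuous_laxV k))).sub
    ((hq.continuous_laxV k).mul (hq.continuous_laxU k))

lemma IsClassicalSolution.hasDerivAt_laxU (hq : IsClassicalSolution ε q₀ q) (k : ℂ) (x t : ℝ)
    (i j : Fin 2) :
    HasDerivAt (fun s => laxU q k x s i j) (potMat (dtOf ε q₀ q x t) i j) t := by
  have h := hq.hasDerivAt_t x t
  simp only [laxU_eq]
  fin_cases i <;> fin_cases j
  · simpa [potMat] using hasDerivAt_const t (-(Complex.I * k))
  · simpa [potMat] using h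
  · simpa [potMat] using (HasDerivAt.conj h).fun_neg
  · simpa [potMat] using hasDerivAt_const t (Complex.I * k)

/-- A solution of the space equation at time `0` extends to a solution of the Lax pair. -/
lemma IsClassicalSolution.exists_lax_solution (hq : IsClassicalSolution ε q₀ q) (k : ℂ)
    {φ₀ : ℝ → Fin 2 → ℂ} (h0 : ∀ x, HasDerivAt φ₀ (laxU q k x 0 *ᵥ φ₀ x) x) :
    ∃ φ : ℝ → ℝ → Fin 2 → ℂ, (∀ x, φ x 0 = φ₀ x) ∧
      (∀ x t, HasDerivAt (fun y => φ y t) (laxU q k x t *ᵥ φ x t) x) ∧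
      ∀ x t, HasDerivAt (fun s => φ x s) (laxV ε q₀ q k x t *ᵥ φ x t) t := by
  choose φ hφ0 hφt using fun x : ℝ => exists_linear_ode
    ((hq.continuous_laxV k).comp (Continuous.prodMk_right x)) (φ₀ x)
  refine ⟨φ, hφ0, ?_, hφt⟩
  refine hasDerivAt_space_of_time (hq.continuous_laxV k) (hq.continuous_laxVx k)
    (hq.hasDerivAt_laxV k) (hq.hasDerivAt_laxU k) (fun x t => rfl) hφt fun x => ?_
  simp only [hφ0]
  exact h0 x

/-! ### The two ends of the line -/

/-- The factor `f = 16 ε k⁴ - 8 ε q₀² k² + 2 k + 6 ε q₀⁴ + 1` with `θ = λ (x + f t)`. -/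
def freq (ε q₀ : ℝ) (z : ℂ) : ℂ :=
  16 * ε * kz q₀ z ^ 4 - 8 * ε * (q₀ : ℂ) ^ 2 * kz q₀ z ^ 2 + 2 * kz q₀ z
    + 6 * ε * (q₀ : ℂ) ^ 4 + 1

/-- The space part of the Lax pair for the constant potential `c`. -/
def asymU (c k : ℂ) : Matrix (Fin 2) (Fin 2) ℂ := !![-(Complex.I * k), c; -conj c, Complex.I * k]

/-- The behaviour of `q` at one end `l` of the line, where `q → c`. The orientation `o = ±1` turns
`l` into `-∞`. -/
structure EndData (q₀ : ℝ) (q : ℝ → ℝ → ℂ) (c : ℂ) (l : Filter ℝ) (o : ℝ) : Prop where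
  norm_c : ‖c‖ = q₀
  sq : o * o = 1
  to_bot : Tendsto (fun x => o * x) l atBot
  of_bot : Tendsto (fun x => o * x) atBot l
  tendsto_q : TendstoLocallyUniformly (fun x t => q x t) (fun _ => c) l
  tendsto_dx : ∀ j, 1 ≤ j → j ≤ 4 →
    TendstoLocallyUniformly (fun x t => dx j q x t) (fun _ => 0) l
  integrable : ∀ t a : ℝ, IntegrableOn (fun y => q (o * y) t - c) (Set.Iic a)

variable {qm qp c : ℂ} {l : Filter ℝ} {o : ℝ}

lemma HasNonzeroBoundary.endData_bot (h : HasNonzeroBoundary q₀ q qm qp) :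
    EndData q₀ q qm atBot 1 where
  norm_c := h.norm_qm
  sq := one_mul 1
  to_bot := by
    simp only [one_mul]
    exact tendsto_id
  of_bot := by
    simp only [one_mul]
    exact tendsto_id
  tendsto_q := h.tendsto_bot
  tendsto_dx := h.tendsto_dx_bot
  integrable t a := by simpa using h.integrable_bot t a

lemma HasNonzeroBoundary.endData_top (h : HasNonzeroBoundary q₀ q qm qp) :
    EndData q₀ q qp atTop (-1) where
  norm_c := h.norm_qp
  sq := by norm_num
  to_bot := by simpa using tendsto_neg_atTop_atBot
  of_bot := by simpa using tendsto_neg_atBot_atTop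
  tendsto_q := h.tendsto_top
  tendsto_dx := h.tendsto_dx_top
  integrable t a := by
    have h1 := h.integrable_top t (-a)
    have h2 : MeasurableEmbedding (fun x : ℝ => -x) := (Homeomorph.neg ℝ).measurableEmbedding
    have h3 := (Measure.measurePreserving_neg (volume : Measure ℝ)).integrableOn_comp_preimage h2
      (f := fun x => q x t - qp) (s := Set.Ici (-a))
    have h4 := h3.2 h1
    simpa [Function.comp_def] using h4

lemma tendsto_prod_of_locallyUniformly {F : ℝ → ℝ → ℂ} {a : ℂ}
    (h : TendstoLocallyUniformly F (fun _ => a) l) (t : ℝ) :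
    Tendsto (fun p : ℝ × ℝ => F p.1 p.2) (l ×ˢ 𝓝 t) (𝓝 a) :=
  Uniform.tendsto_nhds_right.2 (tendstoLocallyUniformly_iff_forall_tendsto.1 h t)

lemma laxVJet_const (ε : ℝ) (hc : ‖c‖ = q₀) (z : ℂ) :
    laxVJet ε q₀ (kz q₀ z) ![c, 0, 0, 0, 0] = freq ε q₀ z • asymU c (kz q₀ z) := by
  have h1 : c * conj c = (q₀ : ℂ) ^ 2 := by rw [← norm_sq_eq, hc]
  ext i j
  fin_cases i <;> fin_cases j
  · simp [laxVJet, laxV11Jet, freq, asymU, h1]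
    ring
  · simp [laxVJet, laxV12Jet, freq, asymU, h1]
    ring
  · have h2 : conj c * c = (q₀ : ℂ) ^ 2 := by rw [mul_comm, h1]
    simp [laxVJet, laxV12Jet, freq, asymU, h2, map_ofNat]
    ring
  · simp [laxVJet, laxV11Jet, freq, asymU, h1]
    ring

/-- At an end of the line, `V` tends to `f U_±`, locally uniformly in time. -/
lemma EndData.tendsto_laxV (h : EndData q₀ q c l o) (ε : ℝ) (z : ℂ) (t : ℝ) :
    Tendsto (fun p : ℝ × ℝ => laxV ε q₀ q (kz q₀ z) p.1 p.2) (l ×ˢ 𝓝 t)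
      (𝓝 (freq ε q₀ z • asymU c (kz q₀ z))) := by
  rw [← laxVJet_const ε h.norm_c]
  simp only [laxV_eq]
  refine ((continuous_laxVJet ε q₀ _).tendsto _).comp (tendsto_pi_nhds.2 fun j => ?_)
  fin_cases j
  · simpa [jet, dx_zero] using tendsto_prod_of_locallyUniformly h.tendsto_q t
  · exact tendsto_prod_of_locallyUniformly (h.tendsto_dx 1 (by norm_num) (by norm_num)) t
  · exact tendsto_prod_of_locallyUniformly (h.tendsto_dx 2 (by norm_num) (by norm_num)) t
  · exact tendsto_prod_of_locallyUniformly (h.tendsto_dx 3 (by norm_num) (by norm_num)) t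
  · exact tendsto_prod_of_locallyUniformly (h.tendsto_dx 4 (by norm_num) (by norm_num)) t

end

section

variable {ε q₀ : ℝ} {q : ℝ → ℝ → ℂ} {c : ℂ} {l : Filter ℝ} {o : ℝ}

/-! ### Modified Jost functions at a fixed time -/

/-- The sign with which `θ` enters column `j`: `1` for the first column, `-1` for the second. -/
def sgn : Fin 2 → ℝ := ![1, -1]

/-- The coefficient of the equation `u_x = (U ± i λ) u` of the modified Jost functions. -/
def modU (q₀ : ℝ) (q : ℝ → ℝ → ℂ) (z : ℂ) (j : Fin 2) (t x : ℝ) : Matrix (Fin 2) (Fin 2) ℂ :=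
  laxU q (kz q₀ z) x t + (sgn j * Complex.I * lam q₀ z) • 1

/-- `u` is the `j`-th column of a modified Jost function at time `t`: a solution of
`u_x = (U ± i λ) u` that tends to column `j` of `E_±` at the end `l`. -/
structure IsModifiedJost (q₀ : ℝ) (q : ℝ → ℝ → ℂ) (c : ℂ) (l : Filter ℝ) (z : ℂ) (j : Fin 2) (t : ℝ)
    (u : ℝ → Fin 2 → ℂ) : Prop where
  space : ∀ x, HasDerivAt u (modU q₀ q z j t x *ᵥ u x) x
  limit : Tendsto u l (𝓝 fun i => eigMat c z i j)

/-- The spectral parameters at which a Jost column is constructed: `z ≠ 0`, `γ(z) ≠ 0` and `Im λ`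
has the sign `σ`, or vanishes. -/
structure Admissible (q₀ σ : ℝ) (z : ℂ) : Prop where
  ne_zero : z ≠ 0
  gam_ne_zero : gam q₀ z ≠ 0
  im_nonneg : 0 ≤ σ * (lam q₀ z).im

lemma eigMat_eq (c z : ℂ) : eigMat c z =
    !![1, -(Complex.I / z) * c; -(Complex.I / z) * conj c, 1] := by
  ext i j
  fin_cases i <;> fin_cases j <;> simp [eigMat, sigma3, potMat]

/-- The inverse of `E_±` where `γ ≠ 0`. -/
def eigInv (q₀ : ℝ) (c z : ℂ) : Matrix (Fin 2) (Fin 2) ℂ :=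
  (gam q₀ z)⁻¹ • !![1, Complex.I / z * c; Complex.I / z * conj c, 1]

lemma mul_conj_eq (hc : ‖c‖ = q₀) : c * conj c = (q₀ : ℂ) ^ 2 := by rw [← norm_sq_eq, hc]

lemma eigInv_mul_eigMat (hc : ‖c‖ = q₀) {z : ℂ} (hz : gam q₀ z ≠ 0) :
    eigInv q₀ c z * eigMat c z = 1 := by
  have h1 := mul_conj_eq hc
  rw [eigInv, eigMat_eq, Matrix.smul_mul, inv_smul_eq_iff₀ hz]
  have h2 : gam q₀ z = 1 - (Complex.I / z) ^ 2 * (c * conj c) := by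
    rw [gam, h1, div_pow, Complex.I_sq]
    ring
  rw [h2]
  ext i j
  fin_cases i <;> fin_cases j <;> simp [Matrix.mul_apply, Fin.sum_univ_two] <;> ring

lemma eigMat_mul_eigInv (hc : ‖c‖ = q₀) {z : ℂ} (hz : gam q₀ z ≠ 0) :
    eigMat c z * eigInv q₀ c z = 1 :=
  mul_eq_one_comm.1 (eigInv_mul_eigMat hc hz)

/-- The exponent `± 2 i λ` of the off-diagonal component in the equation of column `j`. -/
def colDiag (q₀ : ℝ) (z : ℂ) (j : Fin 2) : Fin 2 → ℂ :=
  fun i => (sgn j - sgn i) * Complex.I * lam q₀ z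

/-- The columns of `E_±` diagonalize the constant-coefficient space equation. -/
lemma asymU_mul_eigMat (hc : ‖c‖ = q₀) {z : ℂ} (hz : z ≠ 0) (j : Fin 2) :
    (asymU c (kz q₀ z) + (sgn j * Complex.I * lam q₀ z) • 1) * eigMat c z =
      eigMat c z * diagonal (colDiag q₀ z j) := by
  have h1 := mul_conj_eq hc
  rw [eigMat_eq]
  ext a b
  fin_cases a <;> fin_cases b <;> fin_cases j <;>
    simp [asymU, kz, lam, Matrix.mul_apply, Fin.sum_univ_two, colDiag, sgn] <;> field_simp <;>
    ring_nf <;> (try simp only [Complex.I_sq]) <;> (try ring_nf)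
  · linear_combination (-2 * Complex.I) * h1
  · linear_combination -2 * h1
  · linear_combination 2 * h1
  · linear_combination (2 * Complex.I) * h1

lemma modU_eq (q₀ : ℝ) (q : ℝ → ℝ → ℂ) (c z : ℂ) (j : Fin 2) (t x : ℝ) : modU q₀ q z j t x =
    (asymU c (kz q₀ z) + (sgn j * Complex.I * lam q₀ z) • 1) + potMat (q x t - c) := by
  rw [modU, laxU_eq]
  ext a b
  fin_cases a <;> fin_cases b <;> simp [asymU, potMat]
  ring

/-- A gauge transformation `u(x) = P(x) v(o x)` from `v' = d v + A v` to the modified equation. -/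
lemma hasDerivAt_gauge {z : ℂ} {j : Fin 2} {t : ℝ} {A : ℝ → Matrix (Fin 2) (Fin 2) ℂ}
    {v : ℝ → Fin 2 → ℂ} {P P' : ℝ → Matrix (Fin 2) (Fin 2) ℂ} (ho : o * o = 1)
    (hP : ∀ x a b, HasDerivAt (fun y => P y a b) (P' x a b) x)
    (hrel : ∀ x, modU q₀ q z j t x * P x =
      P' x + P x * (diagonal (colDiag q₀ z j) + o • A (o * x)))
    (hv : ∀ y, HasDerivAt v (fun i => (o • colDiag q₀ z j) i * v y i + (A y *ᵥ v y) i) y) (x : ℝ) :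
    HasDerivAt (fun x => P x *ᵥ v (o * x)) (modU q₀ q z j t x *ᵥ (P x *ᵥ v (o * x))) x := by
  have h1 : HasDerivAt (fun x : ℝ => o * x) o x := by
    simpa using (hasDerivAt_id x).const_mul o
  have h2 := HasDerivAt.mulVec (hP x) ((hv (o * x)).scomp x h1)
  refine h2.congr_deriv ?_
  have h3 : (o • fun i => (o • colDiag q₀ z j) i * v (o * x) i + (A (o * x) *ᵥ v (o * x)) i) =
      (diagonal (colDiag q₀ z j) + o • A (o * x)) *ᵥ v (o * x) := by
    rw [Matrix.add_mulVec, Matrix.smul_mulVec]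
    ext i
    simp only [Pi.smul_apply, Pi.add_apply, Matrix.mulVec_diagonal, smul_add, smul_mul_assoc,
      smul_smul, ho, one_smul]
  simp only [Function.comp_apply]
  rw [h3, Matrix.mulVec_mulVec, Matrix.mulVec_mulVec, ← Matrix.add_mulVec, hrel]

lemma norm_potMat_le (w : ℂ) : ‖potMat w‖ ≤ ‖w‖ := by
  rw [Matrix.linfty_opNorm_def, ← coe_nnnorm, NNReal.coe_le_coe]
  refine Finset.sup_le fun i _ => ?_
  fin_cases i <;> simp [potMat]

/-- The coefficient `E_±⁻¹ (Q - Q_±) E_±` of the Volterra equation for the Jost columns, with the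
orientation `o`. -/
def jostCoef (q₀ : ℝ) (q : ℝ → ℝ → ℂ) (c : ℂ) (o t : ℝ) (z : ℂ) (y : ℝ) :
    Matrix (Fin 2) (Fin 2) ℂ :=
  o • (eigInv q₀ c z * potMat (q (o * y) t - c) * eigMat c z)

lemma re_colDiag_nonpos {z : ℂ} {j : Fin 2} (h : 0 ≤ o * sgn j * (lam q₀ z).im) (i : Fin 2) :
    ((o • colDiag q₀ z j) i).re ≤ 0 := by
  have h1 : ((o • colDiag q₀ z j) i).re = -(o * (sgn j - sgn i) * (lam q₀ z).im) := by
    simp [colDiag]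
    ring
  rw [h1]
  have h2 : o * (sgn j - sgn i) * (lam q₀ z).im = 0 ∨
      o * (sgn j - sgn i) * (lam q₀ z).im = 2 * (o * sgn j * (lam q₀ z).im) := by
    fin_cases i <;> fin_cases j <;> simp [sgn] <;> right <;> ring
  rcases h2 with h2 | h2 <;> rw [h2] <;> linarith

lemma EndData.abs_o (hE : EndData q₀ q c l o) : |o| = 1 := by
  rcases mul_self_eq_one_iff.1 hE.sq with h | h <;> simp [h]

lemma IsClassicalSolution.continuous_slice (hq : IsClassicalSolution ε q₀ q) (t : ℝ) :
    Continuous fun x => q x t :=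
  (hq.contDiff_x t).continuous

lemma jostCoef_volterraData (hq : IsClassicalSolution ε q₀ q) (hE : EndData q₀ q c l o) (t : ℝ)
    {z : ℂ} {j : Fin 2} (hz : 0 ≤ o * sgn j * (lam q₀ z).im) {C : ℝ}
    (hC : ‖eigInv q₀ c z‖ * ‖eigMat c z‖ ≤ C) :
    VolterraData (o • colDiag q₀ z j) (jostCoef q₀ q c o t z)
      (fun y => C * ‖q (o * y) t - c‖) where
  re_nonpos := re_colDiag_nonpos hz
  cont := by
    have h1 := hq.continuous_slice t
    have h2 : Continuous fun y : ℝ => potMat (q (o * y) t - c) :=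
      continuous_potMat.comp ((h1.comp (continuous_const_mul o)).sub continuous_const)
    unfold jostCoef
    fun_prop
  bound y := by
    rw [jostCoef, norm_smul, Real.norm_eq_abs, hE.abs_o, one_mul]
    calc ‖eigInv q₀ c z * potMat (q (o * y) t - c) * eigMat c z‖
        ≤ ‖eigInv q₀ c z‖ * ‖potMat (q (o * y) t - c)‖ * ‖eigMat c z‖ :=
          (norm_mul_le _ _).trans (mul_le_mul_of_nonneg_right (norm_mul_le _ _) (norm_nonneg _))
      _ ≤ ‖eigInv q₀ c z‖ * ‖q (o * y) t - c‖ * ‖eigMat c z‖ := by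
          gcongr
          exact norm_potMat_le _
      _ = ‖eigInv q₀ c z‖ * ‖eigMat c z‖ * ‖q (o * y) t - c‖ := by ring
      _ ≤ C * ‖q (o * y) t - c‖ := by gcongr
  cont_g := by
    have h1 := hq.continuous_slice t
    fun_prop
  int_g x := ((hE.integrable t x).norm).const_mul C

/-- The modified Jost column, as constructed from the Volterra equation. -/
def jostSol (q₀ : ℝ) (q : ℝ → ℝ → ℂ) (c : ℂ) (o : ℝ) (z : ℂ) (j : Fin 2) (t x : ℝ) : Fin 2 → ℂ :=
  eigMat c z *ᵥ volterraSol (o • colDiag q₀ z j) (jostCoef q₀ q c o t z) (Pi.single j 1) (o * x)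

lemma colDiag_mul_single (o : ℝ) (z : ℂ) (j i : Fin 2) :
    (o • colDiag q₀ z j) i * (Pi.single j 1 : Fin 2 → ℂ) i = 0 := by
  rcases eq_or_ne i j with rfl | h
  · simp [colDiag]
  · simp [h]

lemma modU_mul_eigMat (hc : ‖c‖ = q₀) (ho : o * o = 1) {z : ℂ} (hz : z ≠ 0) (hg : gam q₀ z ≠ 0)
    (j : Fin 2) (t x : ℝ) : modU q₀ q z j t x * eigMat c z =
      eigMat c z * (diagonal (colDiag q₀ z j) + o • jostCoef q₀ q c o t z (o * x)) := by
  rw [modU_eq q₀ q c, Matrix.add_mul, asymU_mul_eigMat hc hz, Matrix.mul_add, jostCoef, smul_smul,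
    ← mul_assoc o o x, ho, one_mul, one_smul, ← Matrix.mul_assoc, ← Matrix.mul_assoc,
    eigMat_mul_eigInv hc hg, Matrix.one_mul]

lemma mulVec_single_col (M : Matrix (Fin 2) (Fin 2) ℂ) (j : Fin 2) :
    M *ᵥ Pi.single j 1 = fun i => M i j := by
  rw [Matrix.mulVec_single_one]
  rfl

lemma jostSol_isModifiedJost (hq : IsClassicalSolution ε q₀ q) (hE : EndData q₀ q c l o) {z : ℂ}
    {j : Fin 2} (hz : Admissible q₀ (o * sgn j) z) (t : ℝ) :
    IsModifiedJost q₀ q c l z j t (jostSol q₀ q c o z j t) where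
  space x := by
    have hV := jostCoef_volterraData hq hE t hz.im_nonneg le_rfl
    exact hasDerivAt_gauge (P := fun _ => eigMat c z) (P' := fun _ => 0) hE.sq
      (fun x a b => hasDerivAt_const _ _)
      (fun x => by
        rw [zero_add]
        exact modU_mul_eigMat hE.norm_c hE.sq hz.ne_zero hz.gam_ne_zero j t x)
      (hV.hasDerivAt_sol (colDiag_mul_single o z j)) x
  limit := by
    have hV := jostCoef_volterraData hq hE t hz.im_nonneg le_rfl
    rw [← mulVec_single_col]
    have h1 : Continuous fun v : Fin 2 → ℂ => eigMat c z *ᵥ v :=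
      continuous_const.matrix_mulVec continuous_id
    exact (h1.tendsto _).comp ((hV.tendsto_sol (Pi.single j 1)).comp hE.to_bot)

/-- Uniqueness needs only the sign condition on `Im λ`: the difference of two solutions tends to
zero at the end `l`, hence vanishes by the energy estimate. -/
lemma isModifiedJost_unique (hq : IsClassicalSolution ε q₀ q) (hE : EndData q₀ q c l o) {z : ℂ}
    {j : Fin 2} (hz : Admissible q₀ (o * sgn j) z) {t : ℝ} {u₁ u₂ : ℝ → Fin 2 → ℂ}
    (h₁ : IsModifiedJost q₀ q c l z j t u₁) (h₂ : IsModifiedJost q₀ q c l z j t u₂) : u₁ = u₂ := by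
  have hV := jostCoef_volterraData hq hE t hz.im_nonneg le_rfl
  set w : ℝ → Fin 2 → ℂ := fun x => u₁ x - u₂ x with hw
  have hwd : ∀ x, HasDerivAt w (modU q₀ q z j t x *ᵥ w x) x := fun x =>
    ((h₁.space x).sub (h₂.space x)).congr_deriv (by rw [hw, Matrix.mulVec_sub])
  have hw0 : Tendsto w l (𝓝 0) := by simpa using h₁.limit.sub h₂.limit
  set v : ℝ → Fin 2 → ℂ := fun y => eigInv q₀ c z *ᵥ w (o * y) with hv
  have hwv : ∀ y, w (o * y) = eigMat c z *ᵥ v y := fun y => by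
    simp only [hv]
    rw [Matrix.mulVec_mulVec, eigMat_mul_eigInv hE.norm_c hz.gam_ne_zero, Matrix.one_mulVec]
  have hvd : ∀ y, HasDerivAt v (fun i => (o • colDiag q₀ z j) i * v y i +
      (jostCoef q₀ q c o t z y *ᵥ v y) i) y := by
    intro y
    have h1 : HasDerivAt (fun y : ℝ => o * y) o y := by
      simpa using (hasDerivAt_id y).const_mul o
    have h2 := HasDerivAt.mulVec (M := fun _ => eigInv q₀ c z) (M' := 0)
      (fun a b => hasDerivAt_const _ _) ((hwd (o * y)).scomp y h1)
    refine h2.congr_deriv ?_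
    rw [Matrix.zero_mulVec, zero_add, hwv, Matrix.mulVec_mulVec,
      modU_mul_eigMat hE.norm_c hE.sq hz.ne_zero hz.gam_ne_zero, Matrix.mulVec_smul,
      Matrix.mulVec_mulVec, ← Matrix.mul_assoc, eigInv_mul_eigMat hE.norm_c hz.gam_ne_zero,
      Matrix.one_mul, ← mul_assoc, hE.sq, one_mul, Matrix.add_mulVec, Matrix.smul_mulVec, smul_add,
      smul_smul, hE.sq, one_smul]
    ext i
    simp only [Pi.smul_apply, Pi.add_apply, Matrix.mulVec_diagonal, smul_mul_assoc]
  have hv0 : Tendsto v atBot (𝓝 0) := by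
    have h1 : Continuous fun v : Fin 2 → ℂ => eigInv q₀ c z *ᵥ v :=
      continuous_const.matrix_mulVec continuous_id
    have h2 := (h1.tendsto 0).comp (hw0.comp hE.of_bot)
    rwa [Matrix.mulVec_zero] at h2
  ext1 x
  have h3 := hwv (o * x)
  rw [hV.eq_zero_of_tendsto hvd hv0, Matrix.mulVec_zero, ← mul_assoc, hE.sq, one_mul] at h3
  exact sub_eq_zero.1 h3

end

section

variable {ε q₀ : ℝ} {q : ℝ → ℝ → ℂ} {c : ℂ} {l : Filter ℝ} {o : ℝ} {z : ℂ} {j : Fin 2}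
  {φ : ℝ → ℝ → Fin 2 → ℂ}

/-! ### Jost columns of the Lax pair -/

lemma expSigma3_apply_self (a : ℂ) (j : Fin 2) : expSigma3 a j j = Complex.exp (sgn j * a) := by
  fin_cases j <;> simp [expSigma3, sgn]

lemma theta_eq (ε q₀ x t : ℝ) (z : ℂ) : theta ε q₀ x t z = lam q₀ z * (x + freq ε q₀ z * t) := rfl

/-- The exponential factor `e^{± i θ}` of column `j`. -/
def phase (ε q₀ : ℝ) (z : ℂ) (j : Fin 2) (x t : ℝ) : ℂ :=
  Complex.exp (sgn j * (Complex.I * theta ε q₀ x t z))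

lemma phase_ne_zero (ε q₀ : ℝ) (z : ℂ) (j : Fin 2) (x t : ℝ) : phase ε q₀ z j x t ≠ 0 :=
  Complex.exp_ne_zero _

lemma hasDerivAt_phase_x (ε q₀ : ℝ) (z : ℂ) (j : Fin 2) (x t : ℝ) :
    HasDerivAt (fun y => phase ε q₀ z j y t)
      (sgn j * Complex.I * lam q₀ z * phase ε q₀ z j x t) x := by
  have h1 : HasDerivAt (fun y : ℝ => (y : ℂ)) 1 x := Complex.ofRealCLM.hasDerivAt
  have h2 := ((((h1.add_const (freq ε q₀ z * t)).const_mul (lam q₀ z)).const_mul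
    Complex.I).const_mul (sgn j : ℂ)).cexp
  refine h2.congr_deriv ?_
  rw [phase, theta_eq]
  ring

lemma hasDerivAt_phase_t (ε q₀ : ℝ) (z : ℂ) (j : Fin 2) (x t : ℝ) :
    HasDerivAt (fun s => phase ε q₀ z j x s)
      (sgn j * Complex.I * lam q₀ z * freq ε q₀ z * phase ε q₀ z j x t) t := by
  have h1 : HasDerivAt (fun y : ℝ => (y : ℂ)) 1 t := Complex.ofRealCLM.hasDerivAt
  have h2 := (((((h1.const_mul (freq ε q₀ z)).const_add (x : ℂ)).const_mul (lam q₀ z)).const_mul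
    Complex.I).const_mul (sgn j : ℂ)).cexp
  refine h2.congr_deriv ?_
  rw [phase, theta_eq]
  ring

lemma isModifiedJost_phase_smul {t : ℝ} {φ : ℝ → Fin 2 → ℂ}
    (hs : ∀ x, HasDerivAt φ (laxU q (kz q₀ z) x t *ᵥ φ x) x)
    (hl : Tendsto (fun x => phase ε q₀ z j x t • φ x) l (𝓝 fun i => eigMat c z i j)) :
    IsModifiedJost q₀ q c l z j t fun x => phase ε q₀ z j x t • φ x where
  space x := by
    refine ((hasDerivAt_phase_x ε q₀ z j x t).smul (hs x)).congr_deriv ?_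
    rw [modU, Matrix.add_mulVec, Matrix.mulVec_smul, Matrix.smul_mulVec, Matrix.one_mulVec,
      smul_smul]
  limit := hl

lemma IsJostColumn.isModifiedJost (h : IsJostColumn ε q₀ q c l z j φ) (t : ℝ) :
    IsModifiedJost q₀ q c l z j t fun x => phase ε q₀ z j x t • φ x t := by
  refine isModifiedJost_phase_smul (fun x => h.space x t) ?_
  have := h.limit t
  simp only [expSigma3_apply_self] at this
  exact this

lemma IsModifiedJost.hasDerivAt_smul {t : ℝ} {u : ℝ → Fin 2 → ℂ}
    (h : IsModifiedJost q₀ q c l z j t u) (ε x : ℝ) :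
    HasDerivAt (fun x => (phase ε q₀ z j x t)⁻¹ • u x)
      (laxU q (kz q₀ z) x t *ᵥ ((phase ε q₀ z j x t)⁻¹ • u x)) x := by
  have h1 := (hasDerivAt_phase_x ε q₀ z j x t).fun_inv (phase_ne_zero ε q₀ z j x t)
  refine (h1.smul (h.space x)).congr_deriv ?_
  have h2 := phase_ne_zero ε q₀ z j x t
  rw [modU, Matrix.add_mulVec, Matrix.mulVec_smul, Matrix.smul_mulVec, Matrix.one_mulVec, smul_add,
    smul_smul, add_assoc, ← add_smul]
  have h3 : (phase ε q₀ z j x t)⁻¹ * (sgn j * Complex.I * lam q₀ z) +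
      -(sgn j * Complex.I * lam q₀ z * phase ε q₀ z j x t) / phase ε q₀ z j x t ^ 2 = 0 := by
    field_simp
    ring
  rw [h3, zero_smul, add_zero]

/-- Column `j` of `E_±` is annihilated by `U_± ± i λ`. -/
lemma asymU_mulVec_col (hc : ‖c‖ = q₀) (hz : z ≠ 0) (j : Fin 2) :
    (asymU c (kz q₀ z) + (sgn j * Complex.I * lam q₀ z) • 1) *ᵥ (fun i => eigMat c z i j) = 0 := by
  rw [← mulVec_single_col, Matrix.mulVec_mulVec, asymU_mul_eigMat hc hz, ← Matrix.mulVec_mulVec]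
  have h1 : diagonal (colDiag q₀ z j) *ᵥ (Pi.single j 1 : Fin 2 → ℂ) = 0 := by
    ext i
    rw [Matrix.mulVec_diagonal]
    simpa using colDiag_mul_single (q₀ := q₀) 1 z j i
  rw [h1, Matrix.mulVec_zero]

/-- The normalization at an end of the line is preserved in time, because `V` tends to `f U_±`
locally uniformly in time. -/
lemma EndData.tendsto_phase_smul (hE : EndData q₀ q c l o) (hz : z ≠ 0)
    (ht : ∀ x t, HasDerivAt (fun s => φ x s) (laxV ε q₀ q (kz q₀ z) x t *ᵥ φ x t) t)
    (h0 : Tendsto (fun x => phase ε q₀ z j x 0 • φ x 0) l (𝓝 fun i => eigMat c z i j)) (T : ℝ) :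
    Tendsto (fun x => phase ε q₀ z j x T • φ x T) l (𝓝 fun i => eigMat c z i j) := by
  set e : Fin 2 → ℂ := fun i => eigMat c z i j with he
  set V : ℝ → ℝ → Matrix (Fin 2) (Fin 2) ℂ := laxV ε q₀ q (kz q₀ z) with hV
  set f : ℂ := freq ε q₀ z with hf
  set a : ℂ := sgn j * Complex.I * lam q₀ z with ha
  set V₀ : Matrix (Fin 2) (Fin 2) ℂ := f • asymU c (kz q₀ z) with hV₀
  set w : ℝ → ℝ → Fin 2 → ℂ := fun x s => phase ε q₀ z j x s • φ x s - e with hw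
  have hwd : ∀ x s, HasDerivAt (fun s => w x s)
      ((V x s + (f * a) • 1) *ᵥ w x s + (V x s - V₀) *ᵥ e) s := by
    intro x s
    refine (((hasDerivAt_phase_t ε q₀ z j x s).smul (ht x s)).sub_const e).congr_deriv ?_
    have h1 : (V₀ + (f * a) • 1) *ᵥ e = 0 := by
      rw [hV₀, mul_smul, ← smul_add, Matrix.smul_mulVec, asymU_mulVec_col hE.norm_c hz, smul_zero]
    have h2 : (V x s + (f * a) • 1) *ᵥ w x s + (V x s - V₀) *ᵥ e =
        (V x s + (f * a) • 1) *ᵥ (phase ε q₀ z j x s • φ x s) - (V₀ + (f * a) • 1) *ᵥ e := by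
      simp only [hw, Matrix.mulVec_sub, Matrix.sub_mulVec, Matrix.add_mulVec]
      abel
    rw [h2, h1, sub_zero, Matrix.add_mulVec, Matrix.mulVec_smul, Matrix.smul_mulVec,
      Matrix.one_mulVec, smul_smul, ha]
    congr 2
    ring
  have hunif : ∀ d > 0, ∀ᶠ x in l, ∀ s ∈ Set.uIcc 0 T, ‖V x s - V₀‖ < d := by
    intro d hd
    have h1 : ∀ s ∈ Set.uIcc 0 T, ∀ᶠ p : ℝ × ℝ in l ×ˢ 𝓝 s, ‖V p.1 p.2 - V₀‖ < d := fun s _ => by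
      have := (tendsto_iff_norm_sub_tendsto_zero.1 (hE.tendsto_laxV ε z s)).eventually
        (eventually_lt_nhds hd)
      exact this
    simp only [← eventually_iSup, ← isCompact_uIcc.prod_nhdsSet_eq_biSup] at h1
    exact h1.curry.mono fun _ h => h.self_of_nhdsSet
  have hw0 : Tendsto (fun x => ‖w x 0‖) l (𝓝 0) := tendsto_iff_norm_sub_tendsto_zero.1 h0
  rw [tendsto_iff_norm_sub_tendsto_zero]
  set K : ℝ := ‖V₀‖ + 1 + ‖(f * a) • (1 : Matrix (Fin 2) (Fin 2) ℂ)‖ with hK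
  have hK0 : 0 ≤ K := by positivity
  have hbound : ∀ d > 0, d ≤ 1 → ∀ᶠ x in l,
      ‖w x T‖ ≤ (‖w x 0‖ + d * ‖e‖ * |T|) * Real.exp (K * |T|) := by
    intro d hd hd1
    filter_upwards [hunif d hd] with x hx
    refine norm_le_of_norm_deriv_le hK0 (by positivity) (hwd x) fun s hs => ?_
    refine (norm_add_le _ _).trans (add_le_add (norm_mulVec_le ?_ le_rfl)
      (norm_mulVec_le (hx s hs).le le_rfl))
    refine (norm_add_le _ _).trans ?_
    have h3 := norm_le_norm_add_norm_sub' (V x s) V₀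
    have h4 := hx s hs
    rw [hK]
    linarith
  rw [Metric.tendsto_nhds]
  intro δ hδ
  set C : ℝ := (1 + ‖e‖ * |T|) * Real.exp (K * |T|) with hC
  have hC0 : 0 < C := by positivity
  set d : ℝ := min 1 (δ / (2 * C)) with hd
  have hd0 : 0 < d := by positivity
  filter_upwards [hbound d hd0 (min_le_left _ _), hw0.eventually (eventually_lt_nhds hd0)]
    with x h5 h6
  rw [dist_zero_right, norm_norm]
  have h7 : d * C ≤ δ / 2 := by
    calc d * C ≤ δ / (2 * C) * C := by gcongr; exact min_le_right _ _
      _ = δ / 2 := by field_simp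
  have h8 : (‖w x 0‖ + d * ‖e‖ * |T|) * Real.exp (K * |T|) ≤ d * C := by
    rw [hC, ← mul_assoc]
    refine mul_le_mul_of_nonneg_right ?_ (Real.exp_pos _).le
    linarith
  exact (h5.trans (h8.trans h7)).trans_lt (by linarith)

/-- The Jost column is constructed from the space equation at time `0`, extended by the time
equation; it is determined by the space equation alone, at every time. -/
lemma existsUnique_isJostColumn (hq : IsClassicalSolution ε q₀ q) (hE : EndData q₀ q c l o)
    (hz : Admissible q₀ (o * sgn j) z) : ∃! φ, IsJostColumn ε q₀ q c l z j φ := by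
  have h0 := jostSol_isModifiedJost hq hE hz 0
  obtain ⟨φ, hφ0, hφx, hφt⟩ := hq.exists_lax_solution (kz q₀ z) (h0.hasDerivAt_smul ε)
  have hlim : Tendsto (fun x => phase ε q₀ z j x 0 • φ x 0) l (𝓝 fun i => eigMat c z i j) := by
    simp only [hφ0, smul_smul, mul_inv_cancel₀ (phase_ne_zero ε q₀ z j _ _), one_smul]
    exact h0.limit
  refine ⟨φ, ⟨hφx, hφt, fun t => ?_⟩, fun ψ hψ => ?_⟩
  · simp only [expSigma3_apply_self]
    exact hE.tendsto_phase_smul hz.ne_zero hφt hlim t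
  · ext1 x
    ext1 t
    have h1 := isModifiedJost_unique hq hE hz (hψ.isModifiedJost t)
      (isModifiedJost_phase_smul (ε := ε) (fun x => hφx x t)
        (hE.tendsto_phase_smul hz.ne_zero hφt hlim t))
    exact smul_right_injective _ (phase_ne_zero ε q₀ z j x t) (congrFun h1 x)

lemma isJostColumn_jost (hq : IsClassicalSolution ε q₀ q) (hE : EndData q₀ q c l o)
    (hz : Admissible q₀ (o * sgn j) z) : IsJostColumn ε q₀ q c l z j (jost ε q₀ q c l z j) :=
  Classical.epsilon_spec (existsUnique_isJostColumn hq hE hz).exists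

lemma phase_smul_jost (hq : IsClassicalSolution ε q₀ q) (hE : EndData q₀ q c l o)
    (hz : Admissible q₀ (o * sgn j) z) (x t : ℝ) :
    phase ε q₀ z j x t • jost ε q₀ q c l z j x t = jostSol q₀ q c o z j t x :=
  congrFun (isModifiedJost_unique hq hE hz ((isJostColumn_jost hq hE hz).isModifiedJost t)
    (jostSol_isModifiedJost hq hE hz t)) x

lemma mul_expSigma3_apply (M : Matrix (Fin 2) (Fin 2) ℂ) (a : ℂ) (i j : Fin 2) :
    (M * expSigma3 a) i j = Complex.exp (sgn j * a) * M i j := by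
  fin_cases j <;> simp [Matrix.mul_apply, Fin.sum_univ_two, expSigma3, sgn, mul_comm]

/-! ### Wronskians -/

/-- The determinant with columns `v` and `w`. -/
def wron (v w : Fin 2 → ℂ) : ℂ := v 0 * w 1 - v 1 * w 0

lemma wron_smul_smul (a b : ℂ) (v w : Fin 2 → ℂ) : wron (a • v) (b • w) = a * b * wron v w := by
  simp only [wron, Pi.smul_apply, smul_eq_mul]
  ring

/-- The Wronskian of two solutions of a traceless linear system is constant. -/
lemma hasDerivAt_wron {M : Matrix (Fin 2) (Fin 2) ℂ} (hM : M 0 0 + M 1 1 = 0)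
    {v w : ℝ → Fin 2 → ℂ} {x : ℝ} (hv : HasDerivAt v (M *ᵥ v x) x)
    (hw : HasDerivAt w (M *ᵥ w x) x) : HasDerivAt (fun x => wron (v x) (w x)) 0 x := by
  rw [hasDerivAt_pi] at hv hw
  refine (((hv 0).mul (hw 1)).sub ((hv 1).mul (hw 0))).congr_deriv ?_
  simp only [Matrix.mulVec, dotProduct, Fin.sum_univ_two]
  linear_combination (v x 0 * w x 1 - v x 1 * w x 0) * hM

lemma wron_const {c₁ c₂ : ℂ} {l₁ l₂ : Filter ℝ} {j₁ j₂ : Fin 2} {φ ψ : ℝ → ℝ → Fin 2 → ℂ}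
    (hφ : IsJostColumn ε q₀ q c₁ l₁ z j₁ φ) (hψ : IsJostColumn ε q₀ q c₂ l₂ z j₂ ψ) (x t : ℝ) :
    wron (φ x t) (ψ x t) = wron (φ 0 0) (ψ 0 0) := by
  have h1 : ∀ x t, wron (φ x t) (ψ x t) = wron (φ x 0) (ψ x 0) := fun x t =>
    is_const_of_deriv_eq_zero (f := fun s => wron (φ x s) (ψ x s))
      (fun s => (hasDerivAt_wron (by simp [laxV]) (hφ.time x s) (hψ.time x s)).differentiableAt)
      (fun s => (hasDerivAt_wron (by simp [laxV]) (hφ.time x s) (hψ.time x s)).deriv) t 0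
  rw [h1]
  exact is_const_of_deriv_eq_zero (f := fun y => wron (φ y 0) (ψ y 0))
    (fun y => (hasDerivAt_wron (by simp [laxU_eq]) (hφ.space y 0) (hψ.space y 0)).differentiableAt)
    (fun y => (hasDerivAt_wron (by simp [laxU_eq]) (hφ.space y 0) (hψ.space y 0)).deriv) x 0

lemma phase_mul_phase (ε q₀ : ℝ) (z : ℂ) (x t : ℝ) :
    phase ε q₀ z 0 x t * phase ε q₀ z 1 x t = 1 := by
  rw [phase, phase, ← Complex.exp_add, Complex.exp_eq_one_iff]
  exact ⟨0, by simp [sgn]⟩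

/-- The Wronskian of the two Jost columns at one end of the line is `det E_± = γ`. -/
lemma wron_jost_self [l.NeBot] {φ ψ : ℝ → ℝ → Fin 2 → ℂ} (hc : ‖c‖ = q₀)
    (hφ : IsJostColumn ε q₀ q c l z 0 φ) (hψ : IsJostColumn ε q₀ q c l z 1 ψ) :
    wron (φ 0 0) (ψ 0 0) = gam q₀ z := by
  have h1 := (hφ.isModifiedJost 0).limit
  have h2 := (hψ.isModifiedJost 0).limit
  rw [tendsto_pi_nhds] at h1 h2
  have h3 := ((h1 0).mul (h2 1)).sub ((h1 1).mul (h2 0))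
  have h4 : ∀ x, phase ε q₀ z 0 x 0 * phase ε q₀ z 1 x 0 * wron (φ x 0) (ψ x 0)
      = wron (φ 0 0) (ψ 0 0) := fun x => by
    rw [phase_mul_phase, one_mul, wron_const hφ hψ]
  have h5 : Tendsto (fun _ : ℝ => wron (φ 0 0) (ψ 0 0)) l
      (𝓝 (eigMat c z 0 0 * eigMat c z 1 1 - eigMat c z 1 0 * eigMat c z 0 1)) := by
    refine h3.congr fun x => ?_
    rw [← h4 x, ← wron_smul_smul]
    rfl
  rw [tendsto_nhds_unique tendsto_const_nhds h5, eigMat_eq]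
  have h6 := mul_conj_eq hc
  simp only [Matrix.of_apply, Matrix.cons_val', Matrix.cons_val_zero, Matrix.cons_val_one,
    Matrix.cons_val_fin_one]
  rw [gam, ← h6]
  linear_combination (-(c * conj c) / z ^ 2) * Complex.I_sq

end

section

variable {ε q₀ : ℝ} {q : ℝ → ℝ → ℂ} {c : ℂ} {l : Filter ℝ} {o : ℝ} {z : ℂ} {j : Fin 2}

/-! ### Regions of the spectral plane -/

/-- `D^±` are the sets where `± Im λ > 0`, and `λ` is real on `Σ`. -/
lemma lam_im (q₀ : ℝ) {z : ℂ} (hz : z ≠ 0) :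
    (lam q₀ z).im = (‖z‖ ^ 2 - q₀ ^ 2) * z.im / (2 * ‖z‖ ^ 2) := by
  have h0 : ‖z‖ ^ 2 ≠ 0 := by simpa using hz
  have h1 : ((q₀ : ℂ) ^ 2 / z).im = -(q₀ ^ 2 * z.im / ‖z‖ ^ 2) := by
    rw [← Complex.normSq_eq_norm_sq, div_eq_mul_inv, ← Complex.ofReal_pow, Complex.im_ofReal_mul,
      Complex.inv_im]
    ring
  have h2 : (lam q₀ z).im = (z.im + ((q₀ : ℂ) ^ 2 / z).im) / 2 := by
    rw [lam, ← Complex.add_im]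
    simp
  rw [h2, h1]
  field_simp
  ring

lemma gam_eq_zero_iff (hz : z ≠ 0) : gam q₀ z = 0 ↔ z = Complex.I * q₀ ∨ z = -(Complex.I * q₀) := by
  have h1 : gam q₀ z * z ^ 2 = (z - Complex.I * q₀) * (z + Complex.I * q₀) := by
    rw [gam, add_mul, div_mul_cancel₀ _ (pow_ne_zero 2 hz)]
    linear_combination (q₀ : ℂ) ^ 2 * Complex.I_sq
  constructor
  · intro h
    rw [h, zero_mul, eq_comm, mul_eq_zero, sub_eq_zero, add_eq_zero_iff_eq_neg] at h1
    exact h1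
  · intro h
    have h2 : (z - Complex.I * q₀) * (z + Complex.I * q₀) = 0 := by
      rcases h with h | h
      · rw [sub_eq_zero.2 h, zero_mul]
      · rw [add_eq_zero_iff_eq_neg.2 h, mul_zero]
    rw [h2] at h1
    exact (mul_eq_zero.1 h1).resolve_right (pow_ne_zero 2 hz)

lemma gam_ne_zero_of_norm_ne (hq₀ : 0 < q₀) (hz : z ≠ 0) (h : ‖z‖ ≠ q₀) : gam q₀ z ≠ 0 := by
  rw [Ne, gam_eq_zero_iff hz]
  rintro (rfl | rfl) <;> simp [abs_of_pos hq₀] at h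

lemma SigReg.im_lam (hz : z ∈ SigReg q₀) : (lam q₀ z).im = 0 := by
  rw [lam_im q₀ hz.2.1]
  rcases hz.1 with h | h <;> simp [h]

lemma SigReg.gam_ne_zero (hz : z ∈ SigReg q₀) : gam q₀ z ≠ 0 := by
  rw [Ne, gam_eq_zero_iff hz.2.1]
  rintro (h | h)
  · exact hz.2.2.1 h
  · exact hz.2.2.2 h

lemma admissible_of_mul_pos (hq₀ : 0 < q₀) {s : ℝ} (h : 0 < s * ((‖z‖ ^ 2 - q₀ ^ 2) * z.im)) :
    Admissible q₀ s z := by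
  have hz : z ≠ 0 := by
    rintro rfl
    simp at h
  refine ⟨hz, gam_ne_zero_of_norm_ne hq₀ hz ?_, ?_⟩
  · intro h1
    simp [h1] at h
  · rw [lam_im q₀ hz, ← mul_div_assoc]
    positivity

lemma admissible_of_mem_sigReg (hz : z ∈ SigReg q₀) (s : ℝ) : Admissible q₀ s z :=
  ⟨hz.2.1, SigReg.gam_ne_zero hz, by rw [SigReg.im_lam hz, mul_zero]⟩

lemma admissible_plus (hq₀ : 0 < q₀) (hz : z ∈ Dplus q₀ ∪ SigReg q₀) : Admissible q₀ 1 z := by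
  rcases hz with hz | hz
  · exact admissible_of_mul_pos hq₀ (by rw [one_mul]; exact hz)
  · exact admissible_of_mem_sigReg hz 1

lemma admissible_minus (hq₀ : 0 < q₀) (hz : z ∈ Dminus q₀ ∪ SigReg q₀) :
    Admissible q₀ (-1) z := by
  rcases hz with hz | hz
  · refine admissible_of_mul_pos hq₀ ?_
    have : (‖z‖ ^ 2 - q₀ ^ 2) * z.im < 0 := hz
    linarith
  · exact admissible_of_mem_sigReg hz (-1)

lemma isOpen_Dplus (q₀ : ℝ) : IsOpen (Dplus q₀) :=
  isOpen_lt continuous_const (by fun_prop)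

lemma isOpen_Dminus (q₀ : ℝ) : IsOpen (Dminus q₀) :=
  isOpen_lt (by fun_prop) continuous_const

lemma compl_Sig (q₀ : ℝ) (hq₀ : 0 < q₀) : (Sig q₀)ᶜ = Dplus q₀ ∪ Dminus q₀ := by
  ext z
  have h1 : z ∈ Sig q₀ ↔ (‖z‖ ^ 2 - q₀ ^ 2) * z.im = 0 := by
    rw [mul_eq_zero, sub_eq_zero, sq_eq_sq₀ (norm_nonneg z) hq₀.le, or_comm]
    rfl
  rw [Set.mem_compl_iff, h1, ← ne_eq, ne_iff_lt_or_gt, or_comm]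
  rfl

lemma disjoint_Dplus_Dminus (q₀ : ℝ) : Disjoint (Dplus q₀) (Dminus q₀) := by
  refine Set.disjoint_left.2 fun z h1 h2 => ?_
  exact lt_asymm (show 0 < (‖z‖ ^ 2 - q₀ ^ 2) * z.im from h1) h2

/-! ### Dependence of the Jost functions on the spectral parameter -/

lemma differentiableAt_lam (hz : z ≠ 0) : DifferentiableAt ℂ (lam q₀) z := by
  unfold lam
  fun_prop (disch := assumption)

lemma differentiableAt_gam (hz : z ≠ 0) : DifferentiableAt ℂ (gam q₀) z := by
  unfold gam
  fun_prop (disch := simpa using hz)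

lemma differentiableAt_eigMat (c : ℂ) (hz : z ≠ 0) (a b : Fin 2) :
    DifferentiableAt ℂ (fun z => eigMat c z a b) z := by
  simp only [eigMat_eq]
  fin_cases a <;> fin_cases b <;> simp <;> fun_prop (disch := assumption)

lemma differentiableAt_eigInv (c : ℂ) (hz : z ≠ 0) (hg : gam q₀ z ≠ 0) (a b : Fin 2) :
    DifferentiableAt ℂ (fun z => eigInv q₀ c z a b) z := by
  have h1 := (differentiableAt_gam (q₀ := q₀) hz).fun_inv hg
  simp only [eigInv]
  fin_cases a <;> fin_cases b <;> simp <;> fun_prop (disch := assumption)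

lemma continuousAt_matrix {M : ℂ → Matrix (Fin 2) (Fin 2) ℂ}
    (h : ∀ a b, DifferentiableAt ℂ (fun z => M z a b) z) : ContinuousAt M z :=
  tendsto_pi_nhds.2 fun a => tendsto_pi_nhds.2 fun b => (h a b).continuousAt

lemma continuousAt_eigMat (c : ℂ) (hz : z ≠ 0) : ContinuousAt (eigMat c) z :=
  continuousAt_matrix (differentiableAt_eigMat c hz)

lemma continuousAt_eigInv (c : ℂ) (hz : z ≠ 0) (hg : gam q₀ z ≠ 0) :
    ContinuousAt (eigInv q₀ c) z :=
  continuousAt_matrix (differentiableAt_eigInv c hz hg)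

lemma differentiableAt_colDiag (o : ℝ) (j i : Fin 2) (hz : z ≠ 0) :
    DifferentiableAt ℂ (fun z => (o • colDiag q₀ z j) i) z := by
  have := differentiableAt_lam (q₀ := q₀) hz
  simp only [colDiag, Pi.smul_apply]
  fun_prop

lemma differentiableAt_jostCoef (q : ℝ → ℝ → ℂ) (c : ℂ) (o t y : ℝ) (hz : z ≠ 0)
    (hg : gam q₀ z ≠ 0) (a b : Fin 2) :
    DifferentiableAt ℂ (fun z => jostCoef q₀ q c o t z y a b) z := by
  simp only [jostCoef, Matrix.smul_apply, Matrix.mul_apply]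
  refine DifferentiableAt.fun_const_smul ?_ o
  refine DifferentiableAt.fun_sum fun i _ =>
    DifferentiableAt.mul ?_ (differentiableAt_eigMat c hz i b)
  exact DifferentiableAt.fun_sum fun k _ => (differentiableAt_eigInv c hz hg a k).mul_const _

/-- Near an admissible point the Volterra equations have a common majorant. -/
lemma eventually_norm_eig_lt (c : ℂ) (hz : z ≠ 0) (hg : gam q₀ z ≠ 0) :
    ∀ᶠ w in 𝓝 z, ‖eigInv q₀ c w‖ * ‖eigMat c w‖ < ‖eigInv q₀ c z‖ * ‖eigMat c z‖ + 1 :=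
  (((continuousAt_eigInv c hz hg).norm.mul (continuousAt_eigMat c hz).norm).eventually
    (eventually_lt_nhds (lt_add_one _)))

lemma continuousWithinAt_mulVec {M : ℂ → Matrix (Fin 2) (Fin 2) ℂ} {v : ℂ → Fin 2 → ℂ} {S : Set ℂ}
    (hM : ContinuousWithinAt M S z) (hv : ContinuousWithinAt v S z) :
    ContinuousWithinAt (fun z => M z *ᵥ v z) S z := by
  refine continuousWithinAt_pi.2 fun i => ?_
  simp only [Matrix.mulVec, dotProduct]
  exact tendsto_finsetSum _ fun k _ =>
    (tendsto_pi_nhds.1 (tendsto_pi_nhds.1 hM i) k).mul (continuousWithinAt_pi.1 hv k)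

lemma continuousOn_jostSol (hq : IsClassicalSolution ε q₀ q) (hE : EndData q₀ q c l o)
    (j : Fin 2) (t x : ℝ) :
    ContinuousOn (fun z => jostSol q₀ q c o z j t x) {z | Admissible q₀ (o * sgn j) z} := by
  intro z hz
  set C := ‖eigInv q₀ c z‖ * ‖eigMat c z‖ + 1 with hC
  have hev := eventually_norm_eig_lt c hz.ne_zero hz.gam_ne_zero
  set S := {z | Admissible q₀ (o * sgn j) z} ∩ {w | ‖eigInv q₀ c w‖ * ‖eigMat c w‖ < C} with hS
  have h1 : ContinuousOn (fun z => volterraSol (o • colDiag q₀ z j) (jostCoef q₀ q c o t z)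
      (Pi.single j 1) (o * x)) S := by
    refine continuousOn_volterraSol (g := fun y => C * ‖q (o * y) t - c‖)
      (fun w hw => jostCoef_volterraData hq hE t hw.1.im_nonneg hw.2.le) ?_ ?_ _ _
    · refine continuousOn_pi.2 fun i w hw => ?_
      exact (differentiableAt_colDiag o j i hw.1.ne_zero).continuousAt.continuousWithinAt
    · intro y w hw
      exact (continuousAt_matrix (differentiableAt_jostCoef q c o t y hw.1.ne_zero
        hw.1.gam_ne_zero)).continuousWithinAt
  have h2 : ContinuousWithinAt (fun z => volterraSol (o • colDiag q₀ z j) (jostCoef q₀ q c o t z)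
      (Pi.single j 1) (o * x)) {z | Admissible q₀ (o * sgn j) z} z :=
    (h1 z ⟨hz, hev.self_of_nhds⟩).mono_of_mem_nhdsWithin
      (inter_mem self_mem_nhdsWithin (mem_nhdsWithin_of_mem_nhds hev))
  exact continuousWithinAt_mulVec (continuousAt_eigMat c hz.ne_zero).continuousWithinAt h2

lemma differentiableOn_jostSol (hq : IsClassicalSolution ε q₀ q) (hE : EndData q₀ q c l o)
    (j : Fin 2) (t x : ℝ) {U : Set ℂ} (hU : IsOpen U)
    (hUA : ∀ z ∈ U, Admissible q₀ (o * sgn j) z) (i : Fin 2) :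
    DifferentiableOn ℂ (fun z => jostSol q₀ q c o z j t x i) U := by
  intro z hz
  set C := ‖eigInv q₀ c z‖ * ‖eigMat c z‖ + 1 with hC
  have hev := eventually_norm_eig_lt c (hUA z hz).ne_zero (hUA z hz).gam_ne_zero
  obtain ⟨W, hW, hWo, hzW⟩ := eventually_nhds_iff.1 hev
  have h1 : ∀ i, DifferentiableOn ℂ (fun z => volterraSol (o • colDiag q₀ z j)
      (jostCoef q₀ q c o t z) (Pi.single j 1) (o * x) i) (U ∩ W) := fun i => by
    refine differentiableOn_volterraSol (g := fun y => C * ‖q (o * y) t - c‖) (hU.inter hWo)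
      (fun w hw => jostCoef_volterraData hq hE t (hUA w hw.1).im_nonneg (hW w hw.2).le) ?_ ?_ _ _ _
    · intro i w hw
      exact (differentiableAt_colDiag o j i (hUA w hw.1).ne_zero).differentiableWithinAt
    · intro y a b w hw
      exact (differentiableAt_jostCoef q c o t y (hUA w hw.1).ne_zero
        (hUA w hw.1).gam_ne_zero a b).differentiableWithinAt
  simp only [jostSol, Matrix.mulVec, dotProduct]
  refine DifferentiableAt.differentiableWithinAt (DifferentiableAt.fun_sum fun k _ => ?_)
  exact (differentiableAt_eigMat c (hUA z hz).ne_zero i k).mul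
    ((h1 k).differentiableAt ((hU.inter hWo).mem_nhds ⟨hz, hzW⟩))

end

section

variable {ε q₀ : ℝ} {q : ℝ → ℝ → ℂ} {c qm qp : ℂ} {l : Filter ℝ} {o : ℝ} {z : ℂ} {j : Fin 2}

/-! ### Asymptotics of the Jost functions at infinity -/

lemma HasNonzeroBoundary.exists_bound (hq : IsClassicalSolution ε q₀ q)
    (h : HasNonzeroBoundary q₀ q qm qp) (t : ℝ) : ∃ M : ℝ, ∀ x, ‖q x t‖ ≤ M := by
  have h1 : ∀ᶠ x in atBot, ‖q x t‖ < ‖qm‖ + 1 :=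
    ((tendsto_prod_of_locallyUniformly h.tendsto_bot t).comp
      (tendsto_id.prodMk tendsto_const_nhds)).norm.eventually (eventually_lt_nhds (lt_add_one _))
  have h2 : ∀ᶠ x in atTop, ‖q x t‖ < ‖qp‖ + 1 :=
    ((tendsto_prod_of_locallyUniformly h.tendsto_top t).comp
      (tendsto_id.prodMk tendsto_const_nhds)).norm.eventually (eventually_lt_nhds (lt_add_one _))
  obtain ⟨a, ha⟩ := eventually_atBot.1 h1
  obtain ⟨b, hb⟩ := eventually_atTop.1 h2
  obtain ⟨C, hC⟩ := (isCompact_Icc (a := a) (b := b)).exists_bound_of_continuousOn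
    (hq.continuous_slice t).continuousOn
  refine ⟨max C (max (‖qm‖ + 1) (‖qp‖ + 1)), fun x => ?_⟩
  rcases le_or_gt x a with hxa | hxa
  · exact (ha x hxa).le.trans ((le_max_left _ _).trans (le_max_right _ _))
  rcases le_or_gt b x with hxb | hxb
  · exact (hb x hxb).le.trans ((le_max_right _ _).trans (le_max_right _ _))
  · exact (hC x ⟨hxa.le, hxb.le⟩).trans (le_max_left _ _)

/-- The failure of `E(x) = I - (i/z) σ₃ Q(x)` to diagonalize the space equation. -/
def gaugeDefect (q₀ : ℝ) (q : ℝ → ℝ → ℂ) (z : ℂ) (t x : ℝ) : Matrix (Fin 2) (Fin 2) ℂ :=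
  (Complex.I / z) • !![-(q x t * conj (q x t) - (q₀ : ℂ) ^ 2), dx 1 q x t;
    conj (dx 1 q x t), q x t * conj (q x t) - (q₀ : ℂ) ^ 2]

/-- The derivative of `E(x) = I - (i/z) σ₃ Q(x)`. -/
def gaugeDeriv (q : ℝ → ℝ → ℂ) (z : ℂ) (t x : ℝ) : Matrix (Fin 2) (Fin 2) ℂ :=
  !![0, -(Complex.I / z) * dx 1 q x t; -(Complex.I / z) * conj (dx 1 q x t), 0]

lemma hasDerivAt_eigMat (hq : IsClassicalSolution ε q₀ q) (z : ℂ) (t x : ℝ) (a b : Fin 2) :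
    HasDerivAt (fun y => eigMat (q y t) z a b) (gaugeDeriv q z t x a b) x := by
  have h1 := hq.hasDerivAt_x x t
  simp only [eigMat_eq]
  fin_cases a <;> fin_cases b
  · exact hasDerivAt_const _ _
  · exact h1.const_mul _
  · exact (HasDerivAt.conj h1).const_mul _
  · exact hasDerivAt_const _ _

/-- The gauge `E(x)`, built from `q(x)` in place of its limit, turns the coefficient into a diagonal
one up to the terms `|q|² - q₀²` and `q_x`, both multiplied by `i/z`. This is where integrability
of `q_x` is needed. -/
lemma modU_mul_eigMat_q (q₀ : ℝ) (q : ℝ → ℝ → ℂ) (hz : z ≠ 0) (j : Fin 2) (t x : ℝ) :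
    modU q₀ q z j t x * eigMat (q x t) z = gaugeDeriv q z t x +
      (eigMat (q x t) z * diagonal (colDiag q₀ z j) + gaugeDefect q₀ q z t x) := by
  rw [modU_eq q₀ q (q x t), eigMat_eq]
  ext a b
  rw [Matrix.add_apply, Matrix.add_apply, Matrix.mul_diagonal]
  fin_cases a <;> fin_cases b <;> fin_cases j <;>
    simp [asymU, potMat, kz, lam, Matrix.mul_apply, Fin.sum_univ_two, colDiag, sgn, gaugeDeriv,
      gaugeDefect] <;> field_simp <;> ring_nf <;> (try simp only [Complex.I_sq]) <;> (try ring_nf)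

lemma norm_gaugeDefect_le {M : ℝ} (hM : ∀ x, ‖q x t‖ ≤ M) (hc : ‖c‖ = q₀) (z : ℂ) (x : ℝ) :
    ‖gaugeDefect q₀ q z t x‖ ≤ 1 / ‖z‖ * ((M + q₀) * ‖q x t - c‖ + ‖dx 1 q x t‖) := by
  have h1 : ‖q x t * conj (q x t) - (q₀ : ℂ) ^ 2‖ ≤ (M + q₀) * ‖q x t - c‖ := by
    rw [← norm_sq_eq, ← hc, ← Complex.ofReal_pow, ← Complex.ofReal_pow, ← Complex.ofReal_sub,
      Complex.norm_real, Real.norm_eq_abs, sq_sub_sq, abs_mul]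
    have h2 := abs_norm_sub_norm_le (q x t) c
    have h3 := hM x
    have h4 : 0 ≤ M := (norm_nonneg _).trans h3
    rw [abs_of_nonneg (by positivity)]
    gcongr
  rw [gaugeDefect, norm_smul, norm_div, Complex.norm_I]
  refine mul_le_mul_of_nonneg_left ?_ (by positivity)
  refine le_trans ?_ (add_le_add_left h1 _)
  rw [Matrix.linfty_opNorm_def, ← coe_nnnorm, ← coe_nnnorm, ← NNReal.coe_add, NNReal.coe_le_coe]
  refine Finset.sup_le fun i _ => ?_
  fin_cases i
  · have h5 : ‖(q₀ : ℂ) ^ 2 - q x t * conj (q x t)‖₊ = ‖q x t * conj (q x t) - (q₀ : ℂ) ^ 2‖₊ := by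
      rw [← nnnorm_neg, neg_sub]
    simp [Fin.sum_univ_two, h5]
  · simp [Fin.sum_univ_two, add_comm]

/-- `E(x)` is invertible, uniformly in `x`, as soon as `|z| ≥ 2 sup |q|`. -/
lemma norm_eigInv_le {w : ℂ} {M : ℝ} (hM : ‖w‖ ≤ M) (hz : z ≠ 0) (hzM : 2 * M ≤ ‖z‖) :
    gam ‖w‖ z ≠ 0 ∧ ‖eigInv ‖w‖ w z‖ ≤ 2 := by
  have hz0 : 0 < ‖z‖ := norm_pos_iff.2 hz
  have h1 : ‖w‖ / ‖z‖ ≤ 1 / 2 := by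
    rw [div_le_iff₀ hz0]
    linarith
  have h2 : 3 / 4 ≤ ‖gam ‖w‖ z‖ := by
    have h3 : ‖((‖w‖ : ℂ) ^ 2 / z ^ 2)‖ ≤ 1 / 4 := by
      rw [← div_pow, norm_pow, norm_div, Complex.norm_real, norm_norm]
      have : 0 ≤ ‖w‖ / ‖z‖ := by positivity
      nlinarith
    have h4 := norm_sub_norm_le (1 : ℂ) (-((‖w‖ : ℂ) ^ 2 / z ^ 2))
    rw [norm_one, norm_neg, sub_neg_eq_add] at h4
    rw [gam]
    linarith
  have h5 : gam ‖w‖ z ≠ 0 := by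
    intro h
    rw [h, norm_zero] at h2
    norm_num at h2
  refine ⟨h5, ?_⟩
  rw [eigInv, norm_smul, norm_inv]
  have h6 : ‖(!![1, Complex.I / z * w; Complex.I / z * conj w, 1] : Matrix (Fin 2) (Fin 2) ℂ)‖
      ≤ 1 + ‖w‖ / ‖z‖ := by
    rw [Matrix.linfty_opNorm_def, ← coe_nnnorm, ← coe_nnnorm, ← NNReal.coe_one, ← NNReal.coe_div,
      ← NNReal.coe_add, NNReal.coe_le_coe]
    refine Finset.sup_le fun i _ => ?_
    fin_cases i
    · simp [Fin.sum_univ_two, div_eq_inv_mul]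
    · simp [Fin.sum_univ_two, div_eq_inv_mul, add_comm]
  calc ‖gam ‖w‖ z‖⁻¹ * _ ≤ (3 / 4)⁻¹ * (1 + 1 / 2) := by
        gcongr
        linarith
    _ = 2 := by norm_num

lemma norm_eigMat_sub_one_le (w z : ℂ) : ‖eigMat w z - 1‖ ≤ ‖w‖ / ‖z‖ := by
  rw [eigMat_eq, Matrix.linfty_opNorm_def, ← coe_nnnorm, ← coe_nnnorm, ← NNReal.coe_div,
    NNReal.coe_le_coe]
  refine Finset.sup_le fun i _ => ?_
  fin_cases i <;> simp [Fin.sum_univ_two, div_eq_inv_mul]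

/-- The coefficient of the Volterra equation after the gauge transformation `E(x)`. -/
def gaugeCoef (q₀ : ℝ) (q : ℝ → ℝ → ℂ) (o t : ℝ) (z : ℂ) (y : ℝ) : Matrix (Fin 2) (Fin 2) ℂ :=
  o • (eigInv ‖q (o * y) t‖ (q (o * y) t) z * gaugeDefect q₀ q z t (o * y))

/-- The majorant of `z` times the gauge-transformed coefficient. -/
def gaugeBound (q₀ : ℝ) (q : ℝ → ℝ → ℂ) (c : ℂ) (M o t y : ℝ) : ℝ :=
  2 * ((M + q₀) * ‖q (o * y) t - c‖ + ‖dx 1 q (o * y) t‖)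

lemma gaugeCoef_volterraData (hq : IsClassicalSolution ε q₀ q) (hE : EndData q₀ q c l o) {t : ℝ}
    (hint : Integrable fun y => dx 1 q y t) {M : ℝ} (hM : ∀ x, ‖q x t‖ ≤ M)
    (hz : z ≠ 0) (hzM : 2 * M ≤ ‖z‖) (hj : 0 ≤ o * sgn j * (lam q₀ z).im) :
    VolterraData (o • colDiag q₀ z j) (gaugeCoef q₀ q o t z)
      (fun y => 1 / ‖z‖ * gaugeBound q₀ q c M o t y) := by
  have hs : Continuous fun y : ℝ => q (o * y) t :=
    (hq.continuous_slice t).comp (continuous_const_mul o)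
  have hs1 : Continuous fun y : ℝ => dx 1 q (o * y) t :=
    (hq.continuous_dx 1 (by norm_num)).comp (f := fun y : ℝ => (o * y, t)) (by fun_prop)
  have hcs := Complex.continuous_conj.comp hs
  have hcs1 := Complex.continuous_conj.comp hs1
  simp only [Function.comp_def] at hcs hcs1
  refine ⟨re_colDiag_nonpos hj, ?_, fun y => ?_, ?_, fun x => ?_⟩
  · have h1 : Continuous fun y : ℝ => eigInv ‖q (o * y) t‖ (q (o * y) t) z := by
      have h2 : Continuous fun y : ℝ => (gam ‖q (o * y) t‖ z)⁻¹ :=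
        Continuous.inv₀ (continuous_const.add
          (((Complex.continuous_ofReal.comp hs.norm).pow 2).div_const _))
          fun y => (norm_eigInv_le (hM _) hz hzM).1
      refine Continuous.smul h2 (continuous_matrix fun a b => ?_)
      fin_cases a <;> fin_cases b
      · exact continuous_const
      · exact continuous_const.mul hs
      · exact continuous_const.mul hcs
      · exact continuous_const
    have h3 : Continuous fun y : ℝ => gaugeDefect q₀ q z t (o * y) := by
      refine continuous_matrix fun a b => ?_
      unfold gaugeDefect
      fin_cases a <;> fin_cases b
      · exact (((hs.mul hcs).sub continuous_const).neg).const_smul (Complex.I / z)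
      · exact hs1.const_smul (Complex.I / z)
      · exact hcs1.const_smul (Complex.I / z)
      · exact ((hs.mul hcs).sub continuous_const).const_smul (Complex.I / z)
    exact (h1.mul h3).const_smul o
  · rw [gaugeCoef, norm_smul, Real.norm_eq_abs, hE.abs_o, one_mul]
    refine (norm_mul_le _ _).trans ?_
    have h4 := (norm_eigInv_le (hM (o * y)) hz hzM).2
    have h5 := norm_gaugeDefect_le hM hE.norm_c z (o * y)
    refine (mul_le_mul h4 h5 (norm_nonneg _) (by norm_num)).trans (le_of_eq ?_)
    rw [gaugeBound]
    ring
  · exact continuous_const.mul (continuous_const.mul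
      ((continuous_const.mul (hs.sub continuous_const).norm).add hs1.norm))
  · have h6 : o ≠ 0 := by
      rintro rfl
      simpa using hE.sq
    have h7 := ((hint.comp_mul_left' h6).norm).integrableOn (s := Set.Iic x)
    exact ((((hE.integrable t x).norm.const_mul (M + q₀)).add h7).const_mul 2).const_mul _

lemma EndData.tendsto_slice (hE : EndData q₀ q c l o) (t : ℝ) :
    Tendsto (fun x => q x t) l (𝓝 c) :=
  (tendsto_prod_of_locallyUniformly hE.tendsto_q t).comp (tendsto_id.prodMk tendsto_const_nhds)

/-- The Jost column in terms of the Volterra equation with gauge `E(x)`, by uniqueness. -/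
lemma jostSol_eq_gauge (hq : IsClassicalSolution ε q₀ q) (hE : EndData q₀ q c l o) {t : ℝ}
    (hint : Integrable fun y => dx 1 q y t) {M : ℝ} (hM : ∀ x, ‖q x t‖ ≤ M)
    (hzM : 2 * M ≤ ‖z‖) (hz : Admissible q₀ (o * sgn j) z) (x : ℝ) :
    jostSol q₀ q c o z j t x = eigMat (q x t) z *ᵥ
      volterraSol (o • colDiag q₀ z j) (gaugeCoef q₀ q o t z) (Pi.single j 1) (o * x) := by
  have hV := gaugeCoef_volterraData (j := j) hq hE hint hM hz.ne_zero hzM hz.im_nonneg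
  refine congrFun (isModifiedJost_unique hq hE hz (jostSol_isModifiedJost hq hE hz t)
    (u₂ := fun x => eigMat (q x t) z *ᵥ volterraSol (o • colDiag q₀ z j) (gaugeCoef q₀ q o t z)
      (Pi.single j 1) (o * x)) ⟨?_, ?_⟩) x
  · refine hasDerivAt_gauge hE.sq (hasDerivAt_eigMat hq z t) (fun x => ?_)
      (hV.hasDerivAt_sol (colDiag_mul_single o z j))
    rw [modU_mul_eigMat_q q₀ q hz.ne_zero, Matrix.mul_add, gaugeCoef, smul_smul, ← mul_assoc o o x,
      hE.sq, one_mul, one_smul, ← Matrix.mul_assoc,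
      eigMat_mul_eigInv rfl (norm_eigInv_le (hM x) hz.ne_zero hzM).1, Matrix.one_mul]
  · rw [← mulVec_single_col]
    have h1 : Tendsto (fun x => eigMat (q x t) z) l (𝓝 (eigMat c z)) := by
      have h2 : Continuous fun w => eigMat w z := by
        unfold eigMat
        have := continuous_potMat
        fun_prop
      exact (h2.tendsto c).comp (hE.tendsto_slice t)
    have h3 := (hV.tendsto_sol (Pi.single j 1)).comp hE.to_bot
    refine tendsto_pi_nhds.2 fun i => ?_
    simp only [Matrix.mulVec, dotProduct]
    exact tendsto_finsetSum _ fun k _ =>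
      (tendsto_pi_nhds.1 (tendsto_pi_nhds.1 h1 i) k).mul (tendsto_pi_nhds.1 h3 k)

/-- `u_± = I + O(1/z)` at infinity: after the gauge transformation `E(x)` the coefficient of the
Volterra equation is `O(1/z)` in `L¹`. -/
lemma exists_jostSol_bound_infty (hq : IsClassicalSolution ε q₀ q) (hE : EndData q₀ q c l o) {t : ℝ}
    (hint : Integrable fun y => dx 1 q y t) (hb : ∃ M : ℝ, ∀ x, ‖q x t‖ ≤ M) (j : Fin 2) (x : ℝ) :
    ∃ C R : ℝ, 0 < R ∧ ∀ z, R ≤ ‖z‖ → Admissible q₀ (o * sgn j) z →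
      ‖jostSol q₀ q c o z j t x - Pi.single j 1‖ ≤ C / ‖z‖ := by
  obtain ⟨M, hM⟩ := hb
  set H := massIic (gaugeBound q₀ q c M o t) (o * x) with hH
  have hM0 : 0 ≤ M := (norm_nonneg _).trans (hM 0)
  have hq₀ : 0 ≤ q₀ := hE.norm_c ▸ norm_nonneg c
  have hH0 : 0 ≤ H := setIntegral_nonneg measurableSet_Iic fun y _ => by
    unfold gaugeBound
    positivity
  refine ⟨M * (2 * Real.exp (2 * H)) + H * (2 * Real.exp (2 * H)), max 1 (2 * M), by positivity,
    fun z hz hA => ?_⟩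
  have hz1 : 1 ≤ ‖z‖ := (le_max_left _ _).trans hz
  have hz2 : 2 * M ≤ ‖z‖ := (le_max_right _ _).trans hz
  have hz0 : 0 < ‖z‖ := by linarith
  have hV := gaugeCoef_volterraData (j := j) hq hE hint hM hA.ne_zero hz2 hA.im_nonneg
  rw [jostSol_eq_gauge hq hE hint hM hz2 hA]
  have h1 := hV.norm_sol_le (Pi.single j 1) (o * x)
  have h2 := hV.norm_sol_sub_le (Pi.single j 1) (o * x)
  have hmass : massIic (fun y => 1 / ‖z‖ * gaugeBound q₀ q c M o t y) (o * x) = 1 / ‖z‖ * H := by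
    rw [massIic, integral_const_mul]
    rfl
  have hn : ‖(Pi.single j 1 : Fin 2 → ℂ)‖ = 1 := by rw [Pi.norm_single, norm_one]
  rw [hmass, hn, mul_one] at h1 h2
  have hle : 1 / ‖z‖ * H ≤ H := by
    refine mul_le_of_le_one_left hH0 ?_
    rw [div_le_one hz0]
    exact hz1
  have hexp : Real.exp (2 * (1 / ‖z‖ * H)) ≤ Real.exp (2 * H) := by
    rw [Real.exp_le_exp]
    linarith
  set v := volterraSol (o • colDiag q₀ z j) (gaugeCoef q₀ q o t z) (Pi.single j 1) (o * x) with hv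
  have h3 : eigMat (q x t) z *ᵥ v - Pi.single j 1 =
      (eigMat (q x t) z - 1) *ᵥ v + (v - Pi.single j 1) := by
    rw [Matrix.sub_mulVec, Matrix.one_mulVec]
    abel
  rw [h3]
  have h4 : ‖eigMat (q x t) z - 1‖ ≤ M / ‖z‖ :=
    (norm_eigMat_sub_one_le _ _).trans (div_le_div_of_nonneg_right (hM x) hz0.le)
  have h5 : ‖v‖ ≤ 2 * Real.exp (2 * H) := h1.trans (by linarith)
  refine (norm_add_le _ _).trans ((add_le_add (norm_mulVec_le h4 h5) (h2.trans
    (mul_le_mul_of_nonneg_left (mul_le_mul_of_nonneg_left hexp zero_le_two)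
      (by positivity)))).trans (le_of_eq ?_))
  ring

/-! ### The symmetry `z ↦ -q₀²/z` and asymptotics at zero -/

/-- The involution `z ↦ -q₀²/z`, which preserves `k` and changes the sign of `λ`. -/
def inv0 (q₀ : ℝ) (z : ℂ) : ℂ := -((q₀ : ℂ) ^ 2 / z)

lemma kz_inv0 (hq₀ : q₀ ≠ 0) (hz : z ≠ 0) : kz q₀ (inv0 q₀ z) = kz q₀ z := by
  have : (q₀ : ℂ) ≠ 0 := by exact_mod_cast hq₀
  rw [kz, kz, inv0]
  field_simp
  ring

lemma lam_inv0 (hq₀ : q₀ ≠ 0) (hz : z ≠ 0) : lam q₀ (inv0 q₀ z) = -lam q₀ z := by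
  have : (q₀ : ℂ) ≠ 0 := by exact_mod_cast hq₀
  rw [lam, lam, inv0]
  field_simp
  ring

lemma gam_inv0 (hq₀ : q₀ ≠ 0) (hz : z ≠ 0) :
    gam q₀ (inv0 q₀ z) = z ^ 2 / (q₀ : ℂ) ^ 2 * gam q₀ z := by
  have : (q₀ : ℂ) ≠ 0 := by exact_mod_cast hq₀
  rw [gam, gam, inv0]
  field_simp
  ring

/-- The coefficient in `u_j(z) = (κ_j / z) u_{1-j}(-q₀²/z)`. -/
def kap (c : ℂ) : Fin 2 → ℂ := ![-Complex.I * conj c, -Complex.I * c]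

lemma norm_kap (c : ℂ) (j : Fin 2) : ‖kap c j‖ = ‖c‖ := by
  fin_cases j <;> simp [kap]

lemma sgn_one_sub (j : Fin 2) : sgn (1 - j) = -sgn j := by
  fin_cases j <;> simp [sgn]

lemma Admissible.inv0 (hq₀ : q₀ ≠ 0) (h : Admissible q₀ (o * sgn j) z) :
    Admissible q₀ (o * sgn (1 - j)) (inv0 q₀ z) := by
  have h0 : (q₀ : ℂ) ≠ 0 := by exact_mod_cast hq₀
  refine ⟨?_, ?_, ?_⟩
  · rw [IfoNLS.inv0, neg_ne_zero]
    exact div_ne_zero (pow_ne_zero 2 h0) h.ne_zero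
  · rw [gam_inv0 hq₀ h.ne_zero]
    exact mul_ne_zero (div_ne_zero (pow_ne_zero 2 h.ne_zero) (pow_ne_zero 2 h0)) h.gam_ne_zero
  · rw [lam_inv0 hq₀ h.ne_zero, sgn_one_sub, Complex.neg_im]
    simpa using h.im_nonneg

lemma eigMat_inv0 (hq₀ : q₀ ≠ 0) (hc : ‖c‖ = q₀) (hz : z ≠ 0) (i j : Fin 2) :
    eigMat c z i j = kap c j / z * eigMat c (inv0 q₀ z) i (1 - j) := by
  have h0 : (q₀ : ℂ) ≠ 0 := by exact_mod_cast hq₀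
  have h1 := mul_conj_eq hc
  have h2 := Complex.I_sq
  rw [eigMat_eq, eigMat_eq, inv0]
  fin_cases i <;> fin_cases j <;> simp [kap] <;> field_simp <;> simp only [Complex.I_sq] <;>
    first | linear_combination h1 | linear_combination -h1

/-- The involution exchanges the two Jost columns at the same end of the line. -/
lemma jostSol_symm (hq : IsClassicalSolution ε q₀ q) (hE : EndData q₀ q c l o) (hq₀ : q₀ ≠ 0)
    (hz : Admissible q₀ (o * sgn j) z) (t x : ℝ) :
    jostSol q₀ q c o z j t x = (kap c j / z) • jostSol q₀ q c o (inv0 q₀ z) (1 - j) t x := by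
  have h1 := jostSol_isModifiedJost hq hE (hz.inv0 hq₀) t
  refine congrFun (isModifiedJost_unique hq hE hz (jostSol_isModifiedJost hq hE hz t)
    (u₂ := fun x => (kap c j / z) • jostSol q₀ q c o (inv0 q₀ z) (1 - j) t x) ⟨fun x => ?_, ?_⟩) x
  · refine ((h1.space x).const_smul (kap c j / z)).congr_deriv ?_
    rw [Matrix.mulVec_smul, modU, modU, kz_inv0 hq₀ hz.ne_zero, lam_inv0 hq₀ hz.ne_zero,
      sgn_one_sub]
    congr 4
    push_cast
    ring
  · have h2 := h1.limit.const_smul (kap c j / z)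
    refine (h2.congr fun x => rfl).trans (le_of_eq ?_)
    congr 1
    ext i
    rw [eigMat_inv0 hq₀ hE.norm_c hz.ne_zero i j]
    rfl

/-- `u_± = -(i/z) σ₃ Q_± + O(1)` at zero. -/
lemma exists_jostSol_bound_zero (hq : IsClassicalSolution ε q₀ q) (hE : EndData q₀ q c l o)
    (hq₀ : 0 < q₀) {t : ℝ} (hint : Integrable fun y => dx 1 q y t)
    (hb : ∃ M : ℝ, ∀ x, ‖q x t‖ ≤ M) (j : Fin 2) (x : ℝ) :
    ∃ C r : ℝ, 0 < r ∧ ∀ z, ‖z‖ ≤ r → Admissible q₀ (o * sgn j) z →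
      ‖jostSol q₀ q c o z j t x - (kap c j / z) • Pi.single (1 - j) 1‖ ≤ C := by
  obtain ⟨C, R, hR, h⟩ := exists_jostSol_bound_infty hq hE hint hb (1 - j) x
  refine ⟨C / q₀, q₀ ^ 2 / R, by positivity, fun z hz hA => ?_⟩
  have hz0 : 0 < ‖z‖ := norm_pos_iff.2 hA.ne_zero
  have hn : ‖inv0 q₀ z‖ = q₀ ^ 2 / ‖z‖ := by
    rw [inv0, norm_neg, norm_div, norm_pow, Complex.norm_real, Real.norm_of_nonneg hq₀.le]
  have h1 := h (inv0 q₀ z) (by rw [hn]; rw [le_div_iff₀ hR] at hz; rw [le_div_iff₀ hz0]; linarith)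
    (hA.inv0 hq₀.ne')
  rw [jostSol_symm hq hE hq₀.ne' hA, ← smul_sub, norm_smul, norm_div, norm_kap, hE.norm_c]
  rw [hn] at h1
  refine (mul_le_mul_of_nonneg_left h1 (by positivity)).trans (le_of_eq ?_)
  field_simp

end

section

variable {ε q₀ : ℝ} {q : ℝ → ℝ → ℂ} {c₁ c₂ qm qp : ℂ} {l₁ l₂ : Filter ℝ} {o₁ o₂ : ℝ} {z : ℂ}

/-! ### The scattering coefficients -/

lemma Admissible.col_zero (h : Admissible q₀ o₁ z) : Admissible q₀ (o₁ * sgn 0) z := by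
  simpa [sgn] using h

lemma Admissible.col_one (h : Admissible q₀ o₁ z) (ho : o₂ = -o₁) :
    Admissible q₀ (o₂ * sgn 1) z := by
  simpa [sgn, ho] using h

lemma uM_apply (hq : IsClassicalSolution ε q₀ q) (hE : EndData q₀ q qm atBot 1) {j : Fin 2}
    (hz : Admissible q₀ (1 * sgn j) z) (x t : ℝ) (i : Fin 2) :
    uM ε q₀ q qm x t z i j = jostSol q₀ q qm 1 z j t x i := by
  rw [uM, mul_expSigma3_apply, ← phase_smul_jost hq hE hz]
  rfl

lemma uP_apply (hq : IsClassicalSolution ε q₀ q) (hE : EndData q₀ q qp atTop (-1)) {j : Fin 2}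
    (hz : Admissible q₀ (-1 * sgn j) z) (x t : ℝ) (i : Fin 2) :
    uP ε q₀ q qp x t z i j = jostSol q₀ q qp (-1) z j t x i := by
  rw [uP, mul_expSigma3_apply, ← phase_smul_jost hq hE hz]
  rfl

/-- The Wronskian of a first and a second column of modified Jost functions from opposite ends,
divided by `γ`. It is `s₂₂` if the first column comes from `-∞`, and `s₁₁` if it comes from `+∞`. -/
def pairS (q₀ : ℝ) (q : ℝ → ℝ → ℂ) (c₁ c₂ : ℂ) (o₁ o₂ t x : ℝ) (z : ℂ) : ℂ :=
  wron (jostSol q₀ q c₁ o₁ z 0 t x) (jostSol q₀ q c₂ o₂ z 1 t x) / gam q₀ z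

lemma wron_jost_div_gam (hq : IsClassicalSolution ε q₀ q) (hE₁ : EndData q₀ q c₁ l₁ o₁)
    (hE₂ : EndData q₀ q c₂ l₂ o₂) (ho : o₂ = -o₁) (hz : Admissible q₀ o₁ z) (x t : ℝ) :
    wron (jost ε q₀ q c₁ l₁ z 0 0 0) (jost ε q₀ q c₂ l₂ z 1 0 0) / gam q₀ z =
      pairS q₀ q c₁ c₂ o₁ o₂ t x z := by
  rw [pairS, ← phase_smul_jost hq hE₁ hz.col_zero, ← phase_smul_jost hq hE₂ (hz.col_one ho),
    wron_smul_smul, phase_mul_phase, one_mul,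
    wron_const (isJostColumn_jost hq hE₁ hz.col_zero) (isJostColumn_jost hq hE₂ (hz.col_one ho))
      x t]

lemma wron_jost_mul_gam (hq : IsClassicalSolution ε q₀ q) (hE₁ : EndData q₀ q c₁ l₁ o₁)
    (hE₂ : EndData q₀ q c₂ l₂ o₂) (ho : o₂ = -o₁) (hz : Admissible q₀ o₁ z) (x t : ℝ) :
    wron (jost ε q₀ q c₁ l₁ z 0 0 0) (jost ε q₀ q c₂ l₂ z 1 0 0) / gam q₀ z * gam q₀ z =
      wron (jost ε q₀ q c₁ l₁ z 0 x t) (jost ε q₀ q c₂ l₂ z 1 x t) := by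
  rw [div_mul_cancel₀ _ hz.gam_ne_zero,
    wron_const (isJostColumn_jost hq hE₁ hz.col_zero) (isJostColumn_jost hq hE₂ (hz.col_one ho))
      x t]

/-- `φ_+ = φ_- S`: Cramer's rule, with Wronskians that do not depend on `(x,t)`. -/
lemma phiP_eq_phiM_mul_scatMat (hq : IsClassicalSolution ε q₀ q)
    (hbc : HasNonzeroBoundary q₀ q qm qp) (hz : z ∈ SigReg q₀) (x t : ℝ) :
    phiP ε q₀ q qp x t z = phiM ε q₀ q qm x t z * scatMat ε q₀ q qm qp z := by
  have hM : ∀ j, IsJostColumn ε q₀ q qm atBot z j (jost ε q₀ q qm atBot z j) := fun j =>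
    isJostColumn_jost hq hbc.endData_bot (admissible_of_mem_sigReg hz _)
  have hP : ∀ j, IsJostColumn ε q₀ q qp atTop z j (jost ε q₀ q qp atTop z j) := fun j =>
    isJostColumn_jost hq hbc.endData_top (admissible_of_mem_sigReg hz _)
  have hg : gam q₀ z ≠ 0 := SigReg.gam_ne_zero hz
  have h0 := (wron_const (hM 0) (hM 1) x t).trans (wron_jost_self hbc.norm_qm (hM 0) (hM 1))
  have h1 : s11 ε q₀ q qm qp z * gam q₀ z = _ :=
    (div_mul_cancel₀ _ hg).trans (wron_const (hP 0) (hM 1) x t).symm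
  have h2 : s12 ε q₀ q qm qp z * gam q₀ z = _ :=
    (div_mul_cancel₀ _ hg).trans (wron_const (hP 1) (hM 1) x t).symm
  have h3 : s21 ε q₀ q qm qp z * gam q₀ z = _ :=
    (div_mul_cancel₀ _ hg).trans (wron_const (hM 0) (hP 0) x t).symm
  have h4 : s22 ε q₀ q qm qp z * gam q₀ z = _ :=
    (div_mul_cancel₀ _ hg).trans (wron_const (hM 0) (hP 1) x t).symm
  simp only [wron] at h0 h1 h2 h3 h4
  have key : gam q₀ z • phiP ε q₀ q qp x t z =
      gam q₀ z • (phiM ε q₀ q qm x t z * scatMat ε q₀ q qm qp z) := by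
    ext i j
    simp only [Matrix.smul_apply, Matrix.mul_apply, Fin.sum_univ_two, smul_eq_mul]
    fin_cases i <;> fin_cases j <;> simp [phiP, phiM, scatMat, -mul_eq_mul_left_iff]
    · linear_combination (-(jost ε q₀ q qp atTop z 0 x t 0)) * h0
        - jost ε q₀ q qm atBot z 0 x t 0 * h1 - jost ε q₀ q qm atBot z 1 x t 0 * h3
    · linear_combination (-(jost ε q₀ q qp atTop z 1 x t 0)) * h0
        - jost ε q₀ q qm atBot z 0 x t 0 * h2 - jost ε q₀ q qm atBot z 1 x t 0 * h4
    · linear_combination (-(jost ε q₀ q qp atTop z 0 x t 1)) * h0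
        - jost ε q₀ q qm atBot z 0 x t 1 * h1 - jost ε q₀ q qm atBot z 1 x t 1 * h3
    · linear_combination (-(jost ε q₀ q qp atTop z 1 x t 1)) * h0
        - jost ε q₀ q qm atBot z 0 x t 1 * h2 - jost ε q₀ q qm atBot z 1 x t 1 * h4
  exact smul_right_injective _ hg key

/-! ### The jump condition -/

/-- The jump condition is `φ_+ = φ_- S`, solved for the columns that are analytic in `D^±`. -/
lemma MP_eq_MM_mul_jump (hq : IsClassicalSolution ε q₀ q)
    (hbc : HasNonzeroBoundary q₀ q qm qp) (hz : z ∈ SigReg q₀)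
    (h11 : s11 ε q₀ q qm qp z ≠ 0) (h22 : s22 ε q₀ q qm qp z ≠ 0) (x t : ℝ) :
    MP ε q₀ q qm qp x t z = MM ε q₀ q qm qp x t z * (1 - jumpG ε q₀ q qm qp x t z) := by
  have hS := phiP_eq_phiM_mul_scatMat hq hbc hz x t
  have hS0 : ∀ i, phiP ε q₀ q qp x t z i 0 = phiM ε q₀ q qm x t z i 0 * s11 ε q₀ q qm qp z
      + phiM ε q₀ q qm x t z i 1 * s21 ε q₀ q qm qp z := fun i => by
    rw [hS, Matrix.mul_apply, Fin.sum_univ_two]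
    rfl
  have hS1 : ∀ i, phiP ε q₀ q qp x t z i 1 = phiM ε q₀ q qm x t z i 0 * s12 ε q₀ q qm qp z
      + phiM ε q₀ q qm x t z i 1 * s22 ε q₀ q qm qp z := fun i => by
    rw [hS, Matrix.mul_apply, Fin.sum_univ_two]
    rfl
  set a : ℂ := Complex.I * theta ε q₀ x t z with ha
  have hE : Complex.exp (-a) = (Complex.exp a)⁻¹ := Complex.exp_neg a
  have hE0 : Complex.exp a ≠ 0 := Complex.exp_ne_zero a
  have hG : 1 - jumpG ε q₀ q qm qp x t z =
      !![1, rhoT ε q₀ q qm qp z * (Complex.exp a)⁻¹ ^ 2; -(rho ε q₀ q qm qp z * Complex.exp a ^ 2),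
        1 - rho ε q₀ q qm qp z * rhoT ε q₀ q qm qp z] := by
    rw [jumpG, ← ha]
    ext i j
    rw [Matrix.sub_apply, mul_expSigma3_apply]
    fin_cases i <;> fin_cases j <;>
      simp [Matrix.mul_apply, Fin.sum_univ_two, expSigma3, sgn, hE] <;> field_simp
  have hcol : ∀ i, uM ε q₀ q qm x t z i 0 =
      uP ε q₀ q qp x t z i 0 / s11 ε q₀ q qm qp z
        - uM ε q₀ q qm x t z i 1 * (rho ε q₀ q qm qp z * Complex.exp a ^ 2) ∧
      uP ε q₀ q qp x t z i 1 / s22 ε q₀ q qm qp z =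
      uP ε q₀ q qp x t z i 0 / s11 ε q₀ q qm qp z
          * (rhoT ε q₀ q qm qp z * (Complex.exp a)⁻¹ ^ 2)
        + uM ε q₀ q qm x t z i 1 * (1 - rho ε q₀ q qm qp z * rhoT ε q₀ q qm qp z) := fun i => by
    simp only [uM, uP, mul_expSigma3_apply, ← ha, hS0, hS1, rho, rhoT]
    simp only [sgn, Matrix.cons_val_zero, Matrix.cons_val_one, Complex.ofReal_one,
      Complex.ofReal_neg, one_mul, neg_mul, hE]
    constructor <;> field_simp <;> ring
  rw [hG]
  ext i j
  rw [Matrix.mul_apply, Fin.sum_univ_two]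
  fin_cases i <;> fin_cases j <;> simp [MP, MM]
  · linear_combination (hcol 0).1
  · linear_combination (hcol 0).2
  · linear_combination (hcol 1).1
  · linear_combination (hcol 1).2

/-! ### Meromorphy and boundary values -/

lemma meromorphicAt_pairS (hq : IsClassicalSolution ε q₀ q) (hE₁ : EndData q₀ q c₁ l₁ o₁)
    (hE₂ : EndData q₀ q c₂ l₂ o₂) (ho : o₂ = -o₁) {U : Set ℂ} (hU : IsOpen U)
    (hUA : ∀ z ∈ U, Admissible q₀ o₁ z)
    (hz : z ∈ U) (t x : ℝ) : MeromorphicAt (pairS q₀ q c₁ c₂ o₁ o₂ t x) z := by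
  have h1 : ∀ i, MeromorphicAt (fun z => jostSol q₀ q c₁ o₁ z 0 t x i) z := fun i =>
    ((differentiableOn_jostSol hq hE₁ 0 t x hU (fun z h => (hUA z h).col_zero) i).analyticAt
      (hU.mem_nhds hz)).meromorphicAt
  have h2 : ∀ i, MeromorphicAt (fun z => jostSol q₀ q c₂ o₂ z 1 t x i) z := fun i =>
    ((differentiableOn_jostSol hq hE₂ 1 t x hU (fun z h => (hUA z h).col_one ho) i).analyticAt
      (hU.mem_nhds hz)).meromorphicAt
  have h3 : MeromorphicAt (gam q₀) z :=
    ((DifferentiableOn.analyticAt (s := U) (fun w hw =>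
      (differentiableAt_gam (hUA w hw).ne_zero).differentiableWithinAt)
        (hU.mem_nhds hz))).meromorphicAt
  exact (((h1 0).mul (h2 1)).sub ((h1 1).mul (h2 0))).div h3

lemma continuousOn_pairS (hq : IsClassicalSolution ε q₀ q) (hE₁ : EndData q₀ q c₁ l₁ o₁)
    (hE₂ : EndData q₀ q c₂ l₂ o₂) (ho : o₂ = -o₁) (t x : ℝ) :
    ContinuousOn (pairS q₀ q c₁ c₂ o₁ o₂ t x) {z | Admissible q₀ o₁ z} := by
  have h1 := continuousOn_pi.1 ((continuousOn_jostSol hq hE₁ 0 t x).mono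
    fun z (h : Admissible q₀ o₁ z) => h.col_zero)
  have h2 := continuousOn_pi.1 ((continuousOn_jostSol hq hE₂ 1 t x).mono
    fun z (h : Admissible q₀ o₁ z) => h.col_one ho)
  refine (((h1 0).mul (h2 1)).sub ((h1 1).mul (h2 0))).div (fun z hz => ?_) fun z hz =>
    hz.gam_ne_zero
  exact (differentiableAt_gam hz.ne_zero).continuousAt.continuousWithinAt

/-- The entries of `M⁺` in terms of the Volterra solutions. -/
lemma MP_eq (hq₀ : 0 < q₀) (hq : IsClassicalSolution ε q₀ q) (hbc : HasNonzeroBoundary q₀ q qm qp)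
    (hz : z ∈ Dplus q₀ ∪ SigReg q₀) (x t : ℝ) (i : Fin 2) :
    MP ε q₀ q qm qp x t z i 0 = jostSol q₀ q qm 1 z 0 t x i ∧
    MP ε q₀ q qm qp x t z i 1 =
      jostSol q₀ q qp (-1) z 1 t x i / pairS q₀ q qm qp 1 (-1) t x z := by
  have hA := admissible_plus hq₀ hz
  have h1 : s22 ε q₀ q qm qp z = _ :=
    wron_jost_div_gam hq hbc.endData_bot hbc.endData_top rfl hA x t
  rw [← h1, ← uM_apply hq hbc.endData_bot hA.col_zero,
    ← uP_apply hq hbc.endData_top (hA.col_one rfl)]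
  fin_cases i <;> exact ⟨rfl, rfl⟩

/-- The entries of `M⁻` in terms of the Volterra solutions. -/
lemma MM_eq (hq₀ : 0 < q₀) (hq : IsClassicalSolution ε q₀ q) (hbc : HasNonzeroBoundary q₀ q qm qp)
    (hz : z ∈ Dminus q₀ ∪ SigReg q₀) (x t : ℝ) (i : Fin 2) :
    MM ε q₀ q qm qp x t z i 0 =
      jostSol q₀ q qp (-1) z 0 t x i / pairS q₀ q qp qm (-1) 1 t x z ∧
    MM ε q₀ q qm qp x t z i 1 = jostSol q₀ q qm 1 z 1 t x i := by
  have hA := admissible_minus hq₀ hz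
  have ho : (1 : ℝ) = -(-1) := (neg_neg 1).symm
  have h1 : s11 ε q₀ q qm qp z = _ :=
    wron_jost_div_gam hq hbc.endData_top hbc.endData_bot ho hA x t
  rw [← h1, ← uP_apply hq hbc.endData_top hA.col_zero,
    ← uM_apply hq hbc.endData_bot (hA.col_one ho)]
  fin_cases i <;> exact ⟨rfl, rfl⟩

lemma RHM_of_mem_Dplus (hz : z ∈ Dplus q₀) (x t : ℝ) :
    RHM ε q₀ q qm qp x t z = MP ε q₀ q qm qp x t z := if_pos hz

lemma RHM_of_mem_Dminus (hz : z ∈ Dminus q₀) (x t : ℝ) :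
    RHM ε q₀ q qm qp x t z = MM ε q₀ q qm qp x t z :=
  (if_neg fun h => Set.disjoint_left.1 (disjoint_Dplus_Dminus q₀) h hz).trans (if_pos hz)

lemma meromorphicOn_RHM (hq₀ : 0 < q₀) (hq : IsClassicalSolution ε q₀ q)
    (hbc : HasNonzeroBoundary q₀ q qm qp) (x t : ℝ) (i j : Fin 2) :
    MeromorphicOn (fun z => RHM ε q₀ q qm qp x t z i j) (Sig q₀)ᶜ := by
  rw [compl_Sig q₀ hq₀]
  have hbot := hbc.endData_bot
  have htop := hbc.endData_top
  have ho : (1 : ℝ) = -(-1) := (neg_neg 1).symm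
  rintro z (hz | hz)
  · have hU := isOpen_Dplus q₀
    have hUA : ∀ z ∈ Dplus q₀, Admissible q₀ 1 z := fun z h => admissible_plus hq₀ (Or.inl h)
    have h1 := ((differentiableOn_jostSol hq hbot 0 t x hU (fun z h => (hUA z h).col_zero)
      i).analyticAt (hU.mem_nhds hz)).meromorphicAt
    have h2 := ((differentiableOn_jostSol hq htop 1 t x hU (fun z h => (hUA z h).col_one rfl)
      i).analyticAt (hU.mem_nhds hz)).meromorphicAt
    have h3 := meromorphicAt_pairS hq hbot htop rfl hU hUA hz t x
    have h4 : ∀ᶠ w in 𝓝[≠] z, w ∈ Dplus q₀ := mem_nhdsWithin_of_mem_nhds (hU.mem_nhds hz)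
    fin_cases j
    · refine h1.congr (h4.mono fun w hw => ?_)
      exact ((congrFun (congrFun (RHM_of_mem_Dplus hw x t) i) 0).trans
        (MP_eq hq₀ hq hbc (Or.inl hw) x t i).1).symm
    · refine (h2.div h3).congr (h4.mono fun w hw => ?_)
      exact ((congrFun (congrFun (RHM_of_mem_Dplus hw x t) i) 1).trans
        (MP_eq hq₀ hq hbc (Or.inl hw) x t i).2).symm
  · have hU := isOpen_Dminus q₀
    have hUA : ∀ z ∈ Dminus q₀, Admissible q₀ (-1) z := fun z h => admissible_minus hq₀ (Or.inl h)
    have h1 := ((differentiableOn_jostSol hq htop 0 t x hU (fun z h => (hUA z h).col_zero)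
      i).analyticAt (hU.mem_nhds hz)).meromorphicAt
    have h2 := ((differentiableOn_jostSol hq hbot 1 t x hU (fun z h => (hUA z h).col_one ho)
      i).analyticAt (hU.mem_nhds hz)).meromorphicAt
    have h3 := meromorphicAt_pairS hq htop hbot ho hU hUA hz t x
    have h4 : ∀ᶠ w in 𝓝[≠] z, w ∈ Dminus q₀ := mem_nhdsWithin_of_mem_nhds (hU.mem_nhds hz)
    fin_cases j
    · refine (h1.div h3).congr (h4.mono fun w hw => ?_)
      exact ((congrFun (congrFun (RHM_of_mem_Dminus hw x t) i) 0).trans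
        (MM_eq hq₀ hq hbc (Or.inl hw) x t i).1).symm
    · refine h2.congr (h4.mono fun w hw => ?_)
      exact ((congrFun (congrFun (RHM_of_mem_Dminus hw x t) i) 1).trans
        (MM_eq hq₀ hq hbc (Or.inl hw) x t i).2).symm

lemma tendsto_RHM_Dplus (hq₀ : 0 < q₀) (hq : IsClassicalSolution ε q₀ q)
    (hbc : HasNonzeroBoundary q₀ q qm qp) (hz : z ∈ SigReg q₀)
    (h22 : s22 ε q₀ q qm qp z ≠ 0) (x t : ℝ) :
    Tendsto (RHM ε q₀ q qm qp x t) (𝓝[Dplus q₀] z) (𝓝 (MP ε q₀ q qm qp x t z)) := by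
  have hbot := hbc.endData_bot
  have htop := hbc.endData_top
  have hz' : z ∈ Dplus q₀ ∪ SigReg q₀ := Or.inr hz
  have hA := admissible_plus hq₀ hz'
  have hle : 𝓝[Dplus q₀] z ≤ 𝓝[{z | Admissible q₀ 1 z}] z :=
    nhdsWithin_mono z fun w hw => admissible_plus hq₀ (Or.inl hw)
  have h0 : s22 ε q₀ q qm qp z = pairS q₀ q qm qp 1 (-1) t x z :=
    wron_jost_div_gam hq hbot htop rfl hA x t
  have h1 := ((continuousOn_jostSol hq hbot 0 t x).mono
    fun z (h : Admissible q₀ 1 z) => h.col_zero) z hA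
  have h2 := ((continuousOn_jostSol hq htop 1 t x).mono
    fun z (h : Admissible q₀ 1 z) => h.col_one rfl) z hA
  have h3 := continuousOn_pairS hq hbot htop rfl t x z hA
  refine tendsto_pi_nhds.2 fun i => tendsto_pi_nhds.2 fun j => ?_
  fin_cases j
  · refine Tendsto.congr' (eventually_mem_nhdsWithin.mono fun w hw =>
      ((congrFun (congrFun (RHM_of_mem_Dplus hw x t) i) 0).trans
        (MP_eq hq₀ hq hbc (Or.inl hw) x t i).1).symm) ?_
    exact (MP_eq hq₀ hq hbc hz' x t i).1 ▸ (tendsto_pi_nhds.1 h1 i).mono_left hle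
  · refine Tendsto.congr' (eventually_mem_nhdsWithin.mono fun w hw =>
      ((congrFun (congrFun (RHM_of_mem_Dplus hw x t) i) 1).trans
        (MP_eq hq₀ hq hbc (Or.inl hw) x t i).2).symm) ?_
    exact (MP_eq hq₀ hq hbc hz' x t i).2 ▸
      ((tendsto_pi_nhds.1 h2 i).div h3 (h0 ▸ h22)).mono_left hle

lemma tendsto_RHM_Dminus (hq₀ : 0 < q₀) (hq : IsClassicalSolution ε q₀ q)
    (hbc : HasNonzeroBoundary q₀ q qm qp) (hz : z ∈ SigReg q₀)
    (h11 : s11 ε q₀ q qm qp z ≠ 0) (x t : ℝ) :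
    Tendsto (RHM ε q₀ q qm qp x t) (𝓝[Dminus q₀] z) (𝓝 (MM ε q₀ q qm qp x t z)) := by
  have hbot := hbc.endData_bot
  have htop := hbc.endData_top
  have ho : (1 : ℝ) = -(-1) := (neg_neg 1).symm
  have hz' : z ∈ Dminus q₀ ∪ SigReg q₀ := Or.inr hz
  have hA := admissible_minus hq₀ hz'
  have hle : 𝓝[Dminus q₀] z ≤ 𝓝[{z | Admissible q₀ (-1) z}] z :=
    nhdsWithin_mono z fun w hw => admissible_minus hq₀ (Or.inl hw)
  have h0 : s11 ε q₀ q qm qp z = pairS q₀ q qp qm (-1) 1 t x z :=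
    wron_jost_div_gam hq htop hbot ho hA x t
  have h1 := ((continuousOn_jostSol hq htop 0 t x).mono
    fun z (h : Admissible q₀ (-1) z) => h.col_zero) z hA
  have h2 := ((continuousOn_jostSol hq hbot 1 t x).mono
    fun z (h : Admissible q₀ (-1) z) => h.col_one ho) z hA
  have h3 := continuousOn_pairS hq htop hbot ho t x z hA
  refine tendsto_pi_nhds.2 fun i => tendsto_pi_nhds.2 fun j => ?_
  fin_cases j
  · refine Tendsto.congr' (eventually_mem_nhdsWithin.mono fun w hw =>
      ((congrFun (congrFun (RHM_of_mem_Dminus hw x t) i) 0).trans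
        (MM_eq hq₀ hq hbc (Or.inl hw) x t i).1).symm) ?_
    exact (MM_eq hq₀ hq hbc hz' x t i).1 ▸
      ((tendsto_pi_nhds.1 h1 i).div h3 (h0 ▸ h11)).mono_left hle
  · refine Tendsto.congr' (eventually_mem_nhdsWithin.mono fun w hw =>
      ((congrFun (congrFun (RHM_of_mem_Dminus hw x t) i) 1).trans
        (MM_eq hq₀ hq hbc (Or.inl hw) x t i).2).symm) ?_
    exact (MM_eq hq₀ hq hbc hz' x t i).2 ▸ (tendsto_pi_nhds.1 h2 i).mono_left hle

end

section

variable {ε q₀ : ℝ} {q : ℝ → ℝ → ℂ} {c c₁ c₂ qm qp : ℂ} {l l₁ l₂ : Filter ℝ} {o o₁ o₂ : ℝ} {z : ℂ}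

/-! ### Asymptotics of the Riemann-Hilbert matrix -/

section Calculus

variable {F : Filter ℂ} {g f h : ℂ → ℂ} {a b : ℂ}

lemma tendsto_of_isBigO (hg : Tendsto g F (𝓝 0)) (hf : (fun z => f z - a) =O[F] g) :
    Tendsto f F (𝓝 a) :=
  tendsto_sub_nhds_zero_iff.1 (hf.trans_tendsto hg)

lemma isBigO_mul (hg : Tendsto g F (𝓝 0)) (hf : (fun z => f z - a) =O[F] g)
    (hh : (fun z => h z - b) =O[F] g) : (fun z => f z * h z - a * b) =O[F] g := by
  have h1 : (fun z => (f z - a) * h z) =O[F] g := by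
    simpa using hf.mul ((tendsto_of_isBigO hg hh).isBigO_one ℂ)
  exact (h1.add (hh.const_mul_left a)).congr_left fun z => by ring

lemma isBigO_div (hg : Tendsto g F (𝓝 0)) (hf : (fun z => f z - a) =O[F] g)
    (hh : (fun z => h z - b) =O[F] g) (hb : b ≠ 0) :
    (fun z => f z / h z - a / b) =O[F] g := by
  have ht := tendsto_of_isBigO hg hh
  have h1 : (fun z => ((f z - a) * b - a * (h z - b)) * (h z * b)⁻¹) =O[F] g := by
    have h2 := ((ht.mul_const b).inv₀ (mul_ne_zero hb hb)).isBigO_one ℂ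
    have h3 : (fun z => (f z - a) * b - a * (h z - b)) =O[F] g :=
      ((hf.const_mul_left b).congr_left fun z => mul_comm _ _).sub (hh.const_mul_left a)
    simpa using h3.mul h2
  refine h1.congr' ?_ EventuallyEq.rfl
  filter_upwards [ht.eventually_ne hb] with z hz
  field_simp
  ring

/-- The quotient of the entry of a column by a normalized Wronskian, with an error of the order of
those of its ingredients. -/
lemma isBigO_pair {u v : ℂ → Fin 2 → ℂ} {G : ℂ → ℂ} {α β : Fin 2 → ℂ} {Γ : ℂ}
    (hg : Tendsto g F (𝓝 0)) (hu : ∀ i, (fun z => u z i - α i) =O[F] g)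
    (hv : ∀ i, (fun z => v z i - β i) =O[F] g) (hG : (fun z => G z - Γ) =O[F] g) (hΓ : Γ ≠ 0)
    (hw : wron α β ≠ 0) (hf : (fun z => f z - a) =O[F] g) :
    (fun z => f z / (wron (u z) (v z) / G z) - a / (wron α β / Γ)) =O[F] g := by
  refine isBigO_div hg hf (isBigO_div hg ?_ hG hΓ) (div_ne_zero hw hΓ)
  exact ((isBigO_mul hg (hu 0) (hv 1)).sub (isBigO_mul hg (hu 1) (hv 0))).congr_left fun z => by
    rw [wron, wron]
    ring

end Calculus

lemma isBigO_jostSol_infty (hq : IsClassicalSolution ε q₀ q) (hE : EndData q₀ q c l o) {t : ℝ}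
    (hint : Integrable fun y => dx 1 q y t) (hb : ∃ M : ℝ, ∀ x, ‖q x t‖ ≤ M) (j : Fin 2) (x : ℝ)
    {F : Filter ℂ} (hF : F ≤ Bornology.cobounded ℂ)
    (hFA : ∀ᶠ z in F, Admissible q₀ (o * sgn j) z) (i : Fin 2) :
    (fun z => jostSol q₀ q c o z j t x i - (Pi.single j 1 : Fin 2 → ℂ) i) =O[F] fun z => 1 / z := by
  obtain ⟨C, R, hR, h⟩ := exists_jostSol_bound_infty hq hE hint hb j x
  refine IsBigO.of_bound C ?_
  filter_upwards [hFA, hF (tendsto_norm_cobounded_atTop.eventually_ge_atTop R)] with z hz hzR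
  rw [norm_div, norm_one, mul_one_div]
  exact (norm_le_pi_norm (jostSol q₀ q c o z j t x - Pi.single j 1) i).trans (h z hzR hz)

lemma isBigO_jostSol_zero (hq : IsClassicalSolution ε q₀ q) (hE : EndData q₀ q c l o)
    (hq₀ : 0 < q₀) {t : ℝ} (hint : Integrable fun y => dx 1 q y t)
    (hb : ∃ M : ℝ, ∀ x, ‖q x t‖ ≤ M) (j : Fin 2) (x : ℝ)
    {F : Filter ℂ} (hF : F ≤ 𝓝 0) (hFA : ∀ᶠ z in F, Admissible q₀ (o * sgn j) z) (i : Fin 2) :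
    (fun z => z * jostSol q₀ q c o z j t x i - (Pi.single (1 - j) (kap c j) : Fin 2 → ℂ) i)
      =O[F] fun z => z := by
  obtain ⟨C, r, hr, h⟩ := exists_jostSol_bound_zero hq hE hq₀ hint hb j x
  refine IsBigO.of_bound C ?_
  filter_upwards [hFA, hF (Metric.closedBall_mem_nhds 0 hr)] with z hz hzr
  have h1 := (norm_le_pi_norm (jostSol q₀ q c o z j t x - (kap c j / z) • Pi.single (1 - j) 1)
    i).trans (h z (by simpa using hzr) hz)
  have h2 : z * jostSol q₀ q c o z j t x i - (Pi.single (1 - j) (kap c j) : Fin 2 → ℂ) i =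
      (jostSol q₀ q c o z j t x - (kap c j / z) • Pi.single (1 - j) 1 : Fin 2 → ℂ) i * z := by
    have := hz.ne_zero
    rw [Pi.sub_apply, Pi.smul_apply, smul_eq_mul, Pi.single_apply, Pi.single_apply]
    split_ifs <;> field_simp
    ring
  rw [h2, norm_mul]
  exact mul_le_mul_of_nonneg_right h1 (norm_nonneg z)

lemma isBigO_gam_infty (q₀ : ℝ) {F : Filter ℂ} (hF : F ≤ Bornology.cobounded ℂ) :
    (fun z => gam q₀ z - 1) =O[F] fun z => 1 / z := by
  refine IsBigO.of_bound (q₀ ^ 2) ?_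
  filter_upwards [hF (tendsto_norm_cobounded_atTop.eventually_ge_atTop 1)] with z hz
  have h1 : gam q₀ z - 1 = (q₀ : ℂ) ^ 2 / z * (1 / z) := by
    rw [gam]
    ring
  rw [h1, norm_mul, norm_div, norm_pow, Complex.norm_real, Real.norm_eq_abs, sq_abs]
  exact mul_le_mul_of_nonneg_right (div_le_self (sq_nonneg _) hz) (norm_nonneg _)

lemma isBigO_gam_zero (q₀ : ℝ) {F : Filter ℂ} (hF : F ≤ 𝓝 0) (h0 : ∀ᶠ z in F, z ≠ 0) :
    (fun z => z ^ 2 * gam q₀ z - (q₀ : ℂ) ^ 2) =O[F] fun z => z := by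
  refine IsBigO.of_bound 1 ?_
  filter_upwards [h0, hF (Metric.closedBall_mem_nhds 0 one_pos)] with z hz hz1
  have h1 : z ^ 2 * gam q₀ z - (q₀ : ℂ) ^ 2 = z * z := by
    rw [gam]
    field_simp
    ring
  rw [h1, norm_mul]
  exact mul_le_mul_of_nonneg_right (by simpa using hz1) (norm_nonneg z)

/-- At infinity the normalized Wronskian tends to `1`, with error `O(1/z)`. -/
lemma isBigO_pairS_infty (hq : IsClassicalSolution ε q₀ q) (hE₁ : EndData q₀ q c₁ l₁ o₁)
    (hE₂ : EndData q₀ q c₂ l₂ o₂) (ho : o₂ = -o₁) {t : ℝ} (hint : Integrable fun y => dx 1 q y t)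
    (hb : ∃ M : ℝ, ∀ x, ‖q x t‖ ≤ M) (x : ℝ) {F : Filter ℂ} (hF : F ≤ Bornology.cobounded ℂ)
    (hFA : ∀ᶠ z in F, Admissible q₀ o₁ z) {f : ℂ → ℂ} {a : ℂ}
    (hf : (fun z => f z - a) =O[F] fun z => 1 / z) :
    (fun z => f z / pairS q₀ q c₁ c₂ o₁ o₂ t x z - a) =O[F] fun z => 1 / z := by
  have hg : Tendsto (fun z : ℂ => 1 / z) F (𝓝 0) := by
    simpa using (tendsto_inv₀_cobounded (α := ℂ)).mono_left hF
  have hw : wron (Pi.single 0 1) (Pi.single 1 1) = 1 := by simp [wron]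
  have h1 := isBigO_pair hg
    (isBigO_jostSol_infty hq hE₁ hint hb 0 x hF (hFA.mono fun _ h => h.col_zero))
    (isBigO_jostSol_infty hq hE₂ hint hb 1 x hF (hFA.mono fun _ h => h.col_one ho))
    (isBigO_gam_infty q₀ hF) one_ne_zero (by rw [hw]; exact one_ne_zero) hf
  rw [hw, div_one, div_one] at h1
  exact h1

/-- At zero the normalized Wronskian tends to `c₁^* c₂ / q₀²`, with error `O(z)`: the poles of the
two columns cancel that of `γ`. -/
lemma isBigO_pairS_zero (hq : IsClassicalSolution ε q₀ q) (hE₁ : EndData q₀ q c₁ l₁ o₁)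
    (hE₂ : EndData q₀ q c₂ l₂ o₂) (ho : o₂ = -o₁) (hq₀ : 0 < q₀) {t : ℝ}
    (hint : Integrable fun y => dx 1 q y t)
    (hb : ∃ M : ℝ, ∀ x, ‖q x t‖ ≤ M) (x : ℝ) {F : Filter ℂ} (hF : F ≤ 𝓝 0)
    (hFA : ∀ᶠ z in F, Admissible q₀ o₁ z) {f : ℂ → ℂ} {a : ℂ}
    (hf : (fun z => z * f z - a) =O[F] fun z => z) :
    (fun z => z * (f z / pairS q₀ q c₁ c₂ o₁ o₂ t x z)
      - a * ((q₀ : ℂ) ^ 2 / (conj c₁ * c₂))) =O[F] fun z => z := by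
  have h0 : (q₀ : ℂ) ^ 2 ≠ 0 := pow_ne_zero 2 (by exact_mod_cast hq₀.ne')
  have hne : ∀ c : ℂ, ‖c‖ = q₀ → c ≠ 0 := fun c h => norm_pos_iff.1 (h ▸ hq₀)
  have hc₁ : conj c₁ ≠ 0 := (map_ne_zero _).2 (hne c₁ hE₁.norm_c)
  have hc₂ := hne c₂ hE₂.norm_c
  have hw : wron (Pi.single (1 - 0) (kap c₁ 0)) (Pi.single (1 - 1) (kap c₂ 1)) = conj c₁ * c₂ := by
    simp [wron, kap]
    linear_combination (-(conj c₁ * c₂)) * Complex.I_sq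
  have h1 := isBigO_pair hF
    (isBigO_jostSol_zero hq hE₁ hq₀ hint hb 0 x hF (hFA.mono fun _ h => h.col_zero))
    (isBigO_jostSol_zero hq hE₂ hq₀ hint hb 1 x hF (hFA.mono fun _ h => h.col_one ho))
    (isBigO_gam_zero q₀ hF (hFA.mono fun _ h => h.ne_zero)) h0
    (by rw [hw]; exact mul_ne_zero hc₁ hc₂) hf
  rw [hw] at h1
  refine h1.congr' ?_ EventuallyEq.rfl
  filter_upwards [hFA] with z hz
  have h2 := hz.ne_zero
  have h3 : wron (fun i => z * jostSol q₀ q c₁ o₁ z 0 t x i)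
      (fun i => z * jostSol q₀ q c₂ o₂ z 1 t x i) / (z ^ 2 * gam q₀ z) =
      pairS q₀ q c₁ c₂ o₁ o₂ t x z := by
    rw [pairS, ← mul_div_mul_left _ (gam q₀ z) (pow_ne_zero 2 h2)]
    congr 1
    rw [wron, wron]
    ring
  rw [h3, div_div_eq_mul_div, mul_div_assoc, mul_div_assoc]

lemma isBigO_one_of_mul {F : Filter ℂ} {f : ℂ → ℂ} {a : ℂ}
    (h0 : ∀ᶠ z in F, z ≠ 0) (h : (fun z => z * f z - a) =O[F] fun z => z) :
    (fun z => f z - a / z) =O[F] fun _ => (1 : ℂ) := by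
  refine (h.mul (isBigO_refl (fun z : ℂ => z⁻¹) F)).congr' ?_ ?_
  · filter_upwards [h0] with z hz
    field_simp
  · filter_upwards [h0] with z hz
    exact mul_inv_cancel₀ hz

/-- The branch points `± i q₀` lie on the circle `|z| = q₀`, hence away from `0` and `∞`. -/
lemma mem_sigReg_of_norm_ne (hq₀ : 0 < q₀) (hz : z ∈ Sig q₀) (h0 : z ≠ 0) (h : ‖z‖ ≠ q₀) :
    z ∈ SigReg q₀ := by
  refine ⟨hz, h0, ?_, ?_⟩ <;> rintro rfl <;> simp [abs_of_pos hq₀] at h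

lemma eventually_infty_mem (hq₀ : 0 < q₀) (D : Set ℂ) :
    ∀ᶠ z in Bornology.cobounded ℂ ⊓ 𝓟 (D ∪ Sig q₀), z ∈ D ∪ SigReg q₀ := by
  filter_upwards [mem_inf_of_right (mem_principal_self _),
    mem_inf_of_left (tendsto_norm_cobounded_atTop.eventually_gt_atTop q₀)] with z hz hzR
  refine hz.imp_right fun h => mem_sigReg_of_norm_ne hq₀ h ?_ (ne_of_gt hzR)
  exact norm_pos_iff.1 (hq₀.trans hzR)

lemma eventually_zero_mem (hq₀ : 0 < q₀) (D : Set ℂ) :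
    ∀ᶠ z in 𝓝[(D ∪ Sig q₀) \ {0}] 0, z ∈ D ∪ SigReg q₀ := by
  filter_upwards [self_mem_nhdsWithin, mem_nhdsWithin_of_mem_nhds (Metric.ball_mem_nhds 0 hq₀)]
    with z hz hzR
  exact hz.1.imp_right fun h => mem_sigReg_of_norm_ne hq₀ h hz.2
    (ne_of_lt (by simpa using hzR))

lemma isBigO_MP_infty (hq₀ : 0 < q₀) (hq : IsClassicalSolution ε q₀ q)
    (hbc : HasNonzeroBoundary q₀ q qm qp) {t : ℝ} (hint : Integrable fun y => dx 1 q y t)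
    (x : ℝ) (i j : Fin 2) :
    (fun z => MP ε q₀ q qm qp x t z i j - (1 : Matrix (Fin 2) (Fin 2) ℂ) i j)
      =O[Bornology.cobounded ℂ ⊓ 𝓟 (Dplus q₀ ∪ Sig q₀)] fun z => 1 / z := by
  have hbot := hbc.endData_bot
  have htop := hbc.endData_top
  have hb := hbc.exists_bound hq t
  have hmem := eventually_infty_mem hq₀ (Dplus q₀)
  have hA := hmem.mono fun _ h => admissible_plus hq₀ h
  have h1 := isBigO_jostSol_infty hq hbot hint hb 0 x inf_le_left
    (hA.mono fun _ h => h.col_zero) i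
  have h2 := isBigO_pairS_infty hq hbot htop rfl hint hb x inf_le_left hA
    (isBigO_jostSol_infty hq htop hint hb 1 x inf_le_left (hA.mono fun _ h => h.col_one rfl) i)
  fin_cases j
  · refine h1.congr' (hmem.mono fun z hz => ?_) EventuallyEq.rfl
    simp only [Fin.zero_eta, (MP_eq hq₀ hq hbc hz x t i).1, Pi.single_apply, Matrix.one_apply]
  · refine h2.congr' (hmem.mono fun z hz => ?_) EventuallyEq.rfl
    simp only [Fin.mk_one, (MP_eq hq₀ hq hbc hz x t i).2, Pi.single_apply, Matrix.one_apply]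

lemma isBigO_MM_infty (hq₀ : 0 < q₀) (hq : IsClassicalSolution ε q₀ q)
    (hbc : HasNonzeroBoundary q₀ q qm qp) {t : ℝ} (hint : Integrable fun y => dx 1 q y t)
    (x : ℝ) (i j : Fin 2) :
    (fun z => MM ε q₀ q qm qp x t z i j - (1 : Matrix (Fin 2) (Fin 2) ℂ) i j)
      =O[Bornology.cobounded ℂ ⊓ 𝓟 (Dminus q₀ ∪ Sig q₀)] fun z => 1 / z := by
  have hbot := hbc.endData_bot
  have htop := hbc.endData_top
  have ho : (1 : ℝ) = -(-1) := (neg_neg 1).symm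
  have hb := hbc.exists_bound hq t
  have hmem := eventually_infty_mem hq₀ (Dminus q₀)
  have hA := hmem.mono fun _ h => admissible_minus hq₀ h
  have h1 := isBigO_pairS_infty hq htop hbot ho hint hb x inf_le_left hA
    (isBigO_jostSol_infty hq htop hint hb 0 x inf_le_left (hA.mono fun _ h => h.col_zero) i)
  have h2 := isBigO_jostSol_infty hq hbot hint hb 1 x inf_le_left
    (hA.mono fun _ h => h.col_one ho) i
  fin_cases j
  · refine h1.congr' (hmem.mono fun z hz => ?_) EventuallyEq.rfl
    simp only [Fin.zero_eta, (MM_eq hq₀ hq hbc hz x t i).1, Pi.single_apply, Matrix.one_apply]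
  · refine h2.congr' (hmem.mono fun z hz => ?_) EventuallyEq.rfl
    simp only [Fin.mk_one, (MM_eq hq₀ hq hbc hz x t i).2, Pi.single_apply, Matrix.one_apply]

lemma smul_sigma3_potMat (c z : ℂ) (i : Fin 2) :
    (-(Complex.I / z) • (sigma3 * potMat c)) i 0 =
      (Pi.single (1 - 0) (kap c 0) : Fin 2 → ℂ) i / z ∧
    (-(Complex.I / z) • (sigma3 * potMat c)) i 1 =
      (Pi.single (1 - 1) (kap c 1) : Fin 2 → ℂ) i / z := by
  fin_cases i <;> simp [sigma3, potMat, kap] <;> ring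

lemma isBigO_MP_zero (hq₀ : 0 < q₀) (hq : IsClassicalSolution ε q₀ q)
    (hbc : HasNonzeroBoundary q₀ q qm qp) {t : ℝ} (hint : Integrable fun y => dx 1 q y t)
    (x : ℝ) (i j : Fin 2) :
    (fun z => MP ε q₀ q qm qp x t z i j - (-(Complex.I / z) • (sigma3 * potMat qm)) i j)
      =O[𝓝[(Dplus q₀ ∪ Sig q₀) \ {0}] (0 : ℂ)] fun _ => (1 : ℂ) := by
  have hbot := hbc.endData_bot
  have htop := hbc.endData_top
  have hb := hbc.exists_bound hq t
  have hmem := eventually_zero_mem hq₀ (Dplus q₀)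
  have hA := hmem.mono fun _ h => admissible_plus hq₀ h
  have h1 := isBigO_one_of_mul (hA.mono fun _ h => h.ne_zero) (isBigO_jostSol_zero hq hbot hq₀
    hint hb 0 x inf_le_left (hA.mono fun _ h => h.col_zero) i)
  have h2 := isBigO_one_of_mul (hA.mono fun _ h => h.ne_zero) (isBigO_pairS_zero hq hbot htop rfl
    hq₀ hint hb x inf_le_left hA
    (isBigO_jostSol_zero hq htop hq₀ hint hb 1 x inf_le_left (hA.mono fun _ h => h.col_one rfl) i))
  fin_cases j
  · refine h1.congr' (hmem.mono fun z hz => ?_) EventuallyEq.rfl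
    simp only [Fin.zero_eta, (MP_eq hq₀ hq hbc hz x t i).1, (smul_sigma3_potMat qm z i).1]
  · refine h2.congr' (hmem.mono fun z hz => ?_) EventuallyEq.rfl
    simp only [Fin.mk_one, (MP_eq hq₀ hq hbc hz x t i).2, (smul_sigma3_potMat qm z i).2]
    have hm : qm ≠ 0 := norm_pos_iff.1 (hbc.norm_qm ▸ hq₀)
    have hp : qp ≠ 0 := norm_pos_iff.1 (hbc.norm_qp ▸ hq₀)
    have hm' : conj qm ≠ 0 := (map_ne_zero _).2 hm
    congr 2
    rw [← mul_conj_eq hbc.norm_qm, Pi.single_apply, Pi.single_apply]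
    split_ifs
    · simp only [kap, Matrix.cons_val_one, Matrix.cons_val_fin_one]
      field_simp
    · rw [zero_mul]

lemma isBigO_MM_zero (hq₀ : 0 < q₀) (hq : IsClassicalSolution ε q₀ q)
    (hbc : HasNonzeroBoundary q₀ q qm qp) {t : ℝ} (hint : Integrable fun y => dx 1 q y t)
    (x : ℝ) (i j : Fin 2) :
    (fun z => MM ε q₀ q qm qp x t z i j - (-(Complex.I / z) • (sigma3 * potMat qm)) i j)
      =O[𝓝[(Dminus q₀ ∪ Sig q₀) \ {0}] (0 : ℂ)] fun _ => (1 : ℂ) := by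
  have hbot := hbc.endData_bot
  have htop := hbc.endData_top
  have ho : (1 : ℝ) = -(-1) := (neg_neg 1).symm
  have hb := hbc.exists_bound hq t
  have hmem := eventually_zero_mem hq₀ (Dminus q₀)
  have hA := hmem.mono fun _ h => admissible_minus hq₀ h
  have h1 := isBigO_one_of_mul (hA.mono fun _ h => h.ne_zero) (isBigO_pairS_zero hq htop hbot ho
    hq₀ hint hb x inf_le_left hA
    (isBigO_jostSol_zero hq htop hq₀ hint hb 0 x inf_le_left (hA.mono fun _ h => h.col_zero) i))
  have h2 := isBigO_one_of_mul (hA.mono fun _ h => h.ne_zero) (isBigO_jostSol_zero hq hbot hq₀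
    hint hb 1 x inf_le_left (hA.mono fun _ h => h.col_one ho) i)
  fin_cases j
  · refine h1.congr' (hmem.mono fun z hz => ?_) EventuallyEq.rfl
    simp only [Fin.zero_eta, (MM_eq hq₀ hq hbc hz x t i).1, (smul_sigma3_potMat qm z i).1]
    have hm : qm ≠ 0 := norm_pos_iff.1 (hbc.norm_qm ▸ hq₀)
    have hp : qp ≠ 0 := norm_pos_iff.1 (hbc.norm_qp ▸ hq₀)
    have hp' : conj qp ≠ 0 := (map_ne_zero _).2 hp
    congr 2
    rw [← mul_conj_eq hbc.norm_qm, Pi.single_apply, Pi.single_apply]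
    split_ifs
    · simp only [kap, Matrix.cons_val_zero]
      field_simp
    · rw [zero_mul]
  · refine h2.congr' (hmem.mono fun z hz => ?_) EventuallyEq.rfl
    simp only [Fin.mk_one, (MM_eq hq₀ hq hbc hz x t i).2, (smul_sigma3_potMat qm z i).2]

end

end IfoNLS

end

theorem mainTheorem4 (ε q₀ : ℝ) (hq₀ : 0 < q₀) (q : ℝ → ℝ → ℂ) (qm qp : ℂ)
    (hq : IfoNLS.IsClassicalSolution ε q₀ q) (hbc : IfoNLS.HasNonzeroBoundary q₀ q qm qp) :
    -- the Jost functions exist and are unique: `φ_{-,1}`, `φ_{+,2}` on `D⁺ ∪ Σ`,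
    -- and `φ_{-,2}`, `φ_{+,1}` on `D⁻ ∪ Σ`
    (∀ z ∈ IfoNLS.Dplus q₀ ∪ IfoNLS.SigReg q₀,
      (∃! φ, IfoNLS.IsJostColumn ε q₀ q qm atBot z 0 φ) ∧
      (∃! φ, IfoNLS.IsJostColumn ε q₀ q qp atTop z 1 φ)) ∧
    (∀ z ∈ IfoNLS.Dminus q₀ ∪ IfoNLS.SigReg q₀,
      (∃! φ, IfoNLS.IsJostColumn ε q₀ q qm atBot z 1 φ) ∧
      (∃! φ, IfoNLS.IsJostColumn ε q₀ q qp atTop z 0 φ)) ∧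
    -- the scattering data do not depend on `(x,t)`
    (∀ z ∈ IfoNLS.SigReg q₀, ∀ x t : ℝ,
      IfoNLS.phiP ε q₀ q qp x t z
        = IfoNLS.phiM ε q₀ q qm x t z * IfoNLS.scatMat ε q₀ q qm qp z) ∧
    (∀ z ∈ IfoNLS.Dplus q₀, ∀ x t : ℝ,
      IfoNLS.s22 ε q₀ q qm qp z * IfoNLS.gam q₀ z
        = IfoNLS.wr (IfoNLS.phiM ε q₀ q qm x t z) (IfoNLS.phiP ε q₀ q qp x t z) 0 1) ∧
    (∀ z ∈ IfoNLS.Dminus q₀, ∀ x t : ℝ,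
      IfoNLS.s11 ε q₀ q qm qp z * IfoNLS.gam q₀ z
        = IfoNLS.wr (IfoNLS.phiP ε q₀ q qp x t z) (IfoNLS.phiM ε q₀ q qm x t z) 0 1) ∧
    -- the Riemann-Hilbert problem
    ∀ x t : ℝ,
      -- `M` is meromorphic off `Σ`
      (∀ i j, MeromorphicOn (fun z => IfoNLS.RHM ε q₀ q qm qp x t z i j) (IfoNLS.Sig q₀)ᶜ) ∧
      -- on `Σ`, `M` has the boundary values `M^±` from `D^±`, related by the jump condition
      (∀ z ∈ IfoNLS.SigReg q₀,
        IfoNLS.s11 ε q₀ q qm qp z ≠ 0 → IfoNLS.s22 ε q₀ q qm qp z ≠ 0 →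
        Tendsto (IfoNLS.RHM ε q₀ q qm qp x t) (𝓝[IfoNLS.Dplus q₀] z)
          (𝓝 (IfoNLS.MP ε q₀ q qm qp x t z)) ∧
        Tendsto (IfoNLS.RHM ε q₀ q qm qp x t) (𝓝[IfoNLS.Dminus q₀] z)
          (𝓝 (IfoNLS.MM ε q₀ q qm qp x t z)) ∧
        IfoNLS.MP ε q₀ q qm qp x t z
          = IfoNLS.MM ε q₀ q qm qp x t z * (1 - IfoNLS.jumpG ε q₀ q qm qp x t z)) ∧
      -- asymptotics at `∞` and at `0`
      (Integrable (fun y => IfoNLS.dx 1 q y t) → ∀ i j : Fin 2,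
        ((fun z => IfoNLS.MP ε q₀ q qm qp x t z i j - (1 : Matrix (Fin 2) (Fin 2) ℂ) i j)
          =O[Bornology.cobounded ℂ ⊓ 𝓟 (IfoNLS.Dplus q₀ ∪ IfoNLS.Sig q₀)] fun z => 1 / z) ∧
        ((fun z => IfoNLS.MM ε q₀ q qm qp x t z i j - (1 : Matrix (Fin 2) (Fin 2) ℂ) i j)
          =O[Bornology.cobounded ℂ ⊓ 𝓟 (IfoNLS.Dminus q₀ ∪ IfoNLS.Sig q₀)] fun z => 1 / z) ∧
        ((fun z => IfoNLS.MP ε q₀ q qm qp x t z i j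
            - (-(Complex.I / z) • (IfoNLS.sigma3 * IfoNLS.potMat qm)) i j)
          =O[𝓝[(IfoNLS.Dplus q₀ ∪ IfoNLS.Sig q₀) \ {0}] (0 : ℂ)] fun _ => (1 : ℂ)) ∧
        ((fun z => IfoNLS.MM ε q₀ q qm qp x t z i j
            - (-(Complex.I / z) • (IfoNLS.sigma3 * IfoNLS.potMat qm)) i j)
          =O[𝓝[(IfoNLS.Dminus q₀ ∪ IfoNLS.Sig q₀) \ {0}] (0 : ℂ)] fun _ => (1 : ℂ))) := by
  have hbot := hbc.endData_bot
  have htop := hbc.endData_top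
  have ho : (1 : ℝ) = -(-1) := (neg_neg 1).symm
  refine ⟨fun z hz => ?_, fun z hz => ?_, fun z hz x t =>
    IfoNLS.phiP_eq_phiM_mul_scatMat hq hbc hz x t, fun z hz x t => ?_, fun z hz x t => ?_,
    fun x t => ⟨IfoNLS.meromorphicOn_RHM hq₀ hq hbc x t, fun z hz h11 h22 =>
      ⟨IfoNLS.tendsto_RHM_Dplus hq₀ hq hbc hz h22 x t,
        IfoNLS.tendsto_RHM_Dminus hq₀ hq hbc hz h11 x t,
        IfoNLS.MP_eq_MM_mul_jump hq hbc hz h11 h22 x t⟩,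
      fun hint i j => ⟨IfoNLS.isBigO_MP_infty hq₀ hq hbc hint x i j,
        IfoNLS.isBigO_MM_infty hq₀ hq hbc hint x i j,
        IfoNLS.isBigO_MP_zero hq₀ hq hbc hint x i j,
        IfoNLS.isBigO_MM_zero hq₀ hq hbc hint x i j⟩⟩⟩
  · have hA := IfoNLS.admissible_plus hq₀ hz
    exact ⟨IfoNLS.existsUnique_isJostColumn hq hbot hA.col_zero,
      IfoNLS.existsUnique_isJostColumn hq htop (hA.col_one rfl)⟩
  · have hA := IfoNLS.admissible_minus hq₀ hz
    exact ⟨IfoNLS.existsUnique_isJostColumn hq hbot (hA.col_one ho),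
      IfoNLS.existsUnique_isJostColumn hq htop hA.col_zero⟩
  · exact IfoNLS.wron_jost_mul_gam hq hbot htop rfl
      (IfoNLS.admissible_plus hq₀ (Or.inl hz)) x t
  · exact IfoNLS.wron_jost_mul_gam hq htop hbot ho
      (IfoNLS.admissible_minus hq₀ (Or.inl hz)) x t
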